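/- **Setting.** Let $a<b$, $c<d$, $n_0,n_1,n_2\in\mathbb N$, and write $L_2^n[x]$, $L_2^n[y]$, $L_2^n[x,y]$ for the $\mathbb R^n$-valued square-integrable functions on $[a,b]$, $[c,d]$, $[a,b]\times[c,d]$. Let $H_k^n$ be the set of $v\in L_2^n[x,y]$ whose weak derivatives $\partial_x^{i}\partial_y^{j}v$, $0\le i,j\le k$, all lie in $L_2$. For such functions, values on edges and at corners are those of the representatives that are continuous along almost every line, respectively continuous on the closed rectangle. *PI operators.* An element $N\in\mathcal N_{011}\left[\begin{smallmatrix}p_0&r_0\\p_1&r_1\end{smallmatrix}\right]$ consists of a matrix $N_{00}$ and matrix-valued functions $N_{01}(x),N_{02}(y),N_{10}(x),N_{20}(y),N_{12}(x,y),N_{21}(x,y)$ and $N_{11}=\{N_{11}^0(x),N_{11}^1(x,\theta),N_{11}^2(x,\theta)\}$, $N_{22}=\{N_{22}^0(y),N_{22}^1(y,\nu),N_{22}^2(y,\nu)\}$, all square integrable and with $N_{11}^0,N_{22}^0$ essentially bounded. It defines $\mathcal P[N]:\mathbb R^{r_0}\times L_2^{r_1}[x]\times L_2^{r_1}[y]\to\mathbb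 R^{p_0}\times L_2^{p_1}[x]\times L_2^{p_1}[y]$, $$\mathcal P[N]\begin{bmatrix}v\\f\\g\end{bmatrix}=\begin{bmatrix}N_{00}v+\int_a^bN_{01}f\,dx+\int_c^dN_{02}g\,dy\\ N_{10}v+N_{11}^0f+\int_a^xN_{11}^1(x,\theta)f(\theta)d\theta+\int_x^bN_{11}^2(x,\theta)f(\theta)d\theta+\int_c^dN_{12}(x,y)g(y)dy\\ N_{20}v+\int_a^bN_{21}(x,y)f(x)dx+N_{22}^0g+\int_c^yN_{22}^1(y,\nu)g(\nu)d\nu+\int_y^dN_{22}^2(y,\nu)g(\nu)d\nu\end{bmatrix}.$$ $N$ is called separable if $N_{11}^1=N_{11}^2$ and $N_{22}^1=N_{22}^2$. *Boundary conditions.* Put $\Lambda_1v=(v(a,c),v(b,c),v(a,d),v(b,d))$, $\Lambda_2v=(v(\cdot,c),v(\cdot,d))$, $\Lambda_3v=(v(a,\cdot),v(b,\cdot))$, and for $u=(u_0,u_1,u_2)\in L_2^{n_0}\times H_1^{n_1}\times H_2^{n_2}$ $$\Lambda_{\rm bf}u=\Big(\,[\Lambda_1u_1,\Lambda_1u_2,\Lambda_1\partial_xu_2,\Lambda_1\partial_yu_2,\Lambda_1\partial_x\partial_yu_2],\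 [\Lambda_2\partial_xu_1,\Lambda_2\partial_x^2u_2,\Lambda_2\partial_x^2\partial_yu_2],\ [\Lambda_3\partial_yu_1,\Lambda_3\partial_y^2u_2,\Lambda_3\partial_x\partial_y^2u_2]\,\Big).$$ For $B\in\mathcal N_{011}\left[\begin{smallmatrix}n_1+4n_2&4n_1+16n_2\\n_1+2n_2&2n_1+4n_2\end{smallmatrix}\right]$ and $\mathcal B=\mathcal P[B]$ let $$X(\mathcal B)=\{u\in L_2^{n_0}\times H_1^{n_1}\times H_2^{n_2}:\ \mathcal B\Lambda_{\rm bf}u=0\},\quad \mathcal D u=(u_0,\ \partial_x\partial_yu_1,\ \partial_x^2\partial_y^2u_2),\quad \langle u,v\rangle_X=\langle\mathcal Du,\mathcal Dv\rangle_{L_2}.$$ *The matrices $K$ and $H$.* All scalars below multiply identity blocks, and $|$, $\oplus$ denote block columns and block-diagonal composition. Let $$K_{30}=\begin{bmatrix}0&0&0&0&0\\I_{n_1}&0&0&0&0\\0&1&x-a&y-c&(y-c)(x-a)\end{bmatrix},\quad K_{31}(x,y,\theta)=\begin{bmatrix}0&0&0\\I_{n_1}&0&0\\0&x-\theta&(y-c)(x-\theta)\end{bmatrix},$$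 $$K_{32}(x,y,\nu)=\begin{bmatrix}0&0&0\\I_{n_1}&0&0\\0&y-\nu&(x-a)(y-\nu)\end{bmatrix},\quad K_{33}(x,y,\theta,\nu)=\begin{bmatrix}0&0&0\\0&I_{n_1}&0\\0&0&(x-\theta)(y-\nu)\end{bmatrix}.$$ With $\ell=b-a$, $h=d-c$, $\xi=b-x$, $\zeta=d-y$, and $(1,1,1,1)^T$ etc. meaning stacked multiples of $I_{n_1}$ or $I_{n_2}$, $$H_{00}=\begin{bmatrix}1\\1\\1\\1\end{bmatrix}\oplus\begin{bmatrix}1&0&0&0\\1&\ell&0&0\\1&0&h&0\\1&\ell&h&h\ell\\0&1&0&0\\0&1&0&0\\0&1&0&h\\0&1&0&h\\0&0&1&0\\0&0&1&\ell\\0&0&1&0\\0&0&1&\ell\\0&0&0&1\\0&0&0&1\\0&0&0&1\\0&0&0&1\end{bmatrix},\quad H_{01}(x)=\begin{bmatrix}0\\1\\0\\1\end{bmatrix}\oplus\begin{bmatrix}0&0\\\xi&0\\0&0\\\xi&h\xi\\0&0\\1&0\\0&0\\1&h\\0&0\\0&\xi\\0&0\\0&\xi\\0&0\\0&1\\0&0\\0&1\end{bmatrix},\quad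 H_{02}(y)=\begin{bmatrix}0\\0\\1\\1\end{bmatrix}\oplus\begin{bmatrix}0&0\\0&0\\\zeta&0\\\zeta&\ell\zeta\\0&0\\0&0\\0&\zeta\\0&\zeta\\0&0\\0&0\\1&0\\1&\ell\\0&0\\0&0\\0&1\\0&1\end{bmatrix},$$ $$H_{11}=\begin{bmatrix}1\\1\end{bmatrix}\oplus\begin{bmatrix}1&0\\1&h\\0&1\\0&1\end{bmatrix},\qquad H_{22}=\begin{bmatrix}1\\1\end{bmatrix}\oplus\begin{bmatrix}1&0\\1&\ell\\0&1\\0&1\end{bmatrix},$$ and, with $n_0$ initial zero columns, $$H_{03}(x,y)=\big[\,0\ \big|\ (0,0,0,1)^T\oplus(0,0,0,\zeta\xi,0,0,0,\zeta,0,0,0,\xi,0,0,0,1)^T\big],$$ $$H_{13}(y)=\big[\,0\ \big|\ (0,1)^T\oplus(0,\zeta,0,1)^T\big],\qquad H_{23}(x)=\big[\,0\ \big|\ (0,1)^T\oplus(0,\xi,0,1)^T\big].$$ Let $\mathcal H_1=\mathcal P[H_1]$, where $H_1\in\mathcal N_{011}$ has entries $H_{00},H_{01},H_{02}$ in the first row,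 $\{H_{11},0,0\}$ and $\{H_{22},0,0\}$ on the remaining diagonal, and zeros elsewhere. $B$ defines *well-posed* boundary conditions if there is $\hat E\in\mathcal N_{011}\left[\begin{smallmatrix}n_1+4n_2&n_1+4n_2\\n_1+2n_2&n_1+2n_2\end{smallmatrix}\right]$ with $\mathcal P[\hat E]=(\mathcal B\mathcal H_1)^{-1}$. *The operator $\mathcal T$.* For separable $B$ and separable $\hat E\in\mathcal N_{011}$ with $\mathcal P[\hat E]=(\mathcal B\mathcal H_1)^{-1}$ put $$F_0(x,y)=B_{00}H_{03}(x,y)+B_{01}(x)H_{13}(y)+B_{02}(y)H_{23}(x),\quad F_1^0(x,y)=B_{11}^0(x)H_{13}(y),\quad F_2^0(x,y)=B_{22}^0(y)H_{23}(x),$$ $$F_1^1(x,y,\theta)=B_{10}(x)H_{03}(\theta,y)+B_{11}^1(x,\theta)H_{13}(y)+B_{12}(x,y)H_{23}(\theta),$$ $$F_2^1(x,y,\nu)=B_{20}(y)H_{03}(x,\nu)+B_{22}^1(y,\nu)H_{23}(x)+B_{21}(x,y)H_{13}(\nu),$$ $$G_0(x,y)=\hat E_{00}F_0(x,y)+\hat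 E_{01}(x)F_1^0(x,y)+\int_a^b\hat E_{01}(\theta)F_1^1(\theta,y,x)d\theta+\hat E_{02}(y)F_2^0(x,y)+\int_c^d\hat E_{02}(\nu)F_2^1(x,\nu,y)d\nu,$$ $$G_1^0(x,y)=\hat E_{11}^0(x)F_1^0(x,y),\qquad G_2^0(x,y)=\hat E_{22}^0(y)F_2^0(x,y),$$ $$G_1^1(x,y,\theta)=\hat E_{10}(x)F_0(\theta,y)+\hat E_{11}^0(x)F_1^1(x,y,\theta)+\hat E_{11}^1(x,\theta)F_1^0(\theta,y)+\int_a^b\hat E_{11}^1(x,\eta)F_1^1(\eta,y,\theta)d\eta+\hat E_{12}(x,y)F_2^0(\theta,y)+\int_c^d\hat E_{12}(x,\nu)F_2^1(\theta,\nu,y)d\nu,$$ $$G_2^1(x,y,\nu)=\hat E_{20}(y)F_0(x,\nu)+\hat E_{22}^0(y)F_2^1(x,y,\nu)+\hat E_{22}^1(y,\nu)F_2^0(x,\nu)+\int_c^d\hat E_{22}^1(y,\mu)F_2^1(x,\mu,\nu)d\mu+\hat E_{21}(x,y)F_1^0(x,\nu)+\int_a^b\hat E_{21}(\theta,y)F_1^1(\theta,\nu,x)d\theta,$$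 $$T_{22}(x,y,\theta,\nu)=-K_{30}(x,y)G_0(\theta,\nu)-\int_a^xK_{31}(x,y,\eta)G_1^1(\eta,\nu,\theta)d\eta-\int_c^yK_{32}(x,y,\mu)G_2^1(\theta,\mu,\nu)d\mu,$$ $$T_{12}=-K_{31}(x,y,\theta)G_1^0(\theta,\nu)+T_{22},\quad T_{21}=-K_{32}(x,y,\nu)G_2^0(\theta,\nu)+T_{22},\quad T_{11}=K_{33}+T_{21}+T_{12}-T_{22},$$ $$(\mathcal T\hat u)(x,y)=\begin{bmatrix}\hat u_0(x,y)\\0\\0\end{bmatrix}+\int_a^x\!\!\int_c^yT_{11}\hat u\,d\nu d\theta+\int_x^b\!\!\int_c^yT_{21}\hat u\,d\nu d\theta+\int_a^x\!\!\int_y^dT_{12}\hat u\,d\nu d\theta+\int_x^b\!\!\int_y^dT_{22}\hat u\,d\nu d\theta,$$ where $\hat u=\hat u(\theta,\nu)$ and $T_{ij}=T_{ij}(x,y,\theta,\nu)$ under the integrals. *Explicit inverse.* Let $E\in\mathcal N_{011}$ be the separable parameters of $\mathcal B\mathcal H_1$: $E_{00}=B_{00}H_{00}$, $E_{01}=B_{00}H_{01}+B_{01}H_{11}$,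 $E_{02}=B_{00}H_{02}+B_{02}H_{22}$, $E_{10}=B_{10}H_{00}$, $E_{20}=B_{20}H_{00}$, $E_{11}^0=B_{11}^0H_{11}$, $E_{22}^0=B_{22}^0H_{22}$, $E_{11}^1(x,\theta)=B_{10}(x)H_{01}(\theta)+B_{11}^1(x,\theta)H_{11}$, $E_{22}^1(y,\nu)=B_{20}(y)H_{02}(\nu)+B_{22}^1(y,\nu)H_{22}$, $E_{12}(x,y)=B_{10}(x)H_{02}(y)+B_{12}(x,y)H_{22}$, $E_{21}(x,y)=B_{20}(y)H_{01}(x)+B_{21}(x,y)H_{11}$. Suppose that for some $q\in\mathbb N$ there are square-integrable $Z(x),Z(y)$ with $q$ rows and constant matrices with, almost everywhere, $$E_{01}=H_{0x}Z(x),\ E_{02}=H_{0y}Z(y),\ E_{10}=Z(x)^TH_{x0},\ E_{20}=Z(y)^TH_{y0},\ E_{11}^1=Z(x)^T\Gamma_{xx}Z(\theta),$$ $$E_{12}=Z(x)^T\Gamma_{xy}Z(y),\ E_{21}=Z(y)^T\Gamma_{yx}Z(x),\ E_{22}^1=Z(y)^T\Gamma_{yy}Z(\nu)$$ (the factors $Z(x)$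 and $Z(y)$ may be different functions). Put $K_{xx}=\int_a^bZ(E_{11}^0)^{-1}Z^Tdx$, $K_{yy}=\int_c^dZ(E_{22}^0)^{-1}Z^Tdy$, $\Pi_{rs}=\Gamma_{rs}-H_{r0}E_{00}^{-1}H_{0s}$ for $r,s\in\{x,y\}$, $\Sigma_x=I+K_{xx}\Pi_{xx}$, $\Sigma_y=I+K_{yy}\Pi_{yy}$, $\mathrm E_{xy}=\Sigma_x^{-1}K_{xx}\Pi_{xy}$, $\mathrm E_{yx}=\Sigma_y^{-1}K_{yy}\Pi_{yx}$, $R_x=\Sigma_x-K_{xx}\Pi_{xy}\mathrm E_{yx}$, $R_y=\Sigma_y-K_{yy}\Pi_{yx}\mathrm E_{xy}$, and $$\hat\Gamma_{yx}=-(\Pi_{yx}-\Pi_{yy}\mathrm E_{yx})R_x^{-1},\quad\hat\Gamma_{xy}=-(\Pi_{xy}-\Pi_{xx}\mathrm E_{xy})R_y^{-1},$$ $$\hat\Gamma_{yy}=-(\Pi_{yy}+\hat\Gamma_{yx}K_{xx}\Pi_{xy})\Sigma_y^{-1},\quad\hat\Gamma_{xx}=-(\Pi_{xx}+\hat\Gamma_{xy}K_{yy}\Pi_{yx})\Sigma_x^{-1},$$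 $$\hat H_{y0}=-(H_{y0}+\hat\Gamma_{yy}K_{yy}H_{y0}+\hat\Gamma_{yx}K_{xx}H_{x0})E_{00}^{-1},\quad\hat H_{x0}=-(H_{x0}+\hat\Gamma_{xx}K_{xx}H_{x0}+\hat\Gamma_{xy}K_{yy}H_{y0})E_{00}^{-1},$$ $$\hat H_{0y}=-(E_{00}^{-1}H_{0y}-E_{00}^{-1}H_{0x}\mathrm E_{xy})R_y^{-1},\quad\hat H_{0x}=-(E_{00}^{-1}H_{0x}+\hat H_{0y}K_{yy}\Pi_{yx})\Sigma_x^{-1}.$$ Provided $E_{00},\Sigma_x,\Sigma_y,R_x,R_y$ are invertible, $\mathcal L_{\rm inv}(E)$ denotes the separable parameters $\hat E$ with $\hat E_{00}=(I-\hat H_{0x}K_{xx}H_{x0}-\hat H_{0y}K_{yy}H_{y0})E_{00}^{-1}$, $\hat E_{11}^0=(E_{11}^0)^{-1}$, $\hat E_{22}^0=(E_{22}^0)^{-1}$, $\hat E_{01}=\hat H_{0x}Z(x)\hat E_{11}^0(x)$, $\hat E_{02}=\hat H_{0y}Z(y)\hat E_{22}^0(y)$, $\hat E_{10}=\hat E_{11}^0(x)Z(x)^T\hat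 H_{x0}$, $\hat E_{20}=\hat E_{22}^0(y)Z(y)^T\hat H_{y0}$, $\hat E_{11}^1=\hat E_{11}^0(x)Z(x)^T\hat\Gamma_{xx}Z(\theta)\hat E_{11}^0(\theta)$, $\hat E_{12}=\hat E_{11}^0(x)Z(x)^T\hat\Gamma_{xy}Z(y)\hat E_{22}^0(y)$, $\hat E_{21}=\hat E_{22}^0(y)Z(y)^T\hat\Gamma_{yx}Z(x)\hat E_{11}^0(x)$, $\hat E_{22}^1=\hat E_{22}^0(y)Z(y)^T\hat\Gamma_{yy}Z(\nu)\hat E_{22}^0(\nu)$. **Statement.** Let $B\in\mathcal N_{011}$ be separable and define well-posed boundary conditions. Then: 1. There is a separable $\hat E\in\mathcal N_{011}$ with $\mathcal P[\hat E]=(\mathcal B\mathcal H_1)^{-1}$. Whenever $E$ has a decomposition as above for which $E_{00},\Sigma_x,\Sigma_y,R_x,R_y$ are invertible, $\hat E=\mathcal L_{\rm inv}(E)$ is such an element. 2. For every such $\hat E$, the operator $\mathcal T$ is a well-defined linear map from $L_2^{n_0+n_1+n_2}[x,y]$ to $X(\mathcal B)$, it is surjective onto $X(\mathcal B)$, and it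 is unitary with respect to $\langle\cdot,\cdot\rangle_X$: for all $\hat u,\hat v\in L_2^{n_0+n_1+n_2}[x,y]$, $$\langle\mathcal T\hat u,\mathcal T\hat v\rangle_X=\langle\mathcal D\mathcal T\hat u,\mathcal D\mathcal T\hat v\rangle_{L_2}=\langle\hat u,\hat v\rangle_{L_2}.$$ -/

import Mathlib

open MeasureTheory Set Matrix
open scoped ENNReal

noncomputable section

namespace PIE2D

/-! ### Domain and `L₂` spaces -/

/-- Lebesgue measure on the interval `[a, b]`. -/
def mu1 (a b : ℝ) : Measure ℝ := volume.restrict (Icc a b)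

/-- Lebesgue measure on the rectangle `[a, b] × [c, d]`. -/
def mu2 (a b c d : ℝ) : Measure (ℝ × ℝ) := volume.restrict (Icc a b ×ˢ Icc c d)

/-- A matrix-valued function with all entries in `Lᵖ(μ)`. -/
def MatMemLp {α ι κ : Type*} [MeasurableSpace α] (N : α → Matrix ι κ ℝ) (p : ℝ≥0∞)
    (μ : Measure α) : Prop :=
  ∀ i j, MemLp (fun t => N t i j) p μ

/-- The entrywise integral `∫_s^t M(τ) dτ` of a matrix-valued function. -/
def mInt {ι κ : Type*} (s t : ℝ) (M : ℝ → Matrix ι κ ℝ) : Matrix ι κ ℝ :=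
  Matrix.of fun i j => ∫ τ in s..t, M τ i j

/-! ### 011-PI operators -/

/-- Parameters of a 011-PI operator with inputs in `ℝ^r₀ × L₂^r₁[x] × L₂^r₁[y]` and outputs in
`ℝ^p₀ × L₂^p₁[x] × L₂^p₁[y]`.  The diagonal entries `B₁₁ = {B₁₁⁰, B₁₁¹, B₁₁²}` and
`B₂₂ = {B₂₂⁰, B₂₂¹, B₂₂²}` are parameters of 1D-PI operators. Both `N12` and `N21` take their
arguments in the order `(x, y)`. -/
structure Param011 (p₀ p₁ r₀ r₁ : Type) where
  N00 : Matrix p₀ r₀ ℝ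
  N01 : ℝ → Matrix p₀ r₁ ℝ
  N02 : ℝ → Matrix p₀ r₁ ℝ
  N10 : ℝ → Matrix p₁ r₀ ℝ
  N11_0 : ℝ → Matrix p₁ r₁ ℝ
  N11_1 : ℝ → ℝ → Matrix p₁ r₁ ℝ
  N11_2 : ℝ → ℝ → Matrix p₁ r₁ ℝ
  N12 : ℝ → ℝ → Matrix p₁ r₁ ℝ
  N20 : ℝ → Matrix p₁ r₀ ℝ
  N21 : ℝ → ℝ → Matrix p₁ r₁ ℝ
  N22_0 : ℝ → Matrix p₁ r₁ ℝ
  N22_1 : ℝ → ℝ → Matrix p₁ r₁ ℝ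
  N22_2 : ℝ → ℝ → Matrix p₁ r₁ ℝ

/-- Membership in the parameter space `𝒩₀₁₁`: all parameters are square integrable, and the two
multipliers acting on `L₂[x]` and `L₂[y]` are essentially bounded, which is exactly what is needed
for multiplication by them to map `L₂` to `L₂`. -/
structure Param011.Mem {p₀ p₁ r₀ r₁ : Type} (a b c d : ℝ) (N : Param011 p₀ p₁ r₀ r₁) : Prop where
  mem01 : MatMemLp N.N01 2 (mu1 a b)
  mem02 : MatMemLp N.N02 2 (mu1 c d)
  mem10 : MatMemLp N.N10 2 (mu1 a b)
  mem11_0 : MatMemLp N.N11_0 ∞ (mu1 a b)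
  mem11_1 : MatMemLp (fun z : ℝ × ℝ => N.N11_1 z.1 z.2) 2 (mu2 a b a b)
  mem11_2 : MatMemLp (fun z : ℝ × ℝ => N.N11_2 z.1 z.2) 2 (mu2 a b a b)
  mem12 : MatMemLp (fun z : ℝ × ℝ => N.N12 z.1 z.2) 2 (mu2 a b c d)
  mem20 : MatMemLp N.N20 2 (mu1 c d)
  mem21 : MatMemLp (fun z : ℝ × ℝ => N.N21 z.1 z.2) 2 (mu2 a b c d)
  mem22_0 : MatMemLp N.N22_0 ∞ (mu1 c d)
  mem22_1 : MatMemLp (fun z : ℝ × ℝ => N.N22_1 z.1 z.2) 2 (mu2 c d c d)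
  mem22_2 : MatMemLp (fun z : ℝ × ℝ => N.N22_2 z.1 z.2) 2 (mu2 c d c d)

/-- The 1D parameters are separable, i.e. of the form `{N⁰, N¹, N¹}`. -/
def Param011.Separable {p₀ p₁ r₀ r₁ : Type} (N : Param011 p₀ p₁ r₀ r₁) : Prop :=
  N.N11_1 = N.N11_2 ∧ N.N22_1 = N.N22_2

/-- Triples `(v, f, g)` representing elements of `ℝ^r₀ × L₂^r₁[x] × L₂^r₁[y]`. -/
abbrev RL (r₀ r₁ : Type) : Type := (r₀ → ℝ) × (ℝ → r₁ → ℝ) × (ℝ → r₁ → ℝ)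

/-- The two function components are square integrable. -/
def RL.Mem {r₀ r₁ : Type} [Fintype r₁] (a b c d : ℝ) (w : RL r₀ r₁) : Prop :=
  MemLp w.2.1 2 (mu1 a b) ∧ MemLp w.2.2 2 (mu1 c d)

/-- Equality as elements of `ℝ^r₀ × L₂^r₁[x] × L₂^r₁[y]`. -/
def RL.Eq {r₀ r₁ : Type} (a b c d : ℝ) (w w' : RL r₀ r₁) : Prop :=
  w.1 = w'.1 ∧ w.2.1 =ᵐ[mu1 a b] w'.2.1 ∧ w.2.2 =ᵐ[mu1 c d] w'.2.2

/-- The 1D-PI operator on `[a, b]` with parameters `{N⁰, N¹, N²}`. -/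
def P1D {p r : Type} [Fintype p] [Fintype r] (a b : ℝ) (N0 : ℝ → Matrix p r ℝ)
    (N1 N2 : ℝ → ℝ → Matrix p r ℝ) (f : ℝ → r → ℝ) : ℝ → p → ℝ := fun x =>
  N0 x *ᵥ f x + (∫ θ in a..x, N1 x θ *ᵥ f θ) + ∫ θ in x..b, N2 x θ *ᵥ f θ

/-- The 011-PI operator `𝒫[N]`. -/
def P011 {p₀ p₁ r₀ r₁ : Type} [Fintype p₀] [Fintype p₁] [Fintype r₀] [Fintype r₁] (a b c d : ℝ)
    (N : Param011 p₀ p₁ r₀ r₁) (w : RL r₀ r₁) : RL p₀ p₁ :=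
  (N.N00 *ᵥ w.1 + (∫ x in a..b, N.N01 x *ᵥ w.2.1 x) + ∫ y in c..d, N.N02 y *ᵥ w.2.2 y,
   fun x => N.N10 x *ᵥ w.1 + P1D a b N.N11_0 N.N11_1 N.N11_2 w.2.1 x
     + ∫ y in c..d, N.N12 x y *ᵥ w.2.2 y,
   fun y => N.N20 y *ᵥ w.1 + (∫ x in a..b, N.N21 x y *ᵥ w.2.1 x)
     + P1D c d N.N22_0 N.N22_1 N.N22_2 w.2.2 y)

/-! ### 2D-PI operators -/

/-- Parameters of a 2D-PI operator on `L₂^ι[x, y]`. -/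
structure Param2D (ι : Type) where
  N00 : ℝ → ℝ → Matrix ι ι ℝ
  N01 : ℝ → ℝ → ℝ → Matrix ι ι ℝ
  N02 : ℝ → ℝ → ℝ → Matrix ι ι ℝ
  N10 : ℝ → ℝ → ℝ → Matrix ι ι ℝ
  N20 : ℝ → ℝ → ℝ → Matrix ι ι ℝ
  N11 : ℝ → ℝ → ℝ → ℝ → Matrix ι ι ℝ
  N21 : ℝ → ℝ → ℝ → ℝ → Matrix ι ι ℝ
  N12 : ℝ → ℝ → ℝ → ℝ → Matrix ι ι ℝ
  N22 : ℝ → ℝ → ℝ → ℝ → Matrix ι ι ℝ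

/-- The 2D-PI operator `𝒫[N]`. -/
def P2D {ι : Type} [Fintype ι] (a b c d : ℝ) (N : Param2D ι) (u : ℝ × ℝ → ι → ℝ) :
    ℝ × ℝ → ι → ℝ := fun z =>
  let x := z.1
  let y := z.2
  N.N00 x y *ᵥ u (x, y)
    + (∫ θ in a..x, N.N10 x y θ *ᵥ u (θ, y)) + (∫ θ in x..b, N.N20 x y θ *ᵥ u (θ, y))
    + (∫ ν in c..y, N.N01 x y ν *ᵥ u (x, ν)) + (∫ ν in y..d, N.N02 x y ν *ᵥ u (x, ν))
    + (∫ θ in a..x, ∫ ν in c..y, N.N11 x y θ ν *ᵥ u (θ, ν))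
    + (∫ θ in x..b, ∫ ν in c..y, N.N21 x y θ ν *ᵥ u (θ, ν))
    + (∫ θ in a..x, ∫ ν in y..d, N.N12 x y θ ν *ᵥ u (θ, ν))
    + (∫ θ in x..b, ∫ ν in y..d, N.N22 x y θ ν *ᵥ u (θ, ν))

/-! ### Index types for the state and for its boundary values -/

/-- Indices of the state `(u₀, u₁, u₂)`, of size `n₀ + n₁ + n₂`. -/
abbrev State (n₀ n₁ n₂ : ℕ) : Type := Fin n₀ ⊕ (Fin n₁ ⊕ Fin n₂)

/-- Indices of the finite-dimensional core boundary values, of size `n₁ + 4 n₂`. -/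
abbrev Core0 (n₁ n₂ : ℕ) : Type := Fin n₁ ⊕ (Fin 4 × Fin n₂)

/-- Indices of the core boundary functions of one variable, of size `n₁ + 2 n₂`. -/
abbrev Core1 (n₁ n₂ : ℕ) : Type := Fin n₁ ⊕ (Fin 2 × Fin n₂)

/-- Indices of all corner values, of size `4 n₁ + 16 n₂`. -/
abbrev Full0 (n₁ n₂ : ℕ) : Type := (Fin 4 × Fin n₁) ⊕ (Fin 16 × Fin n₂)

/-- Indices of all boundary functions of one variable, of size `2 n₁ + 4 n₂`. -/
abbrev Full1 (n₁ n₂ : ℕ) : Type := (Fin 2 × Fin n₁) ⊕ (Fin 4 × Fin n₂)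

/-! ### The parameters `H` and `K` -/

/-- The block column with blocks `vₖ Iₙ`. -/
def colI {κ : Type} (n : ℕ) (v : κ → ℝ) : Matrix (κ × Fin n) (Fin n) ℝ :=
  Matrix.of fun p j => if p.2 = j then v p.1 else 0

/-- The block row with blocks `vₖ Iₙ`. -/
def rowI {κ : Type} (n : ℕ) (v : κ → ℝ) : Matrix (Fin n) (κ × Fin n) ℝ :=
  Matrix.of fun i p => if i = p.2 then v p.1 else 0

/-- The block matrix with blocks `Mₖₗ Iₙ`. -/
def blkI {κ l : Type} (n : ℕ) (M : Matrix κ l ℝ) : Matrix (κ × Fin n) (l × Fin n) ℝ :=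
  Matrix.of fun p p' => if p.2 = p'.2 then M p.1 p'.1 else 0

def H00 (a b c d : ℝ) (n₁ n₂ : ℕ) : Matrix (Full0 n₁ n₂) (Core0 n₁ n₂) ℝ :=
  fromBlocks (colI n₁ ![1, 1, 1, 1]) 0 0 (blkI n₂
    !![1, 0, 0, 0;
       1, b - a, 0, 0;
       1, 0, d - c, 0;
       1, b - a, d - c, (d - c) * (b - a);
       0, 1, 0, 0;
       0, 1, 0, 0;
       0, 1, 0, d - c;
       0, 1, 0, d - c;
       0, 0, 1, 0;
       0, 0, 1, b - a;
       0, 0, 1, 0;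
       0, 0, 1, b - a;
       0, 0, 0, 1;
       0, 0, 0, 1;
       0, 0, 0, 1;
       0, 0, 0, 1])

def H01 (b c d : ℝ) (n₁ n₂ : ℕ) (x : ℝ) : Matrix (Full0 n₁ n₂) (Core1 n₁ n₂) ℝ :=
  fromBlocks (colI n₁ ![0, 1, 0, 1]) 0 0 (blkI n₂
    !![0, 0;
       b - x, 0;
       0, 0;
       b - x, (d - c) * (b - x);
       0, 0;
       1, 0;
       0, 0;
       1, d - c;
       0, 0;
       0, b - x;
       0, 0;
       0, b - x;
       0, 0;
       0, 1;
       0, 0;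
       0, 1])

def H02 (a b d : ℝ) (n₁ n₂ : ℕ) (y : ℝ) : Matrix (Full0 n₁ n₂) (Core1 n₁ n₂) ℝ :=
  fromBlocks (colI n₁ ![0, 0, 1, 1]) 0 0 (blkI n₂
    !![0, 0;
       0, 0;
       d - y, 0;
       d - y, (b - a) * (d - y);
       0, 0;
       0, 0;
       0, d - y;
       0, d - y;
       0, 0;
       0, 0;
       1, 0;
       1, b - a;
       0, 0;
       0, 0;
       0, 1;
       0, 1])

def H11 (c d : ℝ) (n₁ n₂ : ℕ) : Matrix (Full1 n₁ n₂) (Core1 n₁ n₂) ℝ :=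
  fromBlocks (colI n₁ ![1, 1]) 0 0 (blkI n₂ !![1, 0; 1, d - c; 0, 1; 0, 1])

def H22 (a b : ℝ) (n₁ n₂ : ℕ) : Matrix (Full1 n₁ n₂) (Core1 n₁ n₂) ℝ :=
  fromBlocks (colI n₁ ![1, 1]) 0 0 (blkI n₂ !![1, 0; 1, b - a; 0, 1; 0, 1])

def H03 (b d : ℝ) (n₀ n₁ n₂ : ℕ) (x y : ℝ) : Matrix (Full0 n₁ n₂) (State n₀ n₁ n₂) ℝ :=
  fromCols 0 (fromBlocks (colI n₁ ![0, 0, 0, 1]) 0 0 (colI n₂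
    ![0, 0, 0, (d - y) * (b - x), 0, 0, 0, d - y, 0, 0, 0, b - x, 0, 0, 0, 1]))

def H13 (d : ℝ) (n₀ n₁ n₂ : ℕ) (y : ℝ) : Matrix (Full1 n₁ n₂) (State n₀ n₁ n₂) ℝ :=
  fromCols 0 (fromBlocks (colI n₁ ![0, 1]) 0 0 (colI n₂ ![0, d - y, 0, 1]))

def H23 (b : ℝ) (n₀ n₁ n₂ : ℕ) (x : ℝ) : Matrix (Full1 n₁ n₂) (State n₀ n₁ n₂) ℝ :=
  fromCols 0 (fromBlocks (colI n₁ ![0, 1]) 0 0 (colI n₂ ![0, b - x, 0, 1]))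

/-- The parameters `H₁`. -/
def H1Param (a b c d : ℝ) (n₁ n₂ : ℕ) :
    Param011 (Full0 n₁ n₂) (Full1 n₁ n₂) (Core0 n₁ n₂) (Core1 n₁ n₂) where
  N00 := H00 a b c d n₁ n₂
  N01 := H01 b c d n₁ n₂
  N02 := H02 a b d n₁ n₂
  N10 := 0
  N11_0 := fun _ => H11 c d n₁ n₂
  N11_1 := 0
  N11_2 := 0
  N12 := 0
  N20 := 0
  N21 := 0
  N22_0 := fun _ => H22 a b n₁ n₂
  N22_1 := 0
  N22_2 := 0

def K30 (a c : ℝ) (n₀ n₁ n₂ : ℕ) (x y : ℝ) : Matrix (State n₀ n₁ n₂) (Core0 n₁ n₂) ℝ :=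
  fromRows 0 (fromBlocks 1 0 0 (rowI n₂ ![1, x - a, y - c, (y - c) * (x - a)]))

def K31 (c : ℝ) (n₀ n₁ n₂ : ℕ) (x y θ : ℝ) : Matrix (State n₀ n₁ n₂) (Core1 n₁ n₂) ℝ :=
  fromRows 0 (fromBlocks 1 0 0 (rowI n₂ ![x - θ, (y - c) * (x - θ)]))

def K32 (a : ℝ) (n₀ n₁ n₂ : ℕ) (x y ν : ℝ) : Matrix (State n₀ n₁ n₂) (Core1 n₁ n₂) ℝ :=
  fromRows 0 (fromBlocks 1 0 0 (rowI n₂ ![y - ν, (x - a) * (y - ν)]))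

def K33 (n₀ n₁ n₂ : ℕ) (x y θ ν : ℝ) : Matrix (State n₀ n₁ n₂) (State n₀ n₁ n₂) ℝ :=
  fromBlocks 0 0 0 (fromBlocks 1 0 0 (((x - θ) * (y - ν)) • 1))

/-! ### Well-posed boundary conditions and the parameters `T` -/

/-- Parameters of a boundary operator `ℬ = 𝒫[B]`. -/
abbrev BParam (n₁ n₂ : ℕ) : Type :=
  Param011 (Core0 n₁ n₂) (Core1 n₁ n₂) (Full0 n₁ n₂) (Full1 n₁ n₂)

/-- Parameters of an operator on the core boundary values. -/
abbrev CoreParam (n₁ n₂ : ℕ) : Type :=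
  Param011 (Core0 n₁ n₂) (Core1 n₁ n₂) (Core0 n₁ n₂) (Core1 n₁ n₂)

/-- `𝒫[Ê] = (ℬ ℋ₁)⁻¹` as operators on `ℝ^(n₁+4n₂) × L₂^(n₁+2n₂)[x] × L₂^(n₁+2n₂)[y]`. -/
def IsInverse (a b c d : ℝ) {n₁ n₂ : ℕ} (B : BParam n₁ n₂) (Ehat : CoreParam n₁ n₂) : Prop :=
  ∀ w : RL (Core0 n₁ n₂) (Core1 n₁ n₂), RL.Mem a b c d w →
    RL.Eq a b c d (P011 a b c d Ehat (P011 a b c d B (P011 a b c d (H1Param a b c d n₁ n₂) w))) w ∧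
    RL.Eq a b c d (P011 a b c d B (P011 a b c d (H1Param a b c d n₁ n₂) (P011 a b c d Ehat w))) w

/-- `B` defines well-posed boundary conditions: `ℬ ℋ₁` has an inverse that is a 011-PI operator. -/
def WellPosed (a b c d : ℝ) {n₁ n₂ : ℕ} (B : BParam n₁ n₂) : Prop :=
  ∃ Ehat : CoreParam n₁ n₂, Ehat.Mem a b c d ∧ IsInverse a b c d B Ehat

/-- `Ê ∈ 𝒩₀₁₁` is separable and `𝒫[Ê] = (ℬ ℋ₁)⁻¹`. -/
structure InverseParam (a b c d : ℝ) {n₁ n₂ : ℕ} (B : BParam n₁ n₂) (Ehat : CoreParam n₁ n₂) :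
    Prop where
  mem : Ehat.Mem a b c d
  separable : Ehat.Separable
  inverse : IsInverse a b c d B Ehat

section TMatrices

variable (a b c d : ℝ) (n₀ : ℕ) {n₁ n₂ : ℕ} (B : BParam n₁ n₂) (Ehat : CoreParam n₁ n₂)

def F0 (x y : ℝ) : Matrix (Core0 n₁ n₂) (State n₀ n₁ n₂) ℝ :=
  B.N00 * H03 b d n₀ n₁ n₂ x y + B.N01 x * H13 d n₀ n₁ n₂ y + B.N02 y * H23 b n₀ n₁ n₂ x

def F1_0 (x y : ℝ) : Matrix (Core1 n₁ n₂) (State n₀ n₁ n₂) ℝ :=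
  B.N11_0 x * H13 d n₀ n₁ n₂ y

def F1_1 (x y θ : ℝ) : Matrix (Core1 n₁ n₂) (State n₀ n₁ n₂) ℝ :=
  B.N10 x * H03 b d n₀ n₁ n₂ θ y + B.N11_1 x θ * H13 d n₀ n₁ n₂ y + B.N12 x y * H23 b n₀ n₁ n₂ θ

def F2_0 (x y : ℝ) : Matrix (Core1 n₁ n₂) (State n₀ n₁ n₂) ℝ :=
  B.N22_0 y * H23 b n₀ n₁ n₂ x

def F2_1 (x y ν : ℝ) : Matrix (Core1 n₁ n₂) (State n₀ n₁ n₂) ℝ :=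
  B.N20 y * H03 b d n₀ n₁ n₂ x ν + B.N22_1 y ν * H23 b n₀ n₁ n₂ x + B.N21 x y * H13 d n₀ n₁ n₂ ν

def G0 (x y : ℝ) : Matrix (Core0 n₁ n₂) (State n₀ n₁ n₂) ℝ :=
  Ehat.N00 * F0 b d n₀ B x y
    + Ehat.N01 x * F1_0 d n₀ B x y + mInt a b (fun θ => Ehat.N01 θ * F1_1 b d n₀ B θ y x)
    + Ehat.N02 y * F2_0 b n₀ B x y + mInt c d (fun ν => Ehat.N02 ν * F2_1 b d n₀ B x ν y)

def G1_0 (x y : ℝ) : Matrix (Core1 n₁ n₂) (State n₀ n₁ n₂) ℝ :=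
  Ehat.N11_0 x * F1_0 d n₀ B x y

def G1_1 (x y θ : ℝ) : Matrix (Core1 n₁ n₂) (State n₀ n₁ n₂) ℝ :=
  Ehat.N10 x * F0 b d n₀ B θ y + Ehat.N11_0 x * F1_1 b d n₀ B x y θ
    + Ehat.N11_1 x θ * F1_0 d n₀ B θ y
    + mInt a b (fun η => Ehat.N11_1 x η * F1_1 b d n₀ B η y θ)
    + Ehat.N12 x y * F2_0 b n₀ B θ y + mInt c d (fun ν => Ehat.N12 x ν * F2_1 b d n₀ B θ ν y)

def G2_0 (x y : ℝ) : Matrix (Core1 n₁ n₂) (State n₀ n₁ n₂) ℝ :=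
  Ehat.N22_0 y * F2_0 b n₀ B x y

def G2_1 (x y ν : ℝ) : Matrix (Core1 n₁ n₂) (State n₀ n₁ n₂) ℝ :=
  Ehat.N20 y * F0 b d n₀ B x ν + Ehat.N22_0 y * F2_1 b d n₀ B x y ν
    + Ehat.N22_1 y ν * F2_0 b n₀ B x ν
    + mInt c d (fun μ => Ehat.N22_1 y μ * F2_1 b d n₀ B x μ ν)
    + Ehat.N21 x y * F1_0 d n₀ B x ν + mInt a b (fun θ => Ehat.N21 θ y * F1_1 b d n₀ B θ ν x)

def T22 (x y θ ν : ℝ) : Matrix (State n₀ n₁ n₂) (State n₀ n₁ n₂) ℝ :=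
  - (K30 a c n₀ n₁ n₂ x y * G0 a b c d n₀ B Ehat θ ν)
    - mInt a x (fun η => K31 c n₀ n₁ n₂ x y η * G1_1 a b c d n₀ B Ehat η ν θ)
    - mInt c y (fun μ => K32 a n₀ n₁ n₂ x y μ * G2_1 a b c d n₀ B Ehat θ μ ν)

def T12 (x y θ ν : ℝ) : Matrix (State n₀ n₁ n₂) (State n₀ n₁ n₂) ℝ :=
  - (K31 c n₀ n₁ n₂ x y θ * G1_0 d n₀ B Ehat θ ν) + T22 a b c d n₀ B Ehat x y θ ν

def T21 (x y θ ν : ℝ) : Matrix (State n₀ n₁ n₂) (State n₀ n₁ n₂) ℝ :=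
  - (K32 a n₀ n₁ n₂ x y ν * G2_0 b n₀ B Ehat θ ν) + T22 a b c d n₀ B Ehat x y θ ν

def T11 (x y θ ν : ℝ) : Matrix (State n₀ n₁ n₂) (State n₀ n₁ n₂) ℝ :=
  K33 n₀ n₁ n₂ x y θ ν + T21 a b c d n₀ B Ehat x y θ ν + T12 a b c d n₀ B Ehat x y θ ν
    - T22 a b c d n₀ B Ehat x y θ ν

/-- The parameters `T`, in terms of `B` and of the parameters `Ê` of `(ℬ ℋ₁)⁻¹`. -/
def TParam : Param2D (State n₀ n₁ n₂) where
  N00 := fun _ _ => fromBlocks 1 0 0 0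
  N01 := 0
  N02 := 0
  N10 := 0
  N20 := 0
  N11 := T11 a b c d n₀ B Ehat
  N21 := T21 a b c d n₀ B Ehat
  N12 := T12 a b c d n₀ B Ehat
  N22 := T22 a b c d n₀ B Ehat

/-- The parameters `E` of the composition `ℬ ℋ₁` for separable `B`. -/
def EParam : CoreParam n₁ n₂ where
  N00 := B.N00 * H00 a b c d n₁ n₂
  N01 := fun x => B.N00 * H01 b c d n₁ n₂ x + B.N01 x * H11 c d n₁ n₂
  N02 := fun y => B.N00 * H02 a b d n₁ n₂ y + B.N02 y * H22 a b n₁ n₂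
  N10 := fun x => B.N10 x * H00 a b c d n₁ n₂
  N11_0 := fun x => B.N11_0 x * H11 c d n₁ n₂
  N11_1 := fun x θ => B.N10 x * H01 b c d n₁ n₂ θ + B.N11_1 x θ * H11 c d n₁ n₂
  N11_2 := fun x θ => B.N10 x * H01 b c d n₁ n₂ θ + B.N11_1 x θ * H11 c d n₁ n₂
  N12 := fun x y => B.N10 x * H02 a b d n₁ n₂ y + B.N12 x y * H22 a b n₁ n₂
  N20 := fun y => B.N20 y * H00 a b c d n₁ n₂
  N21 := fun x y => B.N20 y * H01 b c d n₁ n₂ x + B.N21 x y * H11 c d n₁ n₂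
  N22_0 := fun y => B.N22_0 y * H22 a b n₁ n₂
  N22_1 := fun y ν => B.N20 y * H02 a b d n₁ n₂ ν + B.N22_1 y ν * H22 a b n₁ n₂
  N22_2 := fun y ν => B.N20 y * H02 a b d n₁ n₂ ν + B.N22_1 y ν * H22 a b n₁ n₂

end TMatrices

/-! ### The explicit inverse of a separable 011-PI operator with finite-rank kernels -/

/-- Data of a finite-rank decomposition of separable 011 parameters `Q`:
`Q₀ₓ(x) = H₀ₓ Z(x)`, `Qₓ₀(x) = Z(x)ᵀ Hₓ₀`, `Qₓₓ¹(x, θ) = Z(x)ᵀ Γₓₓ Z(θ)`, etc.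
The factor `Z` is `Zx` on `[a, b]` and `Zy` on `[c, d]`. -/
structure Decomp (p₀ p₁ q : Type) where
  Q00 : Matrix p₀ p₀ ℝ
  Qxx : ℝ → Matrix p₁ p₁ ℝ
  Qyy : ℝ → Matrix p₁ p₁ ℝ
  Zx : ℝ → Matrix q p₁ ℝ
  Zy : ℝ → Matrix q p₁ ℝ
  H0x : Matrix p₀ q ℝ
  H0y : Matrix p₀ q ℝ
  Hx0 : Matrix q p₀ ℝ
  Hy0 : Matrix q p₀ ℝ
  Γxx : Matrix q q ℝ
  Γxy : Matrix q q ℝ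
  Γyx : Matrix q q ℝ
  Γyy : Matrix q q ℝ

namespace Decomp

variable {p₀ p₁ q : Type} [Fintype p₀] [Fintype p₁] [Fintype q]
  [DecidableEq p₀] [DecidableEq p₁] [DecidableEq q] (a b c d : ℝ) (D : Decomp p₀ p₁ q)

/-- The 011 parameters `E` are (almost everywhere) given by the decomposition `D`, with square
integrable `Z`. -/
structure Decomposes (E : Param011 p₀ p₁ p₀ p₁) : Prop where
  memZx : MatMemLp D.Zx 2 (mu1 a b)
  memZy : MatMemLp D.Zy 2 (mu1 c d)
  eq00 : E.N00 = D.Q00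
  eq01 : E.N01 =ᵐ[mu1 a b] fun x => D.H0x * D.Zx x
  eq02 : E.N02 =ᵐ[mu1 c d] fun y => D.H0y * D.Zy y
  eq10 : E.N10 =ᵐ[mu1 a b] fun x => (D.Zx x)ᵀ * D.Hx0
  eq20 : E.N20 =ᵐ[mu1 c d] fun y => (D.Zy y)ᵀ * D.Hy0
  eq11_0 : E.N11_0 =ᵐ[mu1 a b] D.Qxx
  eq22_0 : E.N22_0 =ᵐ[mu1 c d] D.Qyy
  eq11_1 : (fun z : ℝ × ℝ => E.N11_1 z.1 z.2) =ᵐ[mu2 a b a b]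
    fun z => (D.Zx z.1)ᵀ * D.Γxx * D.Zx z.2
  eq22_1 : (fun z : ℝ × ℝ => E.N22_1 z.1 z.2) =ᵐ[mu2 c d c d]
    fun z => (D.Zy z.1)ᵀ * D.Γyy * D.Zy z.2
  eq12 : (fun z : ℝ × ℝ => E.N12 z.1 z.2) =ᵐ[mu2 a b c d]
    fun z => (D.Zx z.1)ᵀ * D.Γxy * D.Zy z.2
  eq21 : (fun z : ℝ × ℝ => E.N21 z.1 z.2) =ᵐ[mu2 a b c d]
    fun z => (D.Zy z.2)ᵀ * D.Γyx * D.Zx z.1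

def Kxx : Matrix q q ℝ := mInt a b fun x => D.Zx x * (D.Qxx x)⁻¹ * (D.Zx x)ᵀ
def Kyy : Matrix q q ℝ := mInt c d fun y => D.Zy y * (D.Qyy y)⁻¹ * (D.Zy y)ᵀ
def Pxx : Matrix q q ℝ := D.Γxx - D.Hx0 * D.Q00⁻¹ * D.H0x
def Pxy : Matrix q q ℝ := D.Γxy - D.Hx0 * D.Q00⁻¹ * D.H0y
def Pyx : Matrix q q ℝ := D.Γyx - D.Hy0 * D.Q00⁻¹ * D.H0x
def Pyy : Matrix q q ℝ := D.Γyy - D.Hy0 * D.Q00⁻¹ * D.H0y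
def Sx : Matrix q q ℝ := 1 + D.Kxx a b * D.Pxx
def Sy : Matrix q q ℝ := 1 + D.Kyy c d * D.Pyy
def Exy : Matrix q q ℝ := (D.Sx a b)⁻¹ * D.Kxx a b * D.Pxy
def Eyx : Matrix q q ℝ := (D.Sy c d)⁻¹ * D.Kyy c d * D.Pyx
def Rx : Matrix q q ℝ := D.Sx a b - D.Kxx a b * D.Pxy * D.Eyx c d
def Ry : Matrix q q ℝ := D.Sy c d - D.Kyy c d * D.Pyx * D.Exy a b
def Γyx' : Matrix q q ℝ := -((D.Pyx - D.Pyy * D.Eyx c d) * (D.Rx a b c d)⁻¹)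
def Γxy' : Matrix q q ℝ := -((D.Pxy - D.Pxx * D.Exy a b) * (D.Ry a b c d)⁻¹)
def Γyy' : Matrix q q ℝ :=
  -((D.Pyy + D.Γyx' a b c d * D.Kxx a b * D.Pxy) * (D.Sy c d)⁻¹)
def Γxx' : Matrix q q ℝ :=
  -((D.Pxx + D.Γxy' a b c d * D.Kyy c d * D.Pyx) * (D.Sx a b)⁻¹)
def Hy0' : Matrix q p₀ ℝ :=
  -((D.Hy0 + D.Γyy' a b c d * D.Kyy c d * D.Hy0 + D.Γyx' a b c d * D.Kxx a b * D.Hx0) * D.Q00⁻¹)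
def Hx0' : Matrix q p₀ ℝ :=
  -((D.Hx0 + D.Γxx' a b c d * D.Kxx a b * D.Hx0 + D.Γxy' a b c d * D.Kyy c d * D.Hy0) * D.Q00⁻¹)
def H0y' : Matrix p₀ q ℝ :=
  -((D.Q00⁻¹ * D.H0y - D.Q00⁻¹ * D.H0x * D.Exy a b) * (D.Ry a b c d)⁻¹)
def H0x' : Matrix p₀ q ℝ :=
  -((D.Q00⁻¹ * D.H0x + D.H0y' a b c d * D.Kyy c d * D.Pyx) * (D.Sx a b)⁻¹)

/-- The constant matrices that the inversion formula inverts are invertible. -/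
structure Invertible : Prop where
  unit00 : IsUnit D.Q00
  unitSx : IsUnit (D.Sx a b)
  unitSy : IsUnit (D.Sy c d)
  unitRx : IsUnit (D.Rx a b c d)
  unitRy : IsUnit (D.Ry a b c d)

/-- The explicit parameters `ℒ_inv(Q)` of the inverse operator. -/
def Linv : Param011 p₀ p₁ p₀ p₁ where
  N00 := (1 - D.H0x' a b c d * D.Kxx a b * D.Hx0 - D.H0y' a b c d * D.Kyy c d * D.Hy0) * D.Q00⁻¹
  N01 := fun x => D.H0x' a b c d * (D.Zx x * (D.Qxx x)⁻¹)
  N02 := fun y => D.H0y' a b c d * (D.Zy y * (D.Qyy y)⁻¹)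
  N10 := fun x => (D.Qxx x)⁻¹ * (D.Zx x)ᵀ * D.Hx0' a b c d
  N11_0 := fun x => (D.Qxx x)⁻¹
  N11_1 := fun x θ => (D.Qxx x)⁻¹ * (D.Zx x)ᵀ * D.Γxx' a b c d * (D.Zx θ * (D.Qxx θ)⁻¹)
  N11_2 := fun x θ => (D.Qxx x)⁻¹ * (D.Zx x)ᵀ * D.Γxx' a b c d * (D.Zx θ * (D.Qxx θ)⁻¹)
  N12 := fun x y => (D.Qxx x)⁻¹ * (D.Zx x)ᵀ * D.Γxy' a b c d * (D.Zy y * (D.Qyy y)⁻¹)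
  N20 := fun y => (D.Qyy y)⁻¹ * (D.Zy y)ᵀ * D.Hy0' a b c d
  N21 := fun x y => (D.Qyy y)⁻¹ * (D.Zy y)ᵀ * D.Γyx' a b c d * (D.Zx x * (D.Qxx x)⁻¹)
  N22_0 := fun y => (D.Qyy y)⁻¹
  N22_1 := fun y ν => (D.Qyy y)⁻¹ * (D.Zy y)ᵀ * D.Γyy' a b c d * (D.Zy ν * (D.Qyy ν)⁻¹)
  N22_2 := fun y ν => (D.Qyy y)⁻¹ * (D.Zy y)ᵀ * D.Γyy' a b c d * (D.Zy ν * (D.Qyy ν)⁻¹)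

end Decomp

/-! ### Weak derivatives and Sobolev spaces -/

/-- The classical partial derivative `∂ₓᵏ ∂_yˡ φ`. -/
def pderiv (k l : ℕ) (φ : ℝ × ℝ → ℝ) (z : ℝ × ℝ) : ℝ :=
  iteratedDeriv k (fun s => iteratedDeriv l (fun t => φ (s, t)) z.2) z.1

/-- `w` is the weak derivative `∂ₓᵏ ∂_yˡ v` on the open rectangle `(a, b) × (c, d)`. -/
def HasWeakDeriv (a b c d : ℝ) {n : ℕ} (k l : ℕ) (v w : ℝ × ℝ → Fin n → ℝ) : Prop :=
  ∀ φ : ℝ × ℝ → ℝ, ContDiff ℝ (⊤ : ℕ∞) φ → HasCompactSupport φ →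
    tsupport φ ⊆ Ioo a b ×ˢ Ioo c d →
    ∀ i, ∫ z in Ioo a b ×ˢ Ioo c d, pderiv k l φ z * v z i
      = (-1) ^ (k + l) * ∫ z in Ioo a b ×ˢ Ioo c d, φ z * w z i

/-- The Sobolev space `H_k[x, y]`: all weak derivatives `∂ₓⁱ ∂_yʲ v` with `i, j ≤ k` exist in
`L₂`. -/
def InH (a b c d : ℝ) {n : ℕ} (k : ℕ) (v : ℝ × ℝ → Fin n → ℝ) : Prop :=
  MemLp v 2 (mu2 a b c d) ∧
    ∀ i ≤ k, ∀ j ≤ k, ∃ w, MemLp w 2 (mu2 a b c d) ∧ HasWeakDeriv a b c d i j v w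

open Classical in
/-- The weak derivative `∂ₓᵏ ∂_yˡ v`, if it exists in `L₂` (unique up to null sets). -/
def wderiv (a b c d : ℝ) {n : ℕ} (k l : ℕ) (v : ℝ × ℝ → Fin n → ℝ) : ℝ × ℝ → Fin n → ℝ :=
  if h : ∃ w, MemLp w 2 (mu2 a b c d) ∧ HasWeakDeriv a b c d k l v w then h.choose else 0

/-! ### Boundary values -/

open Classical in
/-- The Dirac operator `[Λ_y^{y₀} v](x) = v(x, y₀)`: evaluation at `y = y₀` of the representative
of `v` that is continuous in `y` on almost every line. -/
def traceY (a b c d : ℝ) {n : ℕ} (y₀ : ℝ) (v : ℝ × ℝ → Fin n → ℝ) : ℝ → Fin n → ℝ :=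
  if h : ∃ v' : ℝ × ℝ → Fin n → ℝ, v' =ᵐ[mu2 a b c d] v ∧
      ∀ᵐ x ∂(mu1 a b), ContinuousOn (fun y => v' (x, y)) (Icc c d)
  then fun x => h.choose (x, y₀) else 0

open Classical in
/-- The Dirac operator `[Λ_x^{x₀} v](y) = v(x₀, y)`: evaluation at `x = x₀` of the representative
of `v` that is continuous in `x` on almost every line. -/
def traceX (a b c d : ℝ) {n : ℕ} (x₀ : ℝ) (v : ℝ × ℝ → Fin n → ℝ) : ℝ → Fin n → ℝ :=
  if h : ∃ v' : ℝ × ℝ → Fin n → ℝ, v' =ᵐ[mu2 a b c d] v ∧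
      ∀ᵐ y ∂(mu1 c d), ContinuousOn (fun x => v' (x, y)) (Icc a b)
  then fun y => h.choose (x₀, y) else 0

open Classical in
/-- The corner value `Λ_x^{x₀} Λ_y^{y₀} v = v(x₀, y₀)` of the continuous representative. -/
def corner (a b c d : ℝ) {n : ℕ} (x₀ y₀ : ℝ) (v : ℝ × ℝ → Fin n → ℝ) : Fin n → ℝ :=
  if h : ∃ v' : ℝ × ℝ → Fin n → ℝ, v' =ᵐ[mu2 a b c d] v ∧
      ContinuousOn v' (Icc a b ×ˢ Icc c d)
  then h.choose (x₀, y₀) else 0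

section Boundary

variable (a b c d : ℝ) {n : ℕ} (v : ℝ × ℝ → Fin n → ℝ)

/-- The four corner values. -/
def Λ1 : Fin 4 → Fin n → ℝ :=
  ![corner a b c d a c v, corner a b c d b c v, corner a b c d a d v, corner a b c d b d v]

/-- The values on the edges `y = c` and `y = d`. -/
def Λ2 (x : ℝ) : Fin 2 → Fin n → ℝ := ![traceY a b c d c v x, traceY a b c d d v x]

/-- The values on the edges `x = a` and `x = b`. -/
def Λ3 (y : ℝ) : Fin 2 → Fin n → ℝ := ![traceX a b c d a v y, traceX a b c d b v y]

/-- The full boundary values `Λ_bf u` of `u = (u₀, u₁, u₂)`; they do not involve `u₀`. -/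
def Λbf {n₁ n₂ : ℕ} (u₁ : ℝ × ℝ → Fin n₁ → ℝ) (u₂ : ℝ × ℝ → Fin n₂ → ℝ) :
    RL (Full0 n₁ n₂) (Full1 n₁ n₂) :=
  let D := fun k l => wderiv a b c d k l u₂
  (Sum.elim (fun p => Λ1 a b c d u₁ p.1 p.2)
    (fun p => (![Λ1 a b c d u₂ 0, Λ1 a b c d u₂ 1, Λ1 a b c d u₂ 2, Λ1 a b c d u₂ 3,
      Λ1 a b c d (D 1 0) 0, Λ1 a b c d (D 1 0) 1, Λ1 a b c d (D 1 0) 2, Λ1 a b c d (D 1 0) 3,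
      Λ1 a b c d (D 0 1) 0, Λ1 a b c d (D 0 1) 1, Λ1 a b c d (D 0 1) 2, Λ1 a b c d (D 0 1) 3,
      Λ1 a b c d (D 1 1) 0, Λ1 a b c d (D 1 1) 1, Λ1 a b c d (D 1 1) 2, Λ1 a b c d (D 1 1) 3]
      : Fin 16 → Fin n₂ → ℝ) p.1 p.2),
   fun x => Sum.elim (fun p => Λ2 a b c d (wderiv a b c d 1 0 u₁) x p.1 p.2)
    (fun p => (![Λ2 a b c d (D 2 0) x 0, Λ2 a b c d (D 2 0) x 1,
      Λ2 a b c d (D 2 1) x 0, Λ2 a b c d (D 2 1) x 1] : Fin 4 → Fin n₂ → ℝ) p.1 p.2),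
   fun y => Sum.elim (fun p => Λ3 a b c d (wderiv a b c d 0 1 u₁) y p.1 p.2)
    (fun p => (![Λ3 a b c d (D 0 2) y 0, Λ3 a b c d (D 0 2) y 1,
      Λ3 a b c d (D 1 2) y 0, Λ3 a b c d (D 1 2) y 1] : Fin 4 → Fin n₂ → ℝ) p.1 p.2))

end Boundary

/-! ### The Hilbert space `L₂`, the set `X(ℬ)` and the operator `𝒟` -/

/-- The Hilbert space `L₂^(n₀+n₁+n₂)[x, y]`. -/
abbrev L2 (a b c d : ℝ) (n₀ n₁ n₂ : ℕ) : Type :=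
  Lp (EuclideanSpace ℝ (State n₀ n₁ n₂)) 2 (mu2 a b c d)

section X

variable {a b c d : ℝ} {n₀ n₁ n₂ : ℕ}

def comp0 (u : L2 a b c d n₀ n₁ n₂) : ℝ × ℝ → Fin n₀ → ℝ := fun z i => u z (Sum.inl i)

def comp1 (u : L2 a b c d n₀ n₁ n₂) : ℝ × ℝ → Fin n₁ → ℝ := fun z i => u z (Sum.inr (Sum.inl i))

def comp2 (u : L2 a b c d n₀ n₁ n₂) : ℝ × ℝ → Fin n₂ → ℝ := fun z i => u z (Sum.inr (Sum.inr i))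

/-- The set `X(ℬ)` of all `u ∈ L₂ × H₁ × H₂` with `ℬ Λ_bf u = 0`. -/
def X (n₀ : ℕ) (B : BParam n₁ n₂) : Set (L2 a b c d n₀ n₁ n₂) :=
  {u | InH a b c d 1 (comp1 u) ∧ InH a b c d 2 (comp2 u) ∧
    RL.Eq a b c d (P011 a b c d B (Λbf a b c d (comp1 u) (comp2 u))) 0}

/-- `p = (u₀, ∂ₓ∂_y u₁, ∂ₓ²∂_y² u₂)` with weak derivatives. -/
def IsD (u p : L2 a b c d n₀ n₁ n₂) : Prop :=
  comp0 p =ᵐ[mu2 a b c d] comp0 u ∧ HasWeakDeriv a b c d 1 1 (comp1 u) (comp1 p) ∧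
    HasWeakDeriv a b c d 2 2 (comp2 u) (comp2 p)

open Classical in
/-- The differential operator `𝒟 u = (u₀, ∂ₓ∂_y u₁, ∂ₓ²∂_y² u₂)`. -/
def Dop (u : L2 a b c d n₀ n₁ n₂) : L2 a b c d n₀ n₁ n₂ :=
  if h : ∃ p, IsD u p then h.choose else 0

/-- The inner product `⟨u, v⟩_X = ⟨𝒟 u, 𝒟 v⟩_{L₂}`. -/
def innerX (u v : L2 a b c d n₀ n₁ n₂) : ℝ := inner ℝ (Dop u) (Dop v)

end X

end PIE2D

end

open PIE2D

/-! A function `u` in `L₂ × H₁ × H₂` is the same thing as a pair `(w, f)`. Here `f = 𝒟 u` holds the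
highest mixed derivatives and `w` the core boundary values: numbers at the corner (a, c) and
functions on the two edges y = c and x = a. Integrating `f` back from that corner gives `u = Sol a c
w f`, an explicit formula with kernels `K30`, `K31`, `K32`, `K33`, and every square integrable pair
occurs. Evaluating the formula and its derivatives on the boundary gives the affine identity `Λ_bf u
= ℋ₁ w + ℋ₃ f`.

The boundary condition therefore reads `ℬ ℋ₁ w = -ℬ ℋ₃ f`. As `ℬ ℋ₁` is invertible, `f` may be
prescribed freely and then forces `w = -Ê ℬ ℋ₃ f`. Substituting this `w` into the integral formula
is `𝒯 f`. Hence `𝒯` and the restriction of `𝒟` to `X(ℬ)` are inverse to each other, and unitarity is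
immediate because the inner product of `X` is defined through `𝒟`.

The analysis is in `exists_Sol` (every `u` has this form), which rests on the du Bois-Reymond type
lemma `exists_eq_add_Ix` and its iterations `exists_S1` and `exists_S2`, and in the boundary
identity `Λbf_eq`. The identification of the kernels is a calculus of integral operators (`Ker`):
composing with a 011-PI operator is Fubini's theorem (`Ker.Mem.comp_app`), so `F` is the kernel of
`ℬ ℋ₃` and `G` that of `Ê ℬ ℋ₃`, and `P2D_eq_Sol` compares the result with `T` quadrant by quadrant.

For the inverse itself, any 1D kernels `N¹, N²` can be glued along the diagonal into one kernel, so
a separable inverse always exists (`exists_inverseParam`). For the explicit formula, finite matrix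
algebra shows that `ℒ_inv(E)` is a left inverse. A left inverse of an operator that has a two-sided
inverse equals it. The formula needs the multipliers `E₁₁⁰, E₂₂⁰` to be invertible almost everywhere
with bounded inverses. This follows from well-posedness, because a multiplier that coincides with a
Hilbert–Schmidt operator vanishes. -/

noncomputable section

namespace PIE2D

set_option linter.unusedSectionVars false

/-! ### Cauchy–Schwarz and Hilbert–Schmidt kernels, scalar case. -/

section Scalar

variable {α β γ : Type*} [MeasurableSpace α] [MeasurableSpace β] [MeasurableSpace γ]
  {μ : Measure α} {ν : Measure β} {ρ : Measure γ}
  [IsFiniteMeasure μ] [IsFiniteMeasure ν] [IsFiniteMeasure ρ]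

lemma sq_integral_mul_le {f g : α → ℝ} (hf : MemLp f 2 μ) (hg : MemLp g 2 μ) :
    (∫ t, f t * g t ∂μ) ^ 2 ≤ (∫ t, f t ^ 2 ∂μ) * ∫ t, g t ^ 2 ∂μ := by
  have key : ∀ {f g : α → ℝ} (hf : MemLp f 2 μ) (hg : MemLp g 2 μ),
      inner ℝ (hf.toLp f) (hg.toLp g) = ∫ t, f t * g t ∂μ := by
    intro f g hf hg
    rw [L2.inner_def]
    refine integral_congr_ae ?_
    filter_upwards [hf.coeFn_toLp, hg.coeFn_toLp] with t h1 h2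
    rw [h1, h2]
    simp [mul_comm]
  have := real_inner_mul_inner_self_le (hf.toLp f) (hg.toLp g)
  rw [key hf hg, key hf hf, key hg hg] at this
  simpa [sq] using this

/-- Cauchy–Schwarz for parametric integrals. -/
lemma memLp_two_integral_mul {u v : α × β → ℝ} {U V : α → ℝ}
    (hu : AEStronglyMeasurable u (μ.prod ν)) (hv : AEStronglyMeasurable v (μ.prod ν))
    (hU : ∀ᵐ s ∂μ, MemLp (fun t => u (s, t)) 2 ν ∧ ∫ t, u (s, t) ^ 2 ∂ν ≤ U s)
    (hV : ∀ᵐ s ∂μ, MemLp (fun t => v (s, t)) 2 ν ∧ ∫ t, v (s, t) ^ 2 ∂ν ≤ V s)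
    (hUV : Integrable (fun s => U s * V s) μ) :
    MemLp (fun s => ∫ t, u (s, t) * v (s, t) ∂ν) 2 μ := by
  have hm : AEStronglyMeasurable (fun s => ∫ t, u (s, t) * v (s, t) ∂ν) μ :=
    (hu.mul hv).integral_prod_right'
  rw [memLp_two_iff_integrable_sq hm]
  -- Only the product `U * V` has to be integrable. This covers a constant bound on one factor as
  -- well as bounds in two separate variables.
  refine hUV.mono' (hm.pow 2) ?_
  filter_upwards [hU, hV] with s h1 h2
  rw [Real.norm_of_nonneg (sq_nonneg _)]
  refine (sq_integral_mul_le h1.1 h2.1).trans ?_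
  have h3 : 0 ≤ ∫ t, u (s, t) ^ 2 ∂ν := integral_nonneg fun t => sq_nonneg _
  have h4 : 0 ≤ ∫ t, v (s, t) ^ 2 ∂ν := integral_nonneg fun t => sq_nonneg _
  exact mul_le_mul h1.2 h2.2 h4 (h3.trans h1.2)

lemma ae_memLp_two_right {k : α × β → ℝ} (hk : MemLp k 2 (μ.prod ν)) :
    ∀ᵐ s ∂μ, MemLp (fun t => k (s, t)) 2 ν := by
  have h1 := hk.1.prodMk_left
  have h2 := ((memLp_two_iff_integrable_sq hk.1).1 hk).prod_right_ae
  filter_upwards [h1, h2] with s h1 h2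
  exact (memLp_two_iff_integrable_sq h1).2 h2

lemma memLp_two_tensor {f : α → ℝ} {g : β → ℝ} (hf : MemLp f 2 μ) (hg : MemLp g 2 ν) :
    MemLp (fun z : α × β => f z.1 * g z.2) 2 (μ.prod ν) := by
  refine (memLp_two_iff_integrable_sq (hf.1.comp_fst.mul hg.1.comp_snd)).2 ?_
  simp only [Pi.mul_apply]
  simp_rw [mul_pow]
  exact Integrable.mul_prod hf.integrable_sq hg.integrable_sq

/-- Hilbert–Schmidt integral operators map `L₂` to `L₂`. -/
lemma memLp_two_hs {k : α × β → ℝ} {f : β → ℝ} (hk : MemLp k 2 (μ.prod ν)) (hf : MemLp f 2 ν) :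
    MemLp (fun s => ∫ t, k (s, t) * f t ∂ν) 2 μ := by
  refine memLp_two_integral_mul (u := k) (v := fun z => f z.2)
    (U := fun s => ∫ t, k (s, t) ^ 2 ∂ν) (V := fun _ => ∫ t, f t ^ 2 ∂ν)
    hk.1 hf.1.comp_snd ?_ ?_ ?_
  · filter_upwards [ae_memLp_two_right hk] with s hs using ⟨hs, le_rfl⟩
  · exact .of_forall fun s => ⟨hf, le_rfl⟩
  · exact ((memLp_two_iff_integrable_sq hk.1).1 hk).integral_prod_left.mul_const _

/-- The composition of two Hilbert–Schmidt kernels is a Hilbert–Schmidt kernel. -/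
lemma memLp_two_hs_comp {k : α × β → ℝ} {l : β × γ → ℝ} (hk : MemLp k 2 (μ.prod ν))
    (hl : MemLp l 2 (ν.prod ρ)) :
    MemLp (fun z : α × γ => ∫ t, k (z.1, t) * l (t, z.2) ∂ν) 2 (μ.prod ρ) := by
  have hl' : MemLp (fun z : γ × β => l z.swap) 2 (ρ.prod ν) :=
    hl.comp_measurePreserving Measure.measurePreserving_swap
  have q1 : Measure.QuasiMeasurePreserving (Prod.map Prod.fst id : (α × γ) × β → α × β)
      ((μ.prod ρ).prod ν) (μ.prod ν) :=
    MeasureTheory.QuasiMeasurePreserving.prodMap Measure.quasiMeasurePreserving_fst (.id ν)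
  have q2 : Measure.QuasiMeasurePreserving (Prod.map Prod.snd id : (α × γ) × β → γ × β)
      ((μ.prod ρ).prod ν) (ρ.prod ν) :=
    MeasureTheory.QuasiMeasurePreserving.prodMap Measure.quasiMeasurePreserving_snd (.id ν)
  refine memLp_two_integral_mul (u := fun w : (α × γ) × β => k (w.1.1, w.2))
    (v := fun w => l (w.2, w.1.2)) (U := fun z => ∫ t, k (z.1, t) ^ 2 ∂ν)
    (V := fun z => ∫ t, l (t, z.2) ^ 2 ∂ν)
    (hk.1.comp_quasiMeasurePreserving q1) (hl'.1.comp_quasiMeasurePreserving q2) ?_ ?_ ?_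
  · filter_upwards [Measure.quasiMeasurePreserving_fst.ae (ae_memLp_two_right hk)] with s hs
    exact ⟨hs, le_rfl⟩
  · filter_upwards [Measure.quasiMeasurePreserving_snd.ae (ae_memLp_two_right hl')] with s hs
    exact ⟨hs, le_rfl⟩
  · exact Integrable.mul_prod ((memLp_two_iff_integrable_sq hk.1).1 hk).integral_prod_left
      ((memLp_two_iff_integrable_sq hl'.1).1 hl').integral_prod_left

/-- The tensor `k(s) f(t)` is itself square integrable, so its product with `A` is integrable. This
is what justifies Fubini in `matInt_mul_fubini`. -/
lemma integrable_triple {k : α → ℝ} {A : α × β → ℝ} {f : β → ℝ} (hk : MemLp k 2 μ)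
    (hA : MemLp A 2 (μ.prod ν)) (hf : MemLp f 2 ν) :
    Integrable (fun z : α × β => k z.1 * A z * f z.2) (μ.prod ν) := by
  have := hA.integrable_mul (memLp_two_tensor hk hf)
  refine this.congr (.of_forall fun z => ?_)
  simp only [Pi.mul_apply]; ring

end Scalar

/-! ### Matrix-valued kernels. -/

section Matrices

variable {α β γ : Type*} [MeasurableSpace α] [MeasurableSpace β] [MeasurableSpace γ]
  {μ : Measure α} {ν : Measure β} {ρ : Measure γ}
  {l m n : Type*} [Fintype l] [Fintype m] [Fintype n]

/-- The entrywise integral of a matrix-valued function. -/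
def matInt (μ : Measure α) (M : α → Matrix l m ℝ) : Matrix l m ℝ :=
  Matrix.of fun i j => ∫ t, M t i j ∂μ

lemma MatMemLp.mulVec {p q r : ℝ≥0∞} [ENNReal.HolderTriple p q r] {M : α → Matrix l m ℝ}
    {f : α → m → ℝ} (hM : MatMemLp M p μ) (hf : MemLp f q μ) :
    MemLp (fun t => M t *ᵥ f t) r μ := by
  refine .of_eval fun i => ?_
  simp only [Matrix.mulVec, dotProduct]
  exact memLp_finsetSum _ fun j _ => (hf.eval j).mul' (hM i j)

lemma MatMemLp.mul {p q r : ℝ≥0∞} [ENNReal.HolderTriple p q r] {M : α → Matrix l m ℝ}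
    {N : α → Matrix m n ℝ} (hM : MatMemLp M p μ) (hN : MatMemLp N q μ) :
    MatMemLp (fun t => M t * N t) r μ := by
  intro i j
  simp only [Matrix.mul_apply]
  exact memLp_finsetSum _ fun k _ => (hN k j).mul' (hM i k)

lemma MatMemLp.add {p : ℝ≥0∞} {M N : α → Matrix l m ℝ} (hM : MatMemLp M p μ)
    (hN : MatMemLp N p μ) : MatMemLp (fun t => M t + N t) p μ :=
  fun i j => (hM i j).add (hN i j)

lemma MatMemLp.transpose {p : ℝ≥0∞} {M : α → Matrix l m ℝ} (hM : MatMemLp M p μ) :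
    MatMemLp (fun t => (M t)ᵀ) p μ :=
  fun i j => hM j i

lemma MatMemLp.congr {p : ℝ≥0∞} {M N : α → Matrix l m ℝ} (hM : MatMemLp M p μ)
    (h : M =ᵐ[μ] N) : MatMemLp N p μ :=
  fun i j => (hM i j).ae_eq (h.mono fun t ht => by rw [ht])

lemma matMemLp_const [IsFiniteMeasure μ] (p : ℝ≥0∞) (C : Matrix l m ℝ) :
    MatMemLp (fun _ : α => C) p μ :=
  fun i j => memLp_const (C i j)

lemma MatMemLp.const_mul [IsFiniteMeasure μ] {p : ℝ≥0∞} {M : α → Matrix m n ℝ}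
    (hM : MatMemLp M p μ) (C : Matrix l m ℝ) : MatMemLp (fun t => C * M t) p μ :=
  (matMemLp_const ∞ C).mul hM

lemma MatMemLp.mul_const [IsFiniteMeasure μ] {p : ℝ≥0∞} {M : α → Matrix l m ℝ}
    (hM : MatMemLp M p μ) (C : Matrix m n ℝ) : MatMemLp (fun t => M t * C) p μ :=
  hM.mul (matMemLp_const ∞ C)

lemma MatMemLp.fst [IsFiniteMeasure ν] {p : ℝ≥0∞} {M : α → Matrix l m ℝ}
    (hM : MatMemLp M p μ) : MatMemLp (fun z : α × β => M z.1) p (μ.prod ν) :=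
  fun i j => (hM i j).comp_fst ν

lemma MatMemLp.snd [IsFiniteMeasure μ] [IsFiniteMeasure ν] {p : ℝ≥0∞} {M : β → Matrix l m ℝ}
    (hM : MatMemLp M p ν) : MatMemLp (fun z : α × β => M z.2) p (μ.prod ν) :=
  fun i j => (hM i j).comp_snd μ

lemma integrable_mulVec {M : α → Matrix l m ℝ} {f : α → m → ℝ} (hM : MatMemLp M 2 μ)
    (hf : MemLp f 2 μ) : Integrable (fun t => M t *ᵥ f t) μ :=
  memLp_one_iff_integrable.1 (hM.mulVec hf)

lemma mulVec_integral (M : Matrix l m ℝ) {f : α → m → ℝ} (hf : Integrable f μ) :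
    M *ᵥ (∫ t, f t ∂μ) = ∫ t, M *ᵥ f t ∂μ :=
  ((Matrix.mulVecLin M).toContinuousLinearMap.integral_comp_comm hf).symm

lemma matInt_mulVec {M : α → Matrix l m ℝ} (hM : ∀ i j, Integrable (fun t => M t i j) μ)
    (v : m → ℝ) : matInt μ M *ᵥ v = ∫ t, M t *ᵥ v ∂μ := by
  have h : ∀ i j, Integrable (fun t => M t i j * v j) μ := fun i j => (hM i j).mul_const _
  ext i
  rw [eval_integral fun i => ?_]
  · simp only [Matrix.mulVec, dotProduct, matInt, Matrix.of_apply]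
    rw [integral_finsetSum _ fun j _ => h i j]
    simp_rw [integral_mul_const]
  · simp only [Matrix.mulVec, dotProduct]
    exact integrable_finsetSum _ fun j _ => h i j

variable [IsFiniteMeasure μ] [IsFiniteMeasure ν] [IsFiniteMeasure ρ]

lemma MatMemLp.ae_right {k : α × β → Matrix l m ℝ} (hk : MatMemLp k 2 (μ.prod ν)) :
    ∀ᵐ s ∂μ, MatMemLp (fun t => k (s, t)) 2 ν := by
  simp only [MatMemLp, ae_all_iff]
  exact fun i j => ae_memLp_two_right (hk i j)

lemma MatMemLp.swap {p : ℝ≥0∞} {k : α × β → Matrix l m ℝ} (hk : MatMemLp k p (μ.prod ν)) :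
    MatMemLp (fun z : β × α => k z.swap) p (ν.prod μ) :=
  fun i j => (hk i j).comp_measurePreserving Measure.measurePreserving_swap

lemma MatMemLp.tensor {M : α → Matrix l m ℝ} {N : β → Matrix m n ℝ} (hM : MatMemLp M 2 μ)
    (hN : MatMemLp N 2 ν) : MatMemLp (fun z : α × β => M z.1 * N z.2) 2 (μ.prod ν) := by
  intro i j
  simp only [Matrix.mul_apply]
  exact memLp_finsetSum _ fun k _ => memLp_two_tensor (hM i k) (hN k j)

lemma MatMemLp.hs {k : α × β → Matrix l m ℝ} {f : β → m → ℝ} (hk : MatMemLp k 2 (μ.prod ν))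
    (hf : MemLp f 2 ν) : MemLp (fun s => ∫ t, k (s, t) *ᵥ f t ∂ν) 2 μ := by
  refine .of_eval fun i => ?_
  -- The vector integral splits into entries only where the slice of the kernel is square
  -- integrable, hence for almost every `s`.
  have : ∀ᵐ s ∂μ, ∑ j, ∫ t, k (s, t) i j * f t j ∂ν = (∫ t, k (s, t) *ᵥ f t ∂ν) i := by
    filter_upwards [hk.ae_right] with s hs
    rw [eval_integral fun i => (integrable_mulVec hs hf).eval i]
    simp only [Matrix.mulVec, dotProduct]
    exact (integral_finsetSum _ fun j _ => (hs i j).integrable_mul (hf.eval j)).symm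
  refine MemLp.ae_eq this ?_
  exact memLp_finsetSum _ fun j _ => memLp_two_hs (hk i j) (hf.eval j)

lemma MatMemLp.hs_comp {k : α × β → Matrix l m ℝ} {A : β × γ → Matrix m n ℝ}
    (hk : MatMemLp k 2 (μ.prod ν)) (hA : MatMemLp A 2 (ν.prod ρ)) :
    MatMemLp (fun z : α × γ => matInt ν fun t => k (z.1, t) * A (t, z.2)) 2 (μ.prod ρ) := by
  intro i j
  have h1 : ∀ᵐ z ∂(μ.prod ρ), MatMemLp (fun t => k (z.1, t)) 2 ν :=
    Measure.quasiMeasurePreserving_fst.ae hk.ae_right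
  have h2 : ∀ᵐ z ∂(μ.prod ρ), MatMemLp (fun t => A (t, z.2)) 2 ν :=
    Measure.quasiMeasurePreserving_snd.ae (p := fun p => MatMemLp (fun t => A (t, p)) 2 ν)
      hA.swap.ae_right
  have : ∀ᵐ z ∂(μ.prod ρ), ∑ r, ∫ t, k (z.1, t) i r * A (t, z.2) r j ∂ν
      = (matInt ν fun t => k (z.1, t) * A (t, z.2)) i j := by
    filter_upwards [h1, h2] with z h1 h2
    simp only [matInt, Matrix.of_apply, Matrix.mul_apply]
    exact (integral_finsetSum _ fun r _ => (h1 i r).integrable_mul (h2 r j)).symm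
  refine MemLp.ae_eq this ?_
  exact memLp_finsetSum _ fun r _ => memLp_two_hs_comp (hk i r) (hA r j)

lemma integrable_mulVec_triple {k : α → Matrix l m ℝ} {A : α × β → Matrix m n ℝ} {f : β → n → ℝ}
    (hk : MatMemLp k 2 μ) (hA : MatMemLp A 2 (μ.prod ν)) (hf : MemLp f 2 ν) :
    Integrable (fun z : α × β => (k z.1 * A z) *ᵥ f z.2) (μ.prod ν) := by
  refine .of_eval fun i => ?_
  simp only [Matrix.mulVec, dotProduct, Matrix.mul_apply, Finset.sum_mul]
  exact integrable_finsetSum _ fun j _ => integrable_finsetSum _ fun r _ =>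
    integrable_triple (hk i r) (hA r j) (hf.eval j)

/-- Fubini's theorem for a matrix-valued kernel composed with an integral functional. -/
lemma matInt_mul_fubini {k : α → Matrix l m ℝ} {A : α × β → Matrix m n ℝ} {f : β → n → ℝ}
    (hk : MatMemLp k 2 μ) (hA : MatMemLp A 2 (μ.prod ν)) (hf : MemLp f 2 ν) :
    Integrable (fun p => (matInt μ fun t => k t * A (t, p)) *ᵥ f p) ν ∧
    ∫ p, (matInt μ fun t => k t * A (t, p)) *ᵥ f p ∂ν
      = ∫ t, k t *ᵥ (∫ p, A (t, p) *ᵥ f p ∂ν) ∂μ := by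
  have hI := integrable_mulVec_triple hk hA hf
  have h2 : ∀ᵐ p ∂ν, MatMemLp (fun t => A (t, p)) 2 μ := hA.swap.ae_right
  have h3 : ∀ᵐ p ∂ν, ∫ t, (k t * A (t, p)) *ᵥ f p ∂μ
      = (matInt μ fun t => k t * A (t, p)) *ᵥ f p := by
    filter_upwards [h2] with p hp
    exact (matInt_mulVec (fun i j => memLp_one_iff_integrable.1 (hk.mul hp i j)) _).symm
  refine ⟨hI.integral_prod_right.congr h3, ?_⟩
  rw [← integral_congr_ae h3, ← integral_integral_swap (f := fun t p => (k t * A (t, p)) *ᵥ f p) hI]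
  refine integral_congr_ae ?_
  filter_upwards [hA.ae_right] with t ht
  rw [mulVec_integral _ (integrable_mulVec ht hf)]
  simp_rw [Matrix.mulVec_mulVec]

end Matrices

/-! ### Lebesgue measure on intervals and rectangles. -/

instance isFiniteMeasure_mu1 (a b : ℝ) : IsFiniteMeasure (mu1 a b) := by
  unfold mu1; infer_instance

lemma mu2_eq_prod (a b c d : ℝ) : mu2 a b c d = (mu1 a b).prod (mu1 c d) := by
  rw [mu1, mu1, Measure.prod_restrict, mu2, Measure.volume_eq_prod]

instance isFiniteMeasure_mu2 (a b c d : ℝ) : IsFiniteMeasure (mu2 a b c d) := by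
  rw [mu2_eq_prod]; infer_instance

lemma ae_mem_Icc (a b : ℝ) : ∀ᵐ x ∂(mu1 a b), x ∈ Icc a b :=
  ae_restrict_mem measurableSet_Icc

lemma intervalIntegral_eq_mu1 {E : Type*} [NormedAddCommGroup E] [NormedSpace ℝ E] {a b : ℝ}
    (hab : a ≤ b) (f : ℝ → E) : ∫ x in a..b, f x = ∫ x, f x ∂(mu1 a b) := by
  rw [intervalIntegral.integral_of_le hab, mu1, integral_Icc_eq_integral_Ioc]

lemma mInt_eq_matInt {l m : Type*} {a b : ℝ} (hab : a ≤ b) (M : ℝ → Matrix l m ℝ) :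
    mInt a b M = matInt (mu1 a b) M := by
  ext i j
  exact intervalIntegral_eq_mu1 hab _

lemma intervalIntegrable_of_mu1 {E : Type*} [NormedAddCommGroup E] {a b : ℝ} {f : ℝ → E}
    (hf : Integrable f (mu1 a b)) {s t : ℝ} (hs : s ∈ Icc a b) (ht : t ∈ Icc a b) :
    IntervalIntegrable f volume s t := by
  have h : IntegrableOn f (Icc a b) volume := hf
  rw [intervalIntegrable_iff]
  exact h.mono_set (uIoc_subset_uIcc.trans (uIcc_subset_Icc hs ht))

lemma intervalIntegral_congr_mu1 {E : Type*} [NormedAddCommGroup E] [NormedSpace ℝ E] {a b : ℝ}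
    {f g : ℝ → E} (h : f =ᵐ[mu1 a b] g) {s t : ℝ} (hs : s ∈ Icc a b) (ht : t ∈ Icc a b) :
    ∫ x in s..t, f x = ∫ x in s..t, g x := by
  refine intervalIntegral.integral_congr_ae ?_
  have h' := (ae_restrict_iff' measurableSet_Icc).1 h
  filter_upwards [h'] with x hx hx'
  exact hx (uIcc_subset_Icc hs ht (uIoc_subset_uIcc hx'))

/-- Two Volterra integrals with a common integrand merge into one integral over the whole interval;
this is how separability is used. -/
lemma intervalIntegral_add_mu1 {E : Type*} [NormedAddCommGroup E] [NormedSpace ℝ E] {a b x : ℝ}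
    {f : ℝ → E} (hf : Integrable f (mu1 a b)) (hx : x ∈ Icc a b) :
    (∫ t in a..x, f t) + ∫ t in x..b, f t = ∫ t, f t ∂(mu1 a b) := by
  have hab := hx.1.trans hx.2
  rw [intervalIntegral.integral_add_adjacent_intervals
    (intervalIntegrable_of_mu1 hf (left_mem_Icc.2 hab) hx)
    (intervalIntegrable_of_mu1 hf hx (right_mem_Icc.2 hab)), intervalIntegral_eq_mu1 hab]

/-! ### Triples modulo null sets. -/

section RLEq

variable {r₀ r₁ : Type} {a b c d : ℝ} {w w' w'' : RL r₀ r₁}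

lemma RL.Eq.refl (w : RL r₀ r₁) : RL.Eq a b c d w w := ⟨rfl, .rfl, .rfl⟩

lemma RL.Eq.symm (h : RL.Eq a b c d w w') : RL.Eq a b c d w' w :=
  ⟨h.1.symm, h.2.1.symm, h.2.2.symm⟩

lemma RL.Eq.trans (h : RL.Eq a b c d w w') (h' : RL.Eq a b c d w' w'') :
    RL.Eq a b c d w w'' :=
  ⟨h.1.trans h'.1, h.2.1.trans h'.2.1, h.2.2.trans h'.2.2⟩

lemma RL.Eq.add {v v' : RL r₀ r₁} (h : RL.Eq a b c d w w') (h' : RL.Eq a b c d v v') :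
    RL.Eq a b c d (w + v) (w' + v') :=
  ⟨congrArg₂ (· + ·) h.1 h'.1, h.2.1.add h'.2.1, h.2.2.add h'.2.2⟩

lemma RL.Eq.smul (h : RL.Eq a b c d w w') (s : ℝ) : RL.Eq a b c d (s • w) (s • w') :=
  ⟨congrArg (s • ·) h.1, h.2.1.const_smul s, h.2.2.const_smul s⟩

variable [Fintype r₁]

lemma RL.Mem.congr (hw : RL.Mem a b c d w) (h : RL.Eq a b c d w w') : RL.Mem a b c d w' :=
  ⟨hw.1.ae_eq h.2.1, hw.2.ae_eq h.2.2⟩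

lemma RL.Mem.add (hw : RL.Mem a b c d w) (hw' : RL.Mem a b c d w') :
    RL.Mem a b c d (w + w') :=
  ⟨hw.1.add hw'.1, hw.2.add hw'.2⟩

lemma RL.Mem.smul (hw : RL.Mem a b c d w) (s : ℝ) : RL.Mem a b c d (s • w) :=
  ⟨hw.1.const_smul s, hw.2.const_smul s⟩

lemma RL.mem_zero : RL.Mem a b c d (0 : RL r₀ r₁) := ⟨MemLp.zero, MemLp.zero⟩

end RLEq

/-! ### 011-PI operators and separability. -/

section Operators

variable {p₀ p₁ r₀ r₁ : Type} [Fintype p₀] [Fintype p₁] [Fintype r₀] [Fintype r₁]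
  {a b c d : ℝ}

/-- The operator with separable parameters, in terms of integrals over the whole intervals. -/
def PSep (a b c d : ℝ) (N : Param011 p₀ p₁ r₀ r₁) (w : RL r₀ r₁) : RL p₀ p₁ :=
  (N.N00 *ᵥ w.1 + (∫ x, N.N01 x *ᵥ w.2.1 x ∂(mu1 a b)) + ∫ y, N.N02 y *ᵥ w.2.2 y ∂(mu1 c d),
   fun x => N.N10 x *ᵥ w.1 + N.N11_0 x *ᵥ w.2.1 x + (∫ θ, N.N11_1 x θ *ᵥ w.2.1 θ ∂(mu1 a b))
     + ∫ y, N.N12 x y *ᵥ w.2.2 y ∂(mu1 c d),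
   fun y => N.N20 y *ᵥ w.1 + (∫ x, N.N21 x y *ᵥ w.2.1 x ∂(mu1 a b)) + N.N22_0 y *ᵥ w.2.2 y
     + ∫ ν, N.N22_1 y ν *ᵥ w.2.2 ν ∂(mu1 c d))

namespace Param011.Mem

variable {N : Param011 p₀ p₁ r₀ r₁} (hN : N.Mem a b c d)
include hN

lemma ker11 : MatMemLp (fun z : ℝ × ℝ => N.N11_1 z.1 z.2) 2 ((mu1 a b).prod (mu1 a b)) :=
  mu2_eq_prod a b a b ▸ hN.mem11_1

lemma ker22 : MatMemLp (fun z : ℝ × ℝ => N.N22_1 z.1 z.2) 2 ((mu1 c d).prod (mu1 c d)) :=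
  mu2_eq_prod c d c d ▸ hN.mem22_1

lemma ker12 : MatMemLp (fun z : ℝ × ℝ => N.N12 z.1 z.2) 2 ((mu1 a b).prod (mu1 c d)) :=
  mu2_eq_prod a b c d ▸ hN.mem12

lemma ker21 : MatMemLp (fun z : ℝ × ℝ => N.N21 z.2 z.1) 2 ((mu1 c d).prod (mu1 a b)) :=
  MatMemLp.swap (k := fun z : ℝ × ℝ => N.N21 z.1 z.2) (mu2_eq_prod a b c d ▸ hN.mem21)

end Param011.Mem

lemma PSep_mem {N : Param011 p₀ p₁ r₀ r₁} (hN : N.Mem a b c d) {w : RL r₀ r₁}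
    (hw : RL.Mem a b c d w) : RL.Mem a b c d (PSep a b c d N w) := by
  refine ⟨?_, ?_⟩
  · refine MemLp.add (MemLp.add (MemLp.add ?_ ?_) ?_) ?_
    · exact hN.mem10.mulVec (memLp_const (p := ∞) w.1)
    · exact hN.mem11_0.mulVec hw.1
    · exact hN.ker11.hs hw.1
    · exact hN.ker12.hs hw.2
  · refine MemLp.add (MemLp.add (MemLp.add ?_ ?_) ?_) ?_
    · exact hN.mem20.mulVec (memLp_const (p := ∞) w.1)
    · exact hN.ker21.hs hw.1
    · exact hN.mem22_0.mulVec hw.2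
    · exact hN.ker22.hs hw.2

lemma PSep_congr (N : Param011 p₀ p₁ r₀ r₁) {w w' : RL r₀ r₁} (h : RL.Eq a b c d w w') :
    RL.Eq a b c d (PSep a b c d N w) (PSep a b c d N w') := by
  have h1 : ∀ {l : Type} [Fintype l] (M : ℝ → Matrix l r₁ ℝ),
      ∫ x, M x *ᵥ w.2.1 x ∂(mu1 a b) = ∫ x, M x *ᵥ w'.2.1 x ∂(mu1 a b) := fun M =>
    integral_congr_ae (h.2.1.mono fun x hx => by simp only [hx])
  have h2 : ∀ {l : Type} [Fintype l] (M : ℝ → Matrix l r₁ ℝ),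
      ∫ x, M x *ᵥ w.2.2 x ∂(mu1 c d) = ∫ x, M x *ᵥ w'.2.2 x ∂(mu1 c d) := fun M =>
    integral_congr_ae (h.2.2.mono fun x hx => by simp only [hx])
  refine ⟨?_, ?_, ?_⟩
  · simp only [PSep, h1, h2, h.1]
  · filter_upwards [h.2.1] with x hx
    simp only [PSep, h1, h2, h.1, hx]
  · filter_upwards [h.2.2] with x hx
    simp only [PSep, h1, h2, h.1, hx]

/-- Additivity holds only modulo null sets, since the integrals split only where the kernel slices
are square integrable. Homogeneity needs no integrability and is an honest equality in `PSep_smul`.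
-/
lemma PSep_add {N : Param011 p₀ p₁ r₀ r₁} (hN : N.Mem a b c d) {w w' : RL r₀ r₁}
    (hw : RL.Mem a b c d w) (hw' : RL.Mem a b c d w') :
    RL.Eq a b c d (PSep a b c d N (w + w')) (PSep a b c d N w + PSep a b c d N w') := by
  have key : ∀ {α l : Type} [Fintype l] [MeasurableSpace α] {μ : Measure α}
      {M : α → Matrix l r₁ ℝ} {f g : α → r₁ → ℝ}, MatMemLp M 2 μ → MemLp f 2 μ → MemLp g 2 μ →
      ∫ x, M x *ᵥ (f + g) x ∂μ = ∫ x, M x *ᵥ f x ∂μ + ∫ x, M x *ᵥ g x ∂μ := by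
    intro α l _ _ μ M f g hM hf hg
    rw [← integral_add (integrable_mulVec hM hf) (integrable_mulVec hM hg)]
    simp_rw [Pi.add_apply, Matrix.mulVec_add]
  refine ⟨?_, ?_, ?_⟩
  · simp only [PSep, Prod.fst_add, Prod.snd_add]
    rw [key hN.mem01 hw.1 hw'.1, key hN.mem02 hw.2 hw'.2, Matrix.mulVec_add]
    abel
  · filter_upwards [hN.ker11.ae_right, hN.ker12.ae_right] with x h1 h2
    simp only [PSep, Prod.fst_add, Prod.snd_add]
    rw [Pi.add_apply]
    rw [key h1 hw.1 hw'.1, key h2 hw.2 hw'.2, Matrix.mulVec_add, Pi.add_apply, Matrix.mulVec_add]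
    abel
  · filter_upwards [hN.ker22.ae_right, hN.ker21.ae_right] with x h1 h2
    simp only [PSep, Prod.fst_add, Prod.snd_add]
    rw [Pi.add_apply]
    rw [key h1 hw.2 hw'.2, key h2 hw.1 hw'.1, Matrix.mulVec_add, Pi.add_apply, Matrix.mulVec_add]
    abel

lemma PSep_smul (N : Param011 p₀ p₁ r₀ r₁) (s : ℝ) (w : RL r₀ r₁) :
    PSep a b c d N (s • w) = s • PSep a b c d N w := by
  simp only [PSep, Prod.smul_fst, Prod.smul_snd, Matrix.mulVec_smul, Pi.smul_apply,
    Prod.smul_mk, smul_add, integral_smul]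
  refine Prod.ext rfl (Prod.ext (funext fun x => ?_) (funext fun x => ?_)) <;>
    simp only [Pi.smul_apply, smul_add]

/-- The two triangular integrals have the same kernel, so they add up to one Hilbert–Schmidt
operator. In this form Fubini applies without triangles. -/
lemma P011_eq_PSep (hab : a ≤ b) (hcd : c ≤ d) {N : Param011 p₀ p₁ r₀ r₁}
    (hN : N.Mem a b c d) (hs : N.Separable) {w : RL r₀ r₁} (hw : RL.Mem a b c d w) :
    RL.Eq a b c d (P011 a b c d N w) (PSep a b c d N w) := by
  refine ⟨?_, ?_, ?_⟩
  · simp only [P011, PSep, intervalIntegral_eq_mu1 hab, intervalIntegral_eq_mu1 hcd]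
  · filter_upwards [hN.ker11.ae_right, ae_mem_Icc a b] with x h1 hx
    simp only [P011, PSep, P1D, intervalIntegral_eq_mu1 hcd, ← hs.1]
    rw [add_assoc (N.N11_0 x *ᵥ _), intervalIntegral_add_mu1 (integrable_mulVec h1 hw.1) hx]
    simp only [add_assoc]
  · filter_upwards [hN.ker22.ae_right, ae_mem_Icc c d] with y h1 hy
    simp only [P011, PSep, P1D, intervalIntegral_eq_mu1 hab, ← hs.2]
    rw [add_assoc (N.N22_0 y *ᵥ _), intervalIntegral_add_mu1 (integrable_mulVec h1 hw.2) hy]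
    simp only [add_assoc]

lemma P011_congr (hab : a ≤ b) (hcd : c ≤ d) (N : Param011 p₀ p₁ r₀ r₁) {w w' : RL r₀ r₁}
    (h : RL.Eq a b c d w w') : RL.Eq a b c d (P011 a b c d N w) (P011 a b c d N w') := by
  have ha := left_mem_Icc.2 hab
  have hb := right_mem_Icc.2 hab
  have hc := left_mem_Icc.2 hcd
  have hd := right_mem_Icc.2 hcd
  have h1 : ∀ {l : Type} [Fintype l] (M : ℝ → Matrix l r₁ ℝ) {s t : ℝ}, s ∈ Icc a b → t ∈ Icc a b →
      ∫ x in s..t, M x *ᵥ w.2.1 x = ∫ x in s..t, M x *ᵥ w'.2.1 x := fun M _ _ hs ht =>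
    intervalIntegral_congr_mu1 (h.2.1.mono fun x hx => by simp only [hx]) hs ht
  have h2 : ∀ {l : Type} [Fintype l] (M : ℝ → Matrix l r₁ ℝ) {s t : ℝ}, s ∈ Icc c d → t ∈ Icc c d →
      ∫ x in s..t, M x *ᵥ w.2.2 x = ∫ x in s..t, M x *ᵥ w'.2.2 x := fun M _ _ hs ht =>
    intervalIntegral_congr_mu1 (h.2.2.mono fun x hx => by simp only [hx]) hs ht
  refine ⟨?_, ?_, ?_⟩
  · simp only [P011, h1 _ ha hb, h2 _ hc hd, h.1]
  · filter_upwards [h.2.1, ae_mem_Icc a b] with x hx hx'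
    simp only [P011, P1D, h1 _ ha hx', h1 _ hx' hb, h2 _ hc hd, h.1, hx]
  · filter_upwards [h.2.2, ae_mem_Icc c d] with x hx hx'
    simp only [P011, P1D, h1 _ ha hb, h2 _ hc hx', h2 _ hx' hd, h.1, hx]

lemma P011_mem (hab : a ≤ b) (hcd : c ≤ d) {N : Param011 p₀ p₁ r₀ r₁}
    (hN : N.Mem a b c d) (hs : N.Separable) {w : RL r₀ r₁} (hw : RL.Mem a b c d w) :
    RL.Mem a b c d (P011 a b c d N w) :=
  (PSep_mem hN hw).congr (P011_eq_PSep hab hcd hN hs hw).symm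

lemma P011_add (hab : a ≤ b) (hcd : c ≤ d) {N : Param011 p₀ p₁ r₀ r₁}
    (hN : N.Mem a b c d) (hs : N.Separable) {w w' : RL r₀ r₁}
    (hw : RL.Mem a b c d w) (hw' : RL.Mem a b c d w') :
    RL.Eq a b c d (P011 a b c d N (w + w')) (P011 a b c d N w + P011 a b c d N w') :=
  (P011_eq_PSep hab hcd hN hs (hw.add hw')).trans <| (PSep_add hN hw hw').trans <|
    ((P011_eq_PSep hab hcd hN hs hw).add (P011_eq_PSep hab hcd hN hs hw')).symm

lemma P011_smul (hab : a ≤ b) (hcd : c ≤ d) {N : Param011 p₀ p₁ r₀ r₁}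
    (hN : N.Mem a b c d) (hs : N.Separable) (s : ℝ) {w : RL r₀ r₁} (hw : RL.Mem a b c d w) :
    RL.Eq a b c d (P011 a b c d N (s • w)) (s • P011 a b c d N w) :=
  (P011_eq_PSep hab hcd hN hs (hw.smul s)).trans <|
    PSep_smul (a := a) (b := b) (c := c) (d := d) N s w ▸
      ((P011_eq_PSep hab hcd hN hs hw).smul s).symm

open Classical in
/-- The separable parameters whose 1D kernels are `N¹` below and `N²` above the diagonal. -/
def Param011.glue (N : Param011 p₀ p₁ r₀ r₁) : Param011 p₀ p₁ r₀ r₁ :=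
  { N with
    N11_1 := fun x θ => if θ ≤ x then N.N11_1 x θ else N.N11_2 x θ
    N11_2 := fun x θ => if θ ≤ x then N.N11_1 x θ else N.N11_2 x θ
    N22_1 := fun y ν => if ν ≤ y then N.N22_1 y ν else N.N22_2 y ν
    N22_2 := fun y ν => if ν ≤ y then N.N22_1 y ν else N.N22_2 y ν }

lemma Param011.glue_separable (N : Param011 p₀ p₁ r₀ r₁) : N.glue.Separable := ⟨rfl, rfl⟩

lemma Param011.glue_mem {N : Param011 p₀ p₁ r₀ r₁} (hN : N.Mem a b c d) :
    N.glue.Mem a b c d := by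
  have key : ∀ {s t : ℝ} {M M' : ℝ → ℝ → Matrix p₁ r₁ ℝ},
      MatMemLp (fun z : ℝ × ℝ => M z.1 z.2) 2 (mu2 s t s t) →
      MatMemLp (fun z : ℝ × ℝ => M' z.1 z.2) 2 (mu2 s t s t) →
      MatMemLp (fun z : ℝ × ℝ => if z.2 ≤ z.1 then M z.1 z.2 else M' z.1 z.2) 2
        (mu2 s t s t) := by
    intro s t M M' hM hM' i j
    have := MemLp.piecewise (s := {z : ℝ × ℝ | z.2 ≤ z.1})
      (measurableSet_le measurable_snd measurable_fst) ((hM i j).restrict _)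
      ((hM' i j).restrict _)
    refine this.ae_eq (.of_forall fun z => ?_)
    by_cases h : z.2 ≤ z.1 <;> simp [Set.piecewise, h]
  exact { hN with
    mem11_1 := key hN.mem11_1 hN.mem11_2
    mem11_2 := key hN.mem11_1 hN.mem11_2
    mem22_1 := key hN.mem22_1 hN.mem22_2
    mem22_2 := key hN.mem22_1 hN.mem22_2 }

/-- The first triangular integral sees only `θ ≤ x` and the second only `θ > x`, so each meets its
own branch of the glued kernel. Separability thus restricts the choice of parameters, not the
operator. -/
lemma P011_glue (N : Param011 p₀ p₁ r₀ r₁) (w : RL r₀ r₁) :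
    RL.Eq a b c d (P011 a b c d N.glue w) (P011 a b c d N w) := by
  have key : ∀ {s t x : ℝ}, x ∈ Icc s t → ∀ (N0 : ℝ → Matrix p₁ r₁ ℝ)
      (M M' : ℝ → ℝ → Matrix p₁ r₁ ℝ) (f : ℝ → r₁ → ℝ),
      P1D s t N0 (fun x θ => if θ ≤ x then M x θ else M' x θ)
        (fun x θ => if θ ≤ x then M x θ else M' x θ) f x = P1D s t N0 M M' f x := by
    intro s t x hx N0 M M' f
    simp only [P1D]
    congr 1
    · congr 1
      rw [intervalIntegral.integral_of_le hx.1, intervalIntegral.integral_of_le hx.1]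
      refine setIntegral_congr_fun measurableSet_Ioc fun θ hθ => ?_
      simp only [if_pos hθ.2]
    · rw [intervalIntegral.integral_of_le hx.2, intervalIntegral.integral_of_le hx.2]
      refine setIntegral_congr_fun measurableSet_Ioc fun θ hθ => ?_
      simp only [if_neg (not_le.2 hθ.1)]
  refine ⟨rfl, ?_, ?_⟩
  · filter_upwards [ae_mem_Icc a b] with x hx
    simp only [P011, Param011.glue, key hx]
  · filter_upwards [ae_mem_Icc c d] with x hx
    simp only [P011, Param011.glue, key hx]

end Operators

/-! ### Existence of separable inverse parameters. -/

section Existence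

variable {a b c d : ℝ} {n₁ n₂ : ℕ}

theorem exists_inverseParam {B : BParam n₁ n₂} (hwp : WellPosed a b c d B) (hab : a ≤ b)
    (hcd : c ≤ d) :
    ∃ Ehat : CoreParam n₁ n₂, InverseParam a b c d B Ehat := by
  obtain ⟨E, hE, hinv⟩ := hwp
  refine ⟨E.glue, Param011.glue_mem hE, E.glue_separable, fun w hw => ?_⟩
  obtain ⟨h1, h2⟩ := hinv w hw
  refine ⟨(P011_glue _ _).trans h1, .trans ?_ h2⟩
  exact P011_congr hab hcd _ (P011_congr hab hcd _ (P011_glue _ _))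

end Existence

/-! ### Continuity of the explicit matrices in their variables. -/

section Continuity

lemma memLp_mu1_of_continuous {p : ℝ≥0∞} {a b : ℝ} {f : ℝ → ℝ} (hf : Continuous f) :
    MemLp f p (mu1 a b) := by
  obtain ⟨C, hC⟩ := isCompact_Icc.exists_bound_of_continuousOn (s := Icc a b) hf.continuousOn
  refine MemLp.of_bound hf.aestronglyMeasurable C ?_
  filter_upwards [ae_mem_Icc a b] with x hx using hC x hx

lemma ae_mem_rect (a b c d : ℝ) : ∀ᵐ z ∂(mu2 a b c d), z ∈ Icc a b ×ˢ Icc c d :=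
  ae_restrict_mem (measurableSet_Icc.prod measurableSet_Icc)

lemma memLp_mu2_of_continuous {p : ℝ≥0∞} {a b c d : ℝ} {f : ℝ × ℝ → ℝ} (hf : Continuous f) :
    MemLp f p (mu2 a b c d) := by
  obtain ⟨C, hC⟩ := (isCompact_Icc.prod isCompact_Icc).exists_bound_of_continuousOn
    (s := Icc a b ×ˢ Icc c d) hf.continuousOn
  refine MemLp.of_bound hf.aestronglyMeasurable C ?_
  filter_upwards [ae_mem_rect a b c d] with x hx using hC x hx

variable {α : Type*} [TopologicalSpace α] {κ l : Type}

lemma continuous_blkI_apply {n : ℕ} {M : α → Matrix κ l ℝ}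
    (hM : ∀ i j, Continuous fun t => M t i j) (p : κ × Fin n) (q : l × Fin n) :
    Continuous fun t => blkI n (M t) p q := by
  simp only [blkI, Matrix.of_apply]
  split_ifs
  exacts [hM _ _, continuous_const]

lemma continuous_colI_apply {n : ℕ} {v : α → κ → ℝ}
    (hv : ∀ i, Continuous fun t => v t i) (p : κ × Fin n) (j : Fin n) :
    Continuous fun t => colI n (v t) p j := by
  simp only [colI, Matrix.of_apply]
  split_ifs
  exacts [hv _, continuous_const]

lemma continuous_H01_apply (b c d : ℝ) (n₁ n₂ : ℕ) (i j) :
    Continuous fun x => H01 b c d n₁ n₂ x i j := by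
  rcases i with i | i <;> rcases j with j | j <;>
    simp only [H01, fromBlocks_apply₁₁, fromBlocks_apply₁₂, fromBlocks_apply₂₁,
      fromBlocks_apply₂₂]
  · exact continuous_const
  · exact continuous_const
  · exact continuous_const
  · refine continuous_blkI_apply (fun k k' => ?_) i j
    fin_cases k <;> fin_cases k' <;> simp <;> fun_prop

lemma continuous_H02_apply (a b d : ℝ) (n₁ n₂ : ℕ) (i j) :
    Continuous fun x => H02 a b d n₁ n₂ x i j := by
  rcases i with i | i <;> rcases j with j | j <;>
    simp only [H02, fromBlocks_apply₁₁, fromBlocks_apply₁₂, fromBlocks_apply₂₁,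
      fromBlocks_apply₂₂]
  · exact continuous_const
  · exact continuous_const
  · exact continuous_const
  · refine continuous_blkI_apply (fun k k' => ?_) i j
    fin_cases k <;> fin_cases k' <;> simp <;> fun_prop

lemma continuous_H03_apply (b d : ℝ) (n₀ n₁ n₂ : ℕ) (i j) :
    Continuous fun z : ℝ × ℝ => H03 b d n₀ n₁ n₂ z.1 z.2 i j := by
  rcases j with j | j
  · exact continuous_const
  rcases i with i | i <;> rcases j with j | j <;>
    simp only [H03, fromCols_apply_inr, fromBlocks_apply₁₁, fromBlocks_apply₁₂,
      fromBlocks_apply₂₁, fromBlocks_apply₂₂]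
  · exact continuous_const
  · exact continuous_const
  · exact continuous_const
  · refine continuous_colI_apply (fun k => ?_) i j
    fin_cases k <;> simp <;> fun_prop

lemma continuous_H13_apply (d : ℝ) (n₀ n₁ n₂ : ℕ) (i j) :
    Continuous fun y => H13 d n₀ n₁ n₂ y i j := by
  rcases j with j | j
  · exact continuous_const
  rcases i with i | i <;> rcases j with j | j <;>
    simp only [H13, fromCols_apply_inr, fromBlocks_apply₁₁, fromBlocks_apply₁₂,
      fromBlocks_apply₂₁, fromBlocks_apply₂₂]
  · exact continuous_const
  · exact continuous_const
  · exact continuous_const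
  · refine continuous_colI_apply (fun k => ?_) i j
    fin_cases k <;> simp <;> fun_prop

/-- `H23` is definitionally `H13` with `b` in place of `d`. -/
lemma continuous_H23_apply (b : ℝ) (n₀ n₁ n₂ : ℕ) (i j) :
    Continuous fun x => H23 b n₀ n₁ n₂ x i j := continuous_H13_apply b n₀ n₁ n₂ i j

end Continuity

/-! ### The composition `ℬ ℋ₁`. -/

section Composition

lemma integral_mul_add_mul_mulVec {α : Type*} [MeasurableSpace α] {μ : Measure α}
    [IsFiniteMeasure μ] {l m n k : Type*} [Fintype l] [Fintype m] [Fintype n] [Fintype k]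
    (C : Matrix l m ℝ) {H : α → Matrix m n ℝ} {N : α → Matrix l k ℝ} {f : α → n → ℝ}
    (hH : MatMemLp H 2 μ) (hN : MatMemLp N 2 μ) (D : Matrix k n ℝ) (hf : MemLp f 2 μ) :
    ∫ x, (C * H x + N x * D) *ᵥ f x ∂μ
      = C *ᵥ (∫ x, H x *ᵥ f x ∂μ) + ∫ x, N x *ᵥ D *ᵥ f x ∂μ := by
  rw [mulVec_integral _ (integrable_mulVec hH hf)]
  simp_rw [Matrix.add_mulVec, Matrix.mulVec_mulVec]
  exact integral_add (integrable_mulVec (hH.const_mul C) hf)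
    (integrable_mulVec (hN.mul_const D) hf)

variable {a b c d : ℝ} {n₁ n₂ : ℕ}

lemma H1Param_mem : (H1Param a b c d n₁ n₂).Mem a b c d where
  mem01 i j := memLp_mu1_of_continuous (continuous_H01_apply b c d n₁ n₂ i j)
  mem02 i j := memLp_mu1_of_continuous (continuous_H02_apply a b d n₁ n₂ i j)
  mem10 _ _ := MemLp.zero
  mem11_0 _ _ := memLp_const _
  mem11_1 _ _ := MemLp.zero
  mem11_2 _ _ := MemLp.zero
  mem12 _ _ := MemLp.zero
  mem20 _ _ := MemLp.zero
  mem21 _ _ := MemLp.zero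
  mem22_0 _ _ := memLp_const _
  mem22_1 _ _ := MemLp.zero
  mem22_2 _ _ := MemLp.zero

lemma H1Param_separable : (H1Param a b c d n₁ n₂).Separable := ⟨rfl, rfl⟩

/-- The composition `ℬ ℋ₁`. -/
def BH1 (a b c d : ℝ) (B : BParam n₁ n₂) (w : RL (Core0 n₁ n₂) (Core1 n₁ n₂)) :
    RL (Core0 n₁ n₂) (Core1 n₁ n₂) :=
  P011 a b c d B (P011 a b c d (H1Param a b c d n₁ n₂) w)

lemma BH1_congr (hab : a ≤ b) (hcd : c ≤ d) (B : BParam n₁ n₂)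
    {w w' : RL (Core0 n₁ n₂) (Core1 n₁ n₂)} (h : RL.Eq a b c d w w') :
    RL.Eq a b c d (BH1 a b c d B w) (BH1 a b c d B w') :=
  P011_congr hab hcd _ (P011_congr hab hcd _ h)

lemma PSep_H1 (w : RL (Core0 n₁ n₂) (Core1 n₁ n₂)) :
    PSep a b c d (H1Param a b c d n₁ n₂) w =
      (H00 a b c d n₁ n₂ *ᵥ w.1 + (∫ x, H01 b c d n₁ n₂ x *ᵥ w.2.1 x ∂(mu1 a b))
        + ∫ y, H02 a b d n₁ n₂ y *ᵥ w.2.2 y ∂(mu1 c d),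
      fun x => H11 c d n₁ n₂ *ᵥ w.2.1 x, fun y => H22 a b n₁ n₂ *ᵥ w.2.2 y) := by
  simp only [PSep, H1Param, Pi.zero_apply, Matrix.zero_mulVec, integral_zero, zero_add, add_zero]

/-- `EParam` are the parameters of `ℬ ℋ₁`. -/
lemma BH1_eq_PSep_EParam (hab : a ≤ b) (hcd : c ≤ d) {B : BParam n₁ n₂} (hB : B.Mem a b c d)
    (hsep : B.Separable) {w : RL (Core0 n₁ n₂) (Core1 n₁ n₂)} (hw : RL.Mem a b c d w) :
    RL.Eq a b c d (BH1 a b c d B w) (PSep a b c d (EParam a b c d B) w) := by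
  have h1 := P011_eq_PSep hab hcd H1Param_mem H1Param_separable hw
  rw [PSep_H1] at h1
  have hw' := (P011_mem hab hcd H1Param_mem H1Param_separable hw).congr h1
  refine (P011_congr hab hcd B h1).trans ((P011_eq_PSep hab hcd hB hsep hw').trans ?_)
  have m01 : MatMemLp (H01 b c d n₁ n₂) 2 (mu1 a b) := (H1Param_mem (a := a)).mem01
  have m02 : MatMemLp (H02 a b d n₁ n₂) 2 (mu1 c d) := (H1Param_mem (c := c)).mem02
  refine ⟨?_, ?_, ?_⟩
  · simp only [PSep, EParam]
    rw [integral_mul_add_mul_mulVec _ m01 hB.mem01 _ hw.1,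
      integral_mul_add_mul_mulVec _ m02 hB.mem02 _ hw.2]
    simp only [Matrix.mulVec_add, Matrix.mulVec_mulVec]
    abel
  · filter_upwards [hB.ker11.ae_right, hB.ker12.ae_right] with x h1 h2
    simp only [PSep, EParam]
    rw [integral_mul_add_mul_mulVec _ m01 h1 _ hw.1, integral_mul_add_mul_mulVec _ m02 h2 _ hw.2]
    simp only [Matrix.mulVec_add, Matrix.mulVec_mulVec]
    abel
  · filter_upwards [hB.ker22.ae_right, hB.ker21.ae_right] with x h1 h2
    simp only [PSep, EParam]
    rw [integral_mul_add_mul_mulVec _ m01 h2 _ hw.1, integral_mul_add_mul_mulVec _ m02 h1 _ hw.2]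
    simp only [Matrix.mulVec_add, Matrix.mulVec_mulVec]
    abel

end Composition

/-! ### Multipliers versus Hilbert–Schmidt operators. -/

section Localization

/-- `m x` equals integrals of one integrable function over arbitrarily short intervals around `x`,
and these tend to zero. Rational endpoints keep the union of the exceptional null sets countable. -/
lemma ae_eq_zero_of_local {a b : ℝ} {m : ℝ → ℝ} {k : ℝ × ℝ → ℝ}
    (hk : MemLp k 2 ((mu1 a b).prod (mu1 a b)))
    (h : ∀ r s : ℚ, ∀ᵐ x ∂(mu1 a b), x ∈ Ioo (r : ℝ) s →
      m x = ∫ θ in Ioo (r : ℝ) s, k (x, θ) ∂(mu1 a b)) :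
    ∀ᵐ x ∂(mu1 a b), m x = 0 := by
  simp_rw [← ae_all_iff] at h
  filter_upwards [h, ae_memLp_two_right hk] with x hx hkx
  have hr : ∀ n : ℕ, ∃ r : ℚ, x - 1 / (n + 1 : ℝ) < r ∧ (r : ℝ) < x := fun n =>
    exists_rat_btwn (sub_lt_self x (by positivity))
  have hs : ∀ n : ℕ, ∃ r : ℚ, x < r ∧ (r : ℝ) < x + 1 / (n + 1 : ℝ) := fun n =>
    exists_rat_btwn (lt_add_of_pos_right x (by positivity))
  choose r hr1 hr2 using hr
  choose s hs1 hs2 using hs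
  have hint : Integrable (fun θ => k (x, θ)) (mu1 a b) := hkx.integrable (by norm_num)
  have hμ : Filter.Tendsto (fun n : ℕ => mu1 a b (Ioo (r n : ℝ) (s n))) Filter.atTop
      (nhds 0) := by
    have hlim : Filter.Tendsto (fun n : ℕ => ENNReal.ofReal (2 * (1 / (n + 1 : ℝ))))
        Filter.atTop (nhds 0) := by
      rw [← ENNReal.ofReal_zero]
      refine ENNReal.tendsto_ofReal ?_
      simpa using (tendsto_one_div_add_atTop_nhds_zero_nat (𝕜 := ℝ)).const_mul 2
    refine tendsto_of_tendsto_of_tendsto_of_le_of_le tendsto_const_nhds hlim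
      (fun _ => zero_le) fun n => ?_
    refine (Measure.restrict_apply_le _ _).trans ?_
    rw [Real.volume_Ioo]
    exact ENNReal.ofReal_le_ofReal (by linarith [hr1 n, hs2 n])
  have hlim := hint.tendsto_setIntegral_nhds_zero hμ
  refine tendsto_nhds_unique (tendsto_const_nhds.congr fun n => ?_) hlim
  exact hx (r n) (s n) ⟨hr2 n, hs1 n⟩

/-- A multiplier that agrees with a Hilbert–Schmidt operator vanishes. -/
lemma ae_eq_zero_of_mulVec_eq_integral {p r : Type} [Fintype p] [Fintype r] [DecidableEq r]
    {a b : ℝ} {M : ℝ → Matrix p r ℝ} {k : ℝ × ℝ → Matrix p r ℝ}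
    (hk : MatMemLp k 2 ((mu1 a b).prod (mu1 a b)))
    (h : ∀ f : ℝ → r → ℝ, MemLp f 2 (mu1 a b) →
      ∀ᵐ x ∂(mu1 a b), M x *ᵥ f x = ∫ θ, k (x, θ) *ᵥ f θ ∂(mu1 a b)) :
    M =ᵐ[mu1 a b] 0 := by
  have key : ∀ i j, ∀ᵐ x ∂(mu1 a b), M x i j = 0 := fun i j => by
    refine ae_eq_zero_of_local (hk i j) fun s t => ?_
    -- A basis vector supported on a short interval isolates one column of `M` on the left, while on
    -- the right only that interval is integrated.
    have hf : MemLp ((Ioo (s : ℝ) t).indicator fun _ => (Pi.single j 1 : r → ℝ)) 2 (mu1 a b) :=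
      (memLp_const _).indicator measurableSet_Ioo
    filter_upwards [h _ hf, hk.ae_right] with x hx hkx hxJ
    rw [indicator_of_mem hxJ] at hx
    have := congrFun hx i
    rw [eval_integral fun i => (integrable_mulVec hkx hf).eval i] at this
    rw [← integral_indicator measurableSet_Ioo]
    simp only [Matrix.mulVec_single_one, Matrix.col_apply] at this
    rw [this]
    refine integral_congr_ae (.of_forall fun θ => ?_)
    by_cases hθ : θ ∈ Ioo (s : ℝ) t
    · simp [hθ]
    · simp only [Set.indicator_of_notMem hθ, Matrix.mulVec_zero, Pi.zero_apply]
  simp_rw [← ae_all_iff] at key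
  filter_upwards [key] with x hx
  ext i j
  exact hx i j

end Localization

/-! ### Matrix algebra behind the explicit inverse. -/

namespace Decomp

section Algebra

variable {p₀ p₁ q : Type} [Fintype p₀] [Fintype p₁] [Fintype q]
  [DecidableEq p₀] [DecidableEq p₁] [DecidableEq q] {a b c d : ℝ} {D : Decomp p₀ p₁ q}

lemma mul_inv_mul_cancel {m n : Type} [Fintype n] [DecidableEq n] {S : Matrix n n ℝ}
    (hS : IsUnit S) (M : Matrix m n ℝ) : M * S⁻¹ * S = M :=
  nonsing_inv_mul_cancel_right S M ((isUnit_iff_isUnit_det S).1 hS)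

/-- The coefficients of the inverse solve a linear system from which `Q00` has been eliminated, the
`P` matrices being Schur complements. This equation and the next two only multiply out one inverse.
-/
lemma Γxx'_mul (hD : D.Invertible a b c d) :
    D.Pxx + D.Γxx' a b c d * D.Sx a b + D.Γxy' a b c d * D.Kyy c d * D.Pyx = 0 := by
  rw [Γxx', Matrix.neg_mul, mul_inv_mul_cancel hD.unitSx]
  abel

lemma Γyy'_mul (hD : D.Invertible a b c d) :
    D.Pyy + D.Γyx' a b c d * D.Kxx a b * D.Pxy + D.Γyy' a b c d * D.Sy c d = 0 := by
  rw [Γyy', Matrix.neg_mul, mul_inv_mul_cancel hD.unitSy]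
  abel

lemma H0x'_mul (hD : D.Invertible a b c d) :
    D.Q00⁻¹ * D.H0x + D.H0x' a b c d * D.Sx a b + D.H0y' a b c d * D.Kyy c d * D.Pyx = 0 := by
  rw [H0x', Matrix.neg_mul, mul_inv_mul_cancel hD.unitSx]
  abel

lemma Γxy'_mul (hD : D.Invertible a b c d) :
    D.Pxy + D.Γxx' a b c d * D.Kxx a b * D.Pxy + D.Γxy' a b c d * D.Sy c d = 0 := by
  have h : D.Γxy' a b c d * D.Ry a b c d = -(D.Pxy - D.Pxx * D.Exy a b) := by
    rw [Γxy', Matrix.neg_mul, mul_inv_mul_cancel hD.unitRy]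
  have h2 : D.Γxx' a b c d * D.Kxx a b * D.Pxy
      = -((D.Pxx + D.Γxy' a b c d * D.Kyy c d * D.Pyx) * D.Exy a b) := by
    rw [Γxx', Exy]; simp only [Matrix.neg_mul, Matrix.mul_assoc]
  rw [Ry, Matrix.mul_sub] at h
  rw [h2, eq_add_of_sub_eq h]
  simp only [Matrix.add_mul, Matrix.mul_assoc]
  abel

lemma Γyx'_mul (hD : D.Invertible a b c d) :
    D.Pyx + D.Γyx' a b c d * D.Sx a b + D.Γyy' a b c d * D.Kyy c d * D.Pyx = 0 := by
  have h : D.Γyx' a b c d * D.Rx a b c d = -(D.Pyx - D.Pyy * D.Eyx c d) := by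
    rw [Γyx', Matrix.neg_mul, mul_inv_mul_cancel hD.unitRx]
  have h2 : D.Γyy' a b c d * D.Kyy c d * D.Pyx
      = -((D.Pyy + D.Γyx' a b c d * D.Kxx a b * D.Pxy) * D.Eyx c d) := by
    rw [Γyy', Eyx]; simp only [Matrix.neg_mul, Matrix.mul_assoc]
  rw [Rx, Matrix.mul_sub] at h
  rw [h2, eq_add_of_sub_eq h]
  simp only [Matrix.add_mul, Matrix.mul_assoc]
  abel

lemma H0y'_mul (hD : D.Invertible a b c d) :
    D.Q00⁻¹ * D.H0y + D.H0x' a b c d * D.Kxx a b * D.Pxy + D.H0y' a b c d * D.Sy c d = 0 := by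
  have h : D.H0y' a b c d * D.Ry a b c d
      = -(D.Q00⁻¹ * D.H0y - D.Q00⁻¹ * D.H0x * D.Exy a b) := by
    rw [H0y', Matrix.neg_mul, mul_inv_mul_cancel hD.unitRy]
  have h2 : D.H0x' a b c d * D.Kxx a b * D.Pxy
      = -((D.Q00⁻¹ * D.H0x + D.H0y' a b c d * D.Kyy c d * D.Pyx) * D.Exy a b) := by
    rw [H0x', Exy]; simp only [Matrix.neg_mul, Matrix.mul_assoc]
  rw [Ry, Matrix.mul_sub] at h
  rw [h2, eq_add_of_sub_eq h]
  simp only [Matrix.add_mul, Matrix.mul_assoc]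
  abel

/-- The relations between the coefficients of `Q` and of `ℒ_inv(Q)` that express that the latter
is a left inverse. -/
structure LeftInverse (a b c d : ℝ) (D : Decomp p₀ p₁ q) : Prop where
  r00 : (D.Linv a b c d).N00 * D.Q00 + D.H0x' a b c d * D.Kxx a b * D.Hx0
    + D.H0y' a b c d * D.Kyy c d * D.Hy0 = 1
  r0x : (D.Linv a b c d).N00 * D.H0x + D.H0x' a b c d * (1 + D.Kxx a b * D.Γxx)
    + D.H0y' a b c d * D.Kyy c d * D.Γyx = 0
  r0y : (D.Linv a b c d).N00 * D.H0y + D.H0x' a b c d * D.Kxx a b * D.Γxy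
    + D.H0y' a b c d * (1 + D.Kyy c d * D.Γyy) = 0
  rx0 : D.Hx0 + D.Hx0' a b c d * D.Q00 + D.Γxx' a b c d * D.Kxx a b * D.Hx0
    + D.Γxy' a b c d * D.Kyy c d * D.Hy0 = 0
  rxx : D.Γxx + D.Hx0' a b c d * D.H0x + D.Γxx' a b c d * (1 + D.Kxx a b * D.Γxx)
    + D.Γxy' a b c d * D.Kyy c d * D.Γyx = 0
  rxy : D.Γxy + D.Hx0' a b c d * D.H0y + D.Γxx' a b c d * D.Kxx a b * D.Γxy
    + D.Γxy' a b c d * (1 + D.Kyy c d * D.Γyy) = 0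
  ry0 : D.Hy0 + D.Hy0' a b c d * D.Q00 + D.Γyx' a b c d * D.Kxx a b * D.Hx0
    + D.Γyy' a b c d * D.Kyy c d * D.Hy0 = 0
  ryx : D.Γyx + D.Hy0' a b c d * D.H0x + D.Γyx' a b c d * (1 + D.Kxx a b * D.Γxx)
    + D.Γyy' a b c d * D.Kyy c d * D.Γyx = 0
  ryy : D.Γyy + D.Hy0' a b c d * D.H0y + D.Γyx' a b c d * D.Kxx a b * D.Γxy
    + D.Γyy' a b c d * (1 + D.Kyy c d * D.Γyy) = 0

/-- The three relations in the column of `Q00` unfold definitions. In the other six, the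
coefficients multiplying `H0x` and `H0y` are expanded, which completes each `Γ` to the Schur
complement `Γ - H Q00⁻¹ H`, and the eliminated equations appear. -/
lemma leftInverse (hD : D.Invertible a b c d) : D.LeftInverse a b c d where
  r00 := by
    rw [Linv, mul_inv_mul_cancel hD.unit00]; abel
  r0x := by
    rw [← H0x'_mul hD, Linv, Sx, Pxx, Pyx]
    simp only [Matrix.mul_add, Matrix.mul_sub, Matrix.sub_mul, Matrix.mul_assoc,
      Matrix.mul_one, Matrix.one_mul]
    abel
  r0y := by
    rw [← H0y'_mul hD, Linv, Sy, Pxy, Pyy]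
    simp only [Matrix.mul_add, Matrix.mul_sub, Matrix.sub_mul, Matrix.mul_assoc,
      Matrix.mul_one, Matrix.one_mul]
    abel
  rx0 := by
    rw [Hx0', Matrix.neg_mul, mul_inv_mul_cancel hD.unit00]; abel
  ry0 := by
    rw [Hy0', Matrix.neg_mul, mul_inv_mul_cancel hD.unit00]; abel
  rxx := by
    rw [← Γxx'_mul hD, Hx0', Sx, Pxx, Pyx]
    simp only [Matrix.mul_add, Matrix.add_mul, Matrix.mul_sub, Matrix.mul_assoc,
      Matrix.mul_one, Matrix.neg_mul]
    abel
  rxy := by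
    rw [← Γxy'_mul hD, Hx0', Sy, Pxy, Pyy]
    simp only [Matrix.mul_add, Matrix.add_mul, Matrix.mul_sub, Matrix.mul_assoc,
      Matrix.mul_one, Matrix.neg_mul]
    abel
  ryx := by
    rw [← Γyx'_mul hD, Hy0', Sx, Pxx, Pyx]
    simp only [Matrix.mul_add, Matrix.add_mul, Matrix.mul_sub, Matrix.mul_assoc,
      Matrix.mul_one, Matrix.neg_mul]
    abel
  ryy := by
    rw [← Γyy'_mul hD, Hy0', Sy, Pxy, Pyy]
    simp only [Matrix.mul_add, Matrix.add_mul, Matrix.mul_sub, Matrix.mul_assoc,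
      Matrix.mul_one, Matrix.neg_mul]
    abel

end Algebra

/-! ### From the matrix relations to a left inverse operator. -/

section Operator

variable {p₀ p₁ q : Type} [Fintype p₀] [Fintype p₁] [Fintype q]
  [DecidableEq p₀] [DecidableEq p₁] [DecidableEq q] {a b c d : ℝ} {D : Decomp p₀ p₁ q}
  {E : Param011 p₀ p₁ p₀ p₁}

/-- The finite-rank part of the operator with parameters `Q`, as a function of `v`, `∫ Zₓ f` and
`∫ Z_y g`. -/
def finPart (D : Decomp p₀ p₁ q) (v : p₀ → ℝ) (φ ψ : q → ℝ) : RL p₀ p₁ :=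
  (D.Q00 *ᵥ v + D.H0x *ᵥ φ + D.H0y *ᵥ ψ,
   fun x => (D.Zx x)ᵀ *ᵥ (D.Hx0 *ᵥ v + D.Γxx *ᵥ φ + D.Γxy *ᵥ ψ),
   fun y => (D.Zy y)ᵀ *ᵥ (D.Hy0 *ᵥ v + D.Γyx *ᵥ φ + D.Γyy *ᵥ ψ))

/-- The moments `∫ Zₓ f`. -/
def momX (D : Decomp p₀ p₁ q) (a b : ℝ) (f : ℝ → p₁ → ℝ) : q → ℝ :=
  ∫ x, D.Zx x *ᵥ f x ∂(mu1 a b)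

/-- The moments `∫ Z_y g`. -/
def momY (D : Decomp p₀ p₁ q) (c d : ℝ) (g : ℝ → p₁ → ℝ) : q → ℝ :=
  ∫ y, D.Zy y *ᵥ g y ∂(mu1 c d)

lemma integral_mul_mulVec {α : Type*} [MeasurableSpace α] {μ : Measure α}
    {l m n : Type*} [Fintype l] [Fintype m] [Fintype n] (C : Matrix l m ℝ)
    {H : α → Matrix m n ℝ} {f : α → n → ℝ} (hH : MatMemLp H 2 μ) (hf : MemLp f 2 μ) :
    ∫ x, (C * H x) *ᵥ f x ∂μ = C *ᵥ ∫ x, H x *ᵥ f x ∂μ := by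
  rw [mulVec_integral _ (integrable_mulVec hH hf)]
  simp_rw [Matrix.mulVec_mulVec]

/-- Once the kernels factor through `Zx` and `Zy`, the function arguments enter only through their
moments, apart from the multipliers. -/
lemma PSep_eq_finPart (hE : D.Decomposes a b c d E) {w : RL p₀ p₁} (hw : RL.Mem a b c d w) :
    RL.Eq a b c d (PSep a b c d E w) (D.finPart w.1 (D.momX a b w.2.1) (D.momY c d w.2.2)
      + (0, fun x => D.Qxx x *ᵥ w.2.1 x, fun y => D.Qyy y *ᵥ w.2.2 y)) := by
  have h11 := Measure.ae_ae_of_ae_prod (mu2_eq_prod a b a b ▸ hE.eq11_1)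
  have h22 := Measure.ae_ae_of_ae_prod (mu2_eq_prod c d c d ▸ hE.eq22_1)
  have h12 := Measure.ae_ae_of_ae_prod (mu2_eq_prod a b c d ▸ hE.eq12)
  have h21 : ∀ᵐ y ∂(mu1 c d), ∀ᵐ x ∂(mu1 a b),
      E.N21 x y = (D.Zy y)ᵀ * D.Γyx * D.Zx x := Measure.ae_ae_of_ae_prod
    (Measure.measurePreserving_swap.quasiMeasurePreserving.ae (mu2_eq_prod a b c d ▸ hE.eq21))
  refine ⟨?_, ?_, ?_⟩
  · simp only [PSep, finPart, Prod.fst_add, hE.eq00, add_zero]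
    rw [integral_congr_ae (hE.eq01.mono fun x hx => congrArg (· *ᵥ w.2.1 x) hx),
      integral_congr_ae (hE.eq02.mono fun x hx => congrArg (· *ᵥ w.2.2 x) hx),
      integral_mul_mulVec _ hE.memZx hw.1, integral_mul_mulVec _ hE.memZy hw.2]
    rfl
  · filter_upwards [h11, h12, hE.eq10, hE.eq11_0] with x h1 h2 h3 h4
    simp only [PSep, finPart, Prod.snd_add, Prod.fst_add, Pi.add_apply]
    rw [integral_congr_ae (h1.mono fun t ht => congrArg (· *ᵥ w.2.1 t) ht),
      integral_congr_ae (h2.mono fun t ht => congrArg (· *ᵥ w.2.2 t) ht),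
      integral_mul_mulVec _ hE.memZx hw.1, integral_mul_mulVec _ hE.memZy hw.2, h3, h4]
    simp only [Matrix.mulVec_add, ← Matrix.mulVec_mulVec]
    simp only [momX, momY]
    abel
  · filter_upwards [h22, h21, hE.eq20, hE.eq22_0] with x h1 h2 h3 h4
    simp only [PSep, finPart, Prod.snd_add, Pi.add_apply]
    rw [integral_congr_ae (h1.mono fun t ht => congrArg (· *ᵥ w.2.2 t) ht),
      integral_congr_ae (h2.mono fun t ht => congrArg (· *ᵥ w.2.1 t) ht),
      integral_mul_mulVec _ hE.memZx hw.1, integral_mul_mulVec _ hE.memZy hw.2, h3, h4]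
    simp only [Matrix.mulVec_add, ← Matrix.mulVec_mulVec]
    simp only [momX, momY]
    abel

lemma finPart_mem (hE : D.Decomposes a b c d E) (v : p₀ → ℝ) (φ ψ : q → ℝ) :
    RL.Mem a b c d (D.finPart v φ ψ) :=
  ⟨hE.memZx.transpose.mulVec (memLp_const (p := ∞) _),
    hE.memZy.transpose.mulVec (memLp_const (p := ∞) _)⟩

/-- This is the origin of `Kxx` and `Kyy`: applying `Z M⁻¹` to a finite-rank term `Zᵀ k` gives `∫ Z
M⁻¹ Zᵀ`, and applying it to `M f` gives back the moment of `f`. -/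
lemma integral_mul_inv_mulVec {μ : Measure ℝ} [IsFiniteMeasure μ] {Z : ℝ → Matrix q p₁ ℝ}
    {M : ℝ → Matrix p₁ p₁ ℝ} (hZ : MatMemLp Z 2 μ) (hM : MatMemLp (fun x => (M x)⁻¹) ∞ μ)
    (hu : ∀ᵐ x ∂μ, (M x)⁻¹ * M x = 1) (k : q → ℝ) {f : ℝ → p₁ → ℝ} (hf : MemLp f 2 μ) :
    ∫ x, (Z x * (M x)⁻¹) *ᵥ ((Z x)ᵀ *ᵥ k + M x *ᵥ f x) ∂μ
      = (matInt μ fun x => Z x * (M x)⁻¹ * (Z x)ᵀ) *ᵥ k + ∫ x, Z x *ᵥ f x ∂μ := by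
  have h1 : MatMemLp (fun x => Z x * (M x)⁻¹ * (Z x)ᵀ) 1 μ :=
    (MatMemLp.mul (r := 2) hZ hM).mul hZ.transpose
  rw [matInt_mulVec fun i j => memLp_one_iff_integrable.1 (h1 i j), ← integral_add
    (memLp_one_iff_integrable.1 (h1.mulVec (memLp_const (p := ∞) k))) (integrable_mulVec hZ hf)]
  refine integral_congr_ae ?_
  filter_upwards [hu] with x hx
  rw [Matrix.mulVec_add, Matrix.mulVec_mulVec, Matrix.mulVec_mulVec, Matrix.mul_assoc (Z x) _ (M x),
    hx, Matrix.mul_one]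

set_option maxHeartbeats 800000 in
lemma Linv_mem (hE : D.Decomposes a b c d E)
    (hx : MatMemLp (fun x => (D.Qxx x)⁻¹) ∞ (mu1 a b))
    (hy : MatMemLp (fun y => (D.Qyy y)⁻¹) ∞ (mu1 c d)) : (D.Linv a b c d).Mem a b c d := by
  have lx : ∀ {l : Type} [Fintype l] (C : Matrix q l ℝ),
      MatMemLp (fun x => (D.Qxx x)⁻¹ * (D.Zx x)ᵀ * C) 2 (mu1 a b) := fun C =>
    (hx.mul hE.memZx.transpose).mul_const C
  have ly : ∀ {l : Type} [Fintype l] (C : Matrix q l ℝ),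
      MatMemLp (fun y => (D.Qyy y)⁻¹ * (D.Zy y)ᵀ * C) 2 (mu1 c d) := fun C =>
    (hy.mul hE.memZy.transpose).mul_const C
  have rx : MatMemLp (fun x => D.Zx x * (D.Qxx x)⁻¹) 2 (mu1 a b) := hE.memZx.mul hx
  have ry : MatMemLp (fun y => D.Zy y * (D.Qyy y)⁻¹) 2 (mu1 c d) := hE.memZy.mul hy
  exact {
    mem01 := rx.const_mul _
    mem02 := ry.const_mul _
    mem10 := lx _
    mem11_0 := hx
    mem11_1 := mu2_eq_prod a b a b ▸ (lx _).tensor rx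
    mem11_2 := mu2_eq_prod a b a b ▸ (lx _).tensor rx
    mem12 := mu2_eq_prod a b c d ▸ (lx _).tensor ry
    mem20 := ly _
    mem21 := mu2_eq_prod a b c d ▸ ((ly _).tensor rx).swap
    mem22_0 := hy
    mem22_1 := mu2_eq_prod c d c d ▸ (ly _).tensor ry
    mem22_2 := mu2_eq_prod c d c d ▸ (ly _).tensor ry }

lemma Linv_separable : (D.Linv a b c d).Separable := ⟨rfl, rfl⟩

/-- The conditions on the multipliers are hypotheses here; `multiplier_mul_Qxx` and
`multiplier_mul_Qyy` supply them for boundary operators that have an inverse. -/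
lemma PSep_Linv (hE : D.Decomposes a b c d E) (hab : a ≤ b) (hcd : c ≤ d)
    (hD : D.LeftInverse a b c d)
    (hx : MatMemLp (fun x => (D.Qxx x)⁻¹) ∞ (mu1 a b))
    (hy : MatMemLp (fun y => (D.Qyy y)⁻¹) ∞ (mu1 c d))
    (mx : MatMemLp D.Qxx ∞ (mu1 a b)) (my : MatMemLp D.Qyy ∞ (mu1 c d))
    (ux : ∀ᵐ x ∂(mu1 a b), (D.Qxx x)⁻¹ * D.Qxx x = 1)
    (uy : ∀ᵐ y ∂(mu1 c d), (D.Qyy y)⁻¹ * D.Qyy y = 1)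
    {w : RL p₀ p₁} (hw : RL.Mem a b c d w) :
    RL.Eq a b c d (PSep a b c d (D.Linv a b c d)
      (D.finPart w.1 (D.momX a b w.2.1) (D.momY c d w.2.2)
        + (0, fun x => D.Qxx x *ᵥ w.2.1 x, fun y => D.Qyy y *ᵥ w.2.2 y))) w := by
  set v := w.1
  set φ := D.momX a b w.2.1 with hφ
  set ψ := D.momY c d w.2.2 with hψ
  have rx : MatMemLp (fun x => D.Zx x * (D.Qxx x)⁻¹) 2 (mu1 a b) := hE.memZx.mul hx
  have ry : MatMemLp (fun y => D.Zy y * (D.Qyy y)⁻¹) 2 (mu1 c d) := hE.memZy.mul hy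
  have ix : ∀ {l : Type} [Fintype l] (C : Matrix l q ℝ) (k : q → ℝ),
      ∫ x, (C * (D.Zx x * (D.Qxx x)⁻¹)) *ᵥ ((D.Zx x)ᵀ *ᵥ k + D.Qxx x *ᵥ w.2.1 x) ∂(mu1 a b)
        = C *ᵥ (D.Kxx a b *ᵥ k + φ) := fun C k => by
    rw [integral_mul_mulVec (f := fun x => (D.Zx x)ᵀ *ᵥ k + D.Qxx x *ᵥ w.2.1 x) _ rx ((hE.memZx.transpose.mulVec (memLp_const (p := ∞) k)).add
      (mx.mulVec hw.1)), integral_mul_inv_mulVec hE.memZx hx ux k hw.1, Kxx,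
      mInt_eq_matInt hab]
    rfl
  have iy : ∀ {l : Type} [Fintype l] (C : Matrix l q ℝ) (k : q → ℝ),
      ∫ y, (C * (D.Zy y * (D.Qyy y)⁻¹)) *ᵥ ((D.Zy y)ᵀ *ᵥ k + D.Qyy y *ᵥ w.2.2 y) ∂(mu1 c d)
        = C *ᵥ (D.Kyy c d *ᵥ k + ψ) := fun C k => by
    rw [integral_mul_mulVec (f := fun x => (D.Zy x)ᵀ *ᵥ k + D.Qyy x *ᵥ w.2.2 x) _ ry ((hE.memZy.transpose.mulVec (memLp_const (p := ∞) k)).add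
      (my.mulVec hw.2)), integral_mul_inv_mulVec hE.memZy hy uy k hw.2, Kyy,
      mInt_eq_matInt hcd]
    rfl
  refine ⟨?_, ?_, ?_⟩
  · have h0 := congrArg (· *ᵥ v) hD.r00
    have h1 := congrArg (· *ᵥ φ) hD.r0x
    have h2 := congrArg (· *ᵥ ψ) hD.r0y
    simp only [Matrix.add_mulVec, Matrix.mul_add, Matrix.mul_one,
      ← Matrix.mulVec_mulVec, Matrix.one_mulVec, Matrix.zero_mulVec] at h0 h1 h2
    simp only [PSep, finPart, Prod.snd_add, Prod.fst_add, Pi.add_apply]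
    simp only [show (D.Linv a b c d).N01 = fun x => D.H0x' a b c d * (D.Zx x * (D.Qxx x)⁻¹)
      from rfl, show (D.Linv a b c d).N02 = fun y => D.H0y' a b c d * (D.Zy y * (D.Qyy y)⁻¹)
      from rfl, ix, iy]
    have := congrArg₂ (· + ·) h0 (congrArg₂ (· + ·) h1 h2)
    simp only [add_zero] at this
    refine Eq.trans ?_ this
    simp only [Matrix.mulVec_add, add_zero]
    abel
  · filter_upwards [ux] with x ux
    have h0 := congrArg (· *ᵥ v) hD.rx0
    have h1 := congrArg (· *ᵥ φ) hD.rxx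
    have h2 := congrArg (· *ᵥ ψ) hD.rxy
    simp only [Matrix.add_mulVec, Matrix.mul_add, Matrix.mul_one,
      ← Matrix.mulVec_mulVec, Matrix.zero_mulVec] at h0 h1 h2
    have h3 : (D.Qxx x)⁻¹ *ᵥ D.Qxx x *ᵥ w.2.1 x = w.2.1 x := by
      rw [Matrix.mulVec_mulVec, ux, Matrix.one_mulVec]
    simp only [PSep, finPart, Prod.snd_add, Prod.fst_add, Pi.add_apply]
    simp only [Linv, ix, iy]
    simp only [← Matrix.mulVec_mulVec]
    have := congrArg ((D.Qxx x)⁻¹ *ᵥ (D.Zx x)ᵀ *ᵥ ·)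
      (congrArg₂ (· + ·) h0 (congrArg₂ (· + ·) h1 h2))
    simp only [add_zero, Matrix.mulVec_zero] at this
    refine Eq.trans ?_ ((congrArg (w.2.1 x + ·) this).trans (add_zero _))
    simp only [Matrix.mulVec_add, add_zero, h3]
    abel
  · filter_upwards [uy] with y uy
    have h0 := congrArg (· *ᵥ v) hD.ry0
    have h1 := congrArg (· *ᵥ φ) hD.ryx
    have h2 := congrArg (· *ᵥ ψ) hD.ryy
    simp only [Matrix.add_mulVec, Matrix.mul_add, Matrix.mul_one,
      ← Matrix.mulVec_mulVec, Matrix.zero_mulVec] at h0 h1 h2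
    have h3 : (D.Qyy y)⁻¹ *ᵥ D.Qyy y *ᵥ w.2.2 y = w.2.2 y := by
      rw [Matrix.mulVec_mulVec, uy, Matrix.one_mulVec]
    simp only [PSep, finPart, Prod.snd_add, Prod.fst_add, Pi.add_apply]
    simp only [Linv, ix, iy]
    simp only [← Matrix.mulVec_mulVec]
    have := congrArg ((D.Qyy y)⁻¹ *ᵥ (D.Zy y)ᵀ *ᵥ ·)
      (congrArg₂ (· + ·) h0 (congrArg₂ (· + ·) h1 h2))
    simp only [add_zero, Matrix.mulVec_zero] at this
    refine Eq.trans ?_ ((congrArg (w.2.2 y + ·) this).trans (add_zero _))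
    simp only [Matrix.mulVec_add, add_zero, h3]
    abel

end Operator

end Decomp

/-! ### The multiplier part of a left inverse. -/

lemma PSep_sum {p₀ p₁ r₀ r₁ : Type} [Fintype p₀] [Fintype p₁] [Fintype r₀] [Fintype r₁]
    {a b c d : ℝ} {N : Param011 p₀ p₁ r₀ r₁} (hN : N.Mem a b c d) {ι : Type*} (s : Finset ι)
    (t : ι → ℝ) {w : ι → RL r₀ r₁} (hw : ∀ i, RL.Mem a b c d (w i)) :
    RL.Mem a b c d (∑ i ∈ s, t i • w i) ∧
    RL.Eq a b c d (PSep a b c d N (∑ i ∈ s, t i • w i)) (∑ i ∈ s, t i • PSep a b c d N (w i)) := by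
  classical
  induction s using Finset.induction_on with
  | empty =>
    refine ⟨RL.mem_zero, ?_⟩
    simp only [Finset.sum_empty]
    have := PSep_smul (a := a) (b := b) (c := c) (d := d) N 0 0
    rw [zero_smul, zero_smul] at this
    rw [this]
    exact RL.Eq.refl _
  | insert i s hi ih =>
    rw [Finset.sum_insert hi, Finset.sum_insert hi]
    refine ⟨((hw i).smul _).add ih.1, (PSep_add hN ((hw i).smul _) ih.1).trans ?_⟩
    rw [PSep_smul]
    exact (RL.Eq.refl _).add ih.2

namespace Decomp

variable {p₀ p₁ q : Type} [Fintype p₀] [Fintype p₁] [Fintype q]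
  [DecidableEq p₀] [DecidableEq p₁] [DecidableEq q] {a b c d : ℝ} {D : Decomp p₀ p₁ q}
  {E N : Param011 p₀ p₁ p₀ p₁}

/-- `finPart` as a linear map of its moments. -/
def finPartL (D : Decomp p₀ p₁ q) : (q → ℝ) × (q → ℝ) →ₗ[ℝ] RL p₀ p₁ where
  toFun m := D.finPart 0 m.1 m.2
  map_add' m m' := by
    simp only [finPart, Matrix.mulVec_zero, zero_add, Prod.fst_add, Prod.snd_add,
      Matrix.mulVec_add]
    refine Prod.ext ?_ (Prod.ext (funext fun x => ?_) (funext fun x => ?_)) <;>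
      simp only [Prod.fst_add, Prod.snd_add, Pi.add_apply (M := fun _ => p₁ → ℝ)] <;> abel
  map_smul' s m := by
    simp only [finPart, Matrix.mulVec_zero, zero_add, Prod.smul_fst, Prod.smul_snd,
      Matrix.mulVec_smul, RingHom.id_apply, ← smul_add]
    rfl

/-- An operator applied to a finite-rank family stays of finite rank: the columns of `G` are the
images of the coordinate vectors. As linearity holds modulo null sets, the exceptional set may
depend on `φ`. -/
lemma PSep_finPart_x (hN : N.Mem a b c d) (hE : D.Decomposes a b c d E) :
    ∃ G : ℝ → Matrix p₁ q ℝ, MatMemLp G 2 (mu1 a b) ∧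
      ∀ φ, ∀ᵐ x ∂(mu1 a b), (PSep a b c d N (D.finPart 0 φ 0)).2.1 x = G x *ᵥ φ := by
  refine ⟨fun x => Matrix.of fun i k =>
    (PSep a b c d N (D.finPart 0 (fun j => if k = j then 1 else 0) 0)).2.1 x i,
    fun i k => (PSep_mem hN (finPart_mem hE _ _ _)).1.eval i, fun φ => ?_⟩
  have h1 := (D.finPartL.comp (LinearMap.inl ℝ (q → ℝ) (q → ℝ))).pi_apply_eq_sum_univ φ
  have h2 := (PSep_sum hN Finset.univ φ
    fun k => finPart_mem hE 0 (fun j => if k = j then 1 else 0) 0).2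
  simp only [LinearMap.comp_apply, LinearMap.inl_apply] at h1
  rw [show D.finPart 0 φ 0 = ∑ k, φ k • D.finPart 0 (fun j => if k = j then 1 else 0) 0 from h1]
  filter_upwards [h2.2.1] with x hx
  rw [hx]
  ext i
  simp only [Prod.snd_sum, Prod.fst_sum, Finset.sum_apply, Matrix.mulVec, dotProduct,
    Matrix.of_apply, Prod.smul_snd, Prod.smul_fst, Pi.smul_apply, smul_eq_mul]
  exact Finset.sum_congr rfl fun k _ => mul_comm _ _

lemma PSep_finPart_y (hN : N.Mem a b c d) (hE : D.Decomposes a b c d E) :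
    ∃ G : ℝ → Matrix p₁ q ℝ, MatMemLp G 2 (mu1 c d) ∧
      ∀ ψ, ∀ᵐ y ∂(mu1 c d), (PSep a b c d N (D.finPart 0 0 ψ)).2.2 y = G y *ᵥ ψ := by
  refine ⟨fun x => Matrix.of fun i k =>
    (PSep a b c d N (D.finPart 0 0 (fun j => if k = j then 1 else 0))).2.2 x i,
    fun i k => (PSep_mem hN (finPart_mem hE _ _ _)).2.eval i, fun φ => ?_⟩
  have h1 := (D.finPartL.comp (LinearMap.inr ℝ (q → ℝ) (q → ℝ))).pi_apply_eq_sum_univ φ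
  have h2 := (PSep_sum hN Finset.univ φ
    fun k => finPart_mem hE 0 0 (fun j => if k = j then 1 else 0)).2
  simp only [LinearMap.comp_apply, LinearMap.inr_apply] at h1
  rw [show D.finPart 0 0 φ = ∑ k, φ k • D.finPart 0 0 (fun j => if k = j then 1 else 0) from h1]
  filter_upwards [h2.2.2] with x hx
  rw [hx]
  ext i
  simp only [Prod.snd_sum, Finset.sum_apply, Matrix.mulVec, dotProduct,
    Matrix.of_apply, Prod.smul_snd, Pi.smul_apply, smul_eq_mul]
  exact Finset.sum_congr rfl fun k _ => mul_comm _ _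

/-- On inputs `(0, f, 0)` the identity `N E = 1` says that multiplication by `1 - N11_0 Qxx` equals
a Hilbert–Schmidt operator, so it vanishes. Existence of an inverse thus forces the multiplier of
`E` to be invertible almost everywhere. -/
lemma multiplier_mul_Qxx (hN : N.Mem a b c d) (hE : D.Decomposes a b c d E)
    (mx : MatMemLp D.Qxx ∞ (mu1 a b))
    (hinv : ∀ w, RL.Mem a b c d w → RL.Eq a b c d (PSep a b c d N (PSep a b c d E w)) w) :
    ∀ᵐ x ∂(mu1 a b), N.N11_0 x * D.Qxx x = 1 := by
  obtain ⟨G, hG, hGφ⟩ := PSep_finPart_x hN hE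
  -- `N11_1 Qxx` comes from applying `N` to the multiplier part `Qxx f`, and `G Zx` from applying it
  -- to the finite-rank part, whose moment is `∫ Zx f`.
  have hk : MatMemLp (fun z : ℝ × ℝ => N.N11_1 z.1 z.2 * D.Qxx z.2 + G z.1 * D.Zx z.2) 2
      ((mu1 a b).prod (mu1 a b)) := (hN.ker11.mul mx.snd).add (hG.tensor hE.memZx)
  have := ae_eq_zero_of_mulVec_eq_integral (M := fun x => 1 - N.N11_0 x * D.Qxx x) hk
    fun f hf => by
      have hw : RL.Mem a b c d ((0, f, 0) : RL p₀ p₁) := ⟨hf, MemLp.zero⟩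
      have e1 := PSep_eq_finPart hE hw
      have hy0 : D.momY c d (0 : ℝ → p₁ → ℝ) = 0 := by simp [momY]
      simp only [hy0, Pi.zero_apply, Matrix.mulVec_zero] at e1
      set φ := D.momX a b f with hφ
      have m2 : RL.Mem a b c d ((0, fun x => D.Qxx x *ᵥ f x, fun _ => 0) : RL p₀ p₁) :=
        ⟨mx.mulVec hf, MemLp.zero⟩
      have e2 := ((PSep_congr N e1).symm.trans (hinv _ hw)).symm.trans
        (PSep_add hN (finPart_mem hE 0 φ 0) m2)
      filter_upwards [e2.2.1, hGφ φ, hN.ker11.ae_right] with x h1 h2 h3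
      simp only [Prod.snd_add, Prod.fst_add] at h1
      rw [Pi.add_apply, h2] at h1
      simp only [PSep, Matrix.mulVec_zero, integral_zero, add_zero, zero_add] at h1
      have h4 : f x - N.N11_0 x *ᵥ D.Qxx x *ᵥ f x
          = G x *ᵥ φ + ∫ (θ : ℝ), N.N11_1 x θ *ᵥ D.Qxx θ *ᵥ f θ ∂mu1 a b :=
        sub_eq_of_eq_add (h1.trans (by abel))
      rw [Matrix.sub_mulVec, Matrix.one_mulVec, ← Matrix.mulVec_mulVec, h4, hφ, momX, mulVec_integral _ (integrable_mulVec hE.memZx hf),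
        ← integral_add]
      · refine integral_congr_ae (.of_forall fun θ => ?_)
        simp only [Matrix.add_mulVec, ← Matrix.mulVec_mulVec]
        exact add_comm _ _
      · simp_rw [Matrix.mulVec_mulVec]
        exact integrable_mulVec (hE.memZx.const_mul _) hf
      · exact integrable_mulVec h3 (mx.mulVec hf)
  filter_upwards [this] with x hx
  exact (sub_eq_zero.1 hx).symm

lemma multiplier_mul_Qyy (hN : N.Mem a b c d) (hE : D.Decomposes a b c d E)
    (my : MatMemLp D.Qyy ∞ (mu1 c d))
    (hinv : ∀ w, RL.Mem a b c d w → RL.Eq a b c d (PSep a b c d N (PSep a b c d E w)) w) :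
    ∀ᵐ y ∂(mu1 c d), N.N22_0 y * D.Qyy y = 1 := by
  obtain ⟨G, hG, hGφ⟩ := PSep_finPart_y hN hE
  have hk : MatMemLp (fun z : ℝ × ℝ => N.N22_1 z.1 z.2 * D.Qyy z.2 + G z.1 * D.Zy z.2) 2
      ((mu1 c d).prod (mu1 c d)) := (hN.ker22.mul my.snd).add (hG.tensor hE.memZy)
  have := ae_eq_zero_of_mulVec_eq_integral (M := fun x => 1 - N.N22_0 x * D.Qyy x) hk
    fun f hf => by
      have hw : RL.Mem a b c d ((0, 0, f) : RL p₀ p₁) := ⟨MemLp.zero, hf⟩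
      have e1 := PSep_eq_finPart hE hw
      have hx0 : D.momX a b (0 : ℝ → p₁ → ℝ) = 0 := by simp [momX]
      simp only [hx0, Pi.zero_apply, Matrix.mulVec_zero] at e1
      set φ := D.momY c d f with hφ
      have m2 : RL.Mem a b c d ((0, fun _ => 0, fun x => D.Qyy x *ᵥ f x) : RL p₀ p₁) :=
        ⟨MemLp.zero, my.mulVec hf⟩
      have e2 := ((PSep_congr N e1).symm.trans (hinv _ hw)).symm.trans
        (PSep_add hN (finPart_mem hE 0 0 φ) m2)
      filter_upwards [e2.2.2, hGφ φ, hN.ker22.ae_right] with x h1 h2 h3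
      simp only [Prod.snd_add] at h1
      rw [Pi.add_apply, h2] at h1
      simp only [PSep, Matrix.mulVec_zero, integral_zero, add_zero, zero_add] at h1
      have h4 : f x - N.N22_0 x *ᵥ D.Qyy x *ᵥ f x
          = G x *ᵥ φ + ∫ (ν : ℝ), N.N22_1 x ν *ᵥ D.Qyy ν *ᵥ f ν ∂mu1 c d :=
        sub_eq_of_eq_add (h1.trans (by abel))
      rw [Matrix.sub_mulVec, Matrix.one_mulVec, ← Matrix.mulVec_mulVec, h4, hφ, momY, mulVec_integral _ (integrable_mulVec hE.memZy hf),
        ← integral_add]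
      · refine integral_congr_ae (.of_forall fun θ => ?_)
        simp only [Matrix.add_mulVec, ← Matrix.mulVec_mulVec]
        exact add_comm _ _
      · simp_rw [Matrix.mulVec_mulVec]
        exact integrable_mulVec (hE.memZy.const_mul _) hf
      · exact integrable_mulVec h3 (my.mulVec hf)
  filter_upwards [this] with x hx
  exact (sub_eq_zero.1 hx).symm

end Decomp

/-! ### The explicit inversion formula. -/

section Inverse

variable {a b c d : ℝ} {n₁ n₂ : ℕ} {B : BParam n₁ n₂}

/-- The known inverse `Ehat` has two roles. Its multipliers show that `Qxx⁻¹` and `Qyy⁻¹` exist and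
are essentially bounded, and its right inverse property upgrades the computed left inverse to a
two-sided one. -/
theorem inverseParam_Linv (hab : a ≤ b) (hcd : c ≤ d) (hB : B.Mem a b c d) (hsep : B.Separable)
    {Ehat : CoreParam n₁ n₂} (hEhat : InverseParam a b c d B Ehat) {q : ℕ}
    {Q : Decomp (Core0 n₁ n₂) (Core1 n₁ n₂) (Fin q)}
    (hQ : Q.Decomposes a b c d (EParam a b c d B)) (hinv : Q.Invertible a b c d) :
    InverseParam a b c d B (Q.Linv a b c d) := by
  have mx : MatMemLp Q.Qxx ∞ (mu1 a b) := (hB.mem11_0.mul_const _).congr hQ.eq11_0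
  have my : MatMemLp Q.Qyy ∞ (mu1 c d) := (hB.mem22_0.mul_const _).congr hQ.eq22_0
  have hcomp := fun w hw => BH1_eq_PSep_EParam hab hcd hB hsep (w := w) hw
  have memBH : ∀ w, RL.Mem a b c d w → RL.Mem a b c d (BH1 a b c d B w) := fun w hw =>
    P011_mem hab hcd hB hsep (P011_mem hab hcd H1Param_mem H1Param_separable hw)
  have hleft : ∀ w, RL.Mem a b c d w →
      RL.Eq a b c d (PSep a b c d Ehat (PSep a b c d (EParam a b c d B) w)) w := fun w hw =>
    (PSep_congr _ (hcomp w hw)).symm.trans <|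
      (P011_eq_PSep hab hcd hEhat.mem hEhat.separable (memBH w hw)).symm.trans
        (hEhat.inverse w hw).1
  have ix := Decomp.multiplier_mul_Qxx hEhat.mem hQ mx hleft
  have iy := Decomp.multiplier_mul_Qyy hEhat.mem hQ my hleft
  have ex : ∀ᵐ x ∂(mu1 a b), Ehat.N11_0 x = (Q.Qxx x)⁻¹ :=
    ix.mono fun x hx => (Matrix.inv_eq_left_inv hx).symm
  have ey : ∀ᵐ y ∂(mu1 c d), Ehat.N22_0 y = (Q.Qyy y)⁻¹ :=
    iy.mono fun x hx => (Matrix.inv_eq_left_inv hx).symm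
  have hx := hEhat.mem.mem11_0.congr ex
  have hy := hEhat.mem.mem22_0.congr ey
  have hmem := Decomp.Linv_mem hQ hx hy
  have hL : ∀ w, RL.Mem a b c d w →
      RL.Eq a b c d (P011 a b c d (Q.Linv a b c d) (BH1 a b c d B w)) w := fun w hw =>
    (P011_eq_PSep hab hcd hmem Decomp.Linv_separable (memBH w hw)).trans <|
      (PSep_congr _ ((hcomp w hw).trans (Decomp.PSep_eq_finPart hQ hw))).trans <|
        Decomp.PSep_Linv hQ hab hcd (Decomp.leftInverse hinv) hx hy mx my
          (by filter_upwards [ix, ex] with x h1 h2; rw [← h2, h1])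
          (by filter_upwards [iy, ey] with x h1 h2; rw [← h2, h1]) hw
  refine ⟨hmem, Decomp.Linv_separable, fun w hw => ⟨hL w hw, ?_⟩⟩
  have hu := P011_mem hab hcd hEhat.mem hEhat.separable hw
  have h1 : RL.Eq a b c d (BH1 a b c d B (P011 a b c d Ehat w)) w := (hEhat.inverse w hw).2
  -- A left inverse `L` of an operator `A` with right inverse `Ê` satisfies `L = L A Ê = Ê`.
  have h2 : RL.Eq a b c d (P011 a b c d (Q.Linv a b c d) w) (P011 a b c d Ehat w) :=
    (P011_congr hab hcd _ h1).symm.trans (hL _ hu)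
  exact (BH1_congr hab hcd B h2).trans h1

end Inverse

/-! ### Primitives in one variable and Fubini on triangles and rectangles. -/

section Primitives

lemma integral_ite_le {a b : ℝ} (f : ℝ → ℝ) {s : ℝ} (hs : s ∈ Icc a b) :
    ∫ θ, (if θ ≤ s then f θ else 0) ∂(mu1 a b) = ∫ θ in a..s, f θ := by
  have h1 : (fun θ => if θ ≤ s then f θ else 0) = (Iic s).indicator f := rfl
  rw [h1, integral_indicator measurableSet_Iic, mu1, Measure.restrict_restrict measurableSet_Iic,
    intervalIntegral.integral_of_le hs.1, ← integral_Icc_eq_integral_Ioc]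
  congr 2
  ext θ
  simp only [mem_inter_iff, mem_Iic, mem_Icc]
  exact ⟨fun h => ⟨h.2.1, h.1⟩, fun h => ⟨h.2, h.1, h.2.trans hs.2⟩⟩

lemma integral_ite_ge {a b : ℝ} (f : ℝ → ℝ) {s : ℝ} (hs : s ∈ Icc a b) :
    ∫ θ, (if s ≤ θ then f θ else 0) ∂(mu1 a b) = ∫ θ in s..b, f θ := by
  have h1 : (fun θ => if s ≤ θ then f θ else 0) = (Ici s).indicator f := rfl
  rw [h1, integral_indicator measurableSet_Ici, mu1, Measure.restrict_restrict measurableSet_Ici,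
    intervalIntegral.integral_of_le hs.2, ← integral_Icc_eq_integral_Ioc]
  congr 2
  ext θ
  simp only [mem_inter_iff, mem_Ici, mem_Icc]
  exact ⟨fun h => ⟨h.1, h.2.2⟩, fun h => ⟨h.1, hs.1.trans h.1, h.2⟩⟩

lemma measurableSet_le_prod : MeasurableSet {z : ℝ × ℝ | z.2 ≤ z.1} :=
  measurableSet_le measurable_snd measurable_fst

/-- Fubini's theorem on the triangle `θ ≤ s`. -/
lemma integral_mul_primitive {a b : ℝ} (hab : a ≤ b) {f g : ℝ → ℝ} (hf : Integrable f (mu1 a b))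
    (hg : Integrable g (mu1 a b)) :
    ∫ s in a..b, g s * (∫ θ in a..s, f θ) = ∫ θ in a..b, (∫ s in θ..b, g s) * f θ := by
  have hI : Integrable (fun z : ℝ × ℝ => if z.2 ≤ z.1 then g z.1 * f z.2 else 0)
      ((mu1 a b).prod (mu1 a b)) :=
    (hg.mul_prod hf).indicator measurableSet_le_prod
  have := integral_integral_swap
    (f := fun s θ => if θ ≤ s then g s * f θ else 0) hI
  rw [intervalIntegral_eq_mu1 hab, intervalIntegral_eq_mu1 hab]
  refine Eq.trans ?_ (this.trans ?_) <;> refine integral_congr_ae ?_ <;>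
    filter_upwards [ae_mem_Icc a b] with t ht
  · rw [← integral_ite_le f ht, ← integral_const_mul]
    simp only [mul_ite, mul_zero]
  · rw [← integral_ite_ge g ht, ← integral_mul_const]
    simp only [ite_mul, zero_mul]

lemma integral_primitive {a b : ℝ} {f : ℝ → ℝ} (hf : Integrable f (mu1 a b))
    {x : ℝ} (hx : x ∈ Icc a b) :
    ∫ s in a..x, (∫ θ in a..s, f θ) = ∫ θ in a..x, (x - θ) * f θ := by
  have hf' : Integrable f (mu1 a x) := by
    have h : IntegrableOn f (Icc a b) := hf
    exact h.mono_set (Icc_subset_Icc_right hx.2)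
  have := integral_mul_primitive hx.1 hf' (integrable_const (1 : ℝ))
  simpa using this

/-- Integration by parts against a primitive. -/
lemma integral_deriv_mul_primitive {a b : ℝ} (hab : a ≤ b) {ψ f : ℝ → ℝ} (hψ : ContDiff ℝ 1 ψ)
    (ha : ψ a = 0) (hb : ψ b = 0) (hf : Integrable f (mu1 a b)) (k : ℝ) :
    ∫ x, deriv ψ x * (k + ∫ θ in a..x, f θ) ∂(mu1 a b) = -∫ x, ψ x * f x ∂(mu1 a b) := by
  have hcont : Continuous (deriv ψ) := hψ.continuous_deriv le_rfl
  have hder : ∀ s t, ∫ x in s..t, deriv ψ x = ψ t - ψ s := fun s t =>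
    intervalIntegral.integral_deriv_eq_sub (fun x _ => hψ.differentiable one_ne_zero x)
      (hcont.intervalIntegrable _ _)
  have hg : Integrable (deriv ψ) (mu1 a b) :=
    memLp_one_iff_integrable.1 (memLp_mu1_of_continuous hcont)
  -- Exchanging the integrals leaves `∫_θ^b ψ' = -ψ(θ)`. This gives integration by parts for merely
  -- integrable `f`, with no appeal to absolute continuity.
  have h1 := integral_mul_primitive hab hf hg
  simp only [hder, hb, zero_sub] at h1
  rw [← intervalIntegral_eq_mu1 hab, ← intervalIntegral_eq_mu1 hab,
    ← intervalIntegral.integral_neg]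
  simp only [← neg_mul]
  rw [← h1]
  have hprim : ContinuousOn (fun x => ∫ θ in a..x, f θ) (uIcc a b) :=
    intervalIntegral.continuousOn_primitive_interval' (intervalIntegrable_of_mu1 hf
      (left_mem_Icc.2 hab) (right_mem_Icc.2 hab)) left_mem_uIcc
  simp only [mul_add]
  rw [intervalIntegral.integral_add ((hcont.mul_const k).intervalIntegrable _ _)
    (ContinuousOn.intervalIntegrable (u := fun x => deriv ψ x * ∫ θ in a..x, f θ)
      (hcont.continuousOn.mul hprim)), intervalIntegral.integral_mul_const,
    hder, ha, hb]
  simp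

/-- The primitive in the first variable, vanishing on `x = a`. -/
def Ix (a : ℝ) (r : ℝ × ℝ → ℝ) (z : ℝ × ℝ) : ℝ := ∫ θ in a..z.1, r (θ, z.2)

/-- The primitive in the second variable, vanishing on `y = c`. -/
def Iy (c : ℝ) (r : ℝ × ℝ → ℝ) (z : ℝ × ℝ) : ℝ := ∫ ν in c..z.2, r (z.1, ν)

variable {a b c d : ℝ}

lemma memLp_swap {f : ℝ × ℝ → ℝ} {p : ℝ≥0∞} (hf : MemLp f p (mu2 a b c d)) :
    MemLp (fun z => f z.swap) p (mu2 c d a b) := by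
  rw [mu2_eq_prod] at hf ⊢
  exact hf.comp_measurePreserving Measure.measurePreserving_swap

lemma ae_swap {p : ℝ × ℝ → Prop} (h : ∀ᵐ z ∂(mu2 a b c d), p z) :
    ∀ᵐ z ∂(mu2 c d a b), p z.swap := by
  rw [mu2_eq_prod] at h ⊢
  exact Measure.measurePreserving_swap.quasiMeasurePreserving.ae h

lemma ae_ae_mu2 {p : ℝ × ℝ → Prop} (h : ∀ᵐ z ∂(mu2 a b c d), p z) :
    ∀ᵐ x ∂(mu1 a b), ∀ᵐ y ∂(mu1 c d), p (x, y) :=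
  Measure.ae_ae_of_ae_prod (mu2_eq_prod a b c d ▸ h)

lemma ae_ae_mu2' {p : ℝ × ℝ → Prop} (h : ∀ᵐ z ∂(mu2 a b c d), p z) :
    ∀ᵐ y ∂(mu1 c d), ∀ᵐ x ∂(mu1 a b), p (x, y) :=
  ae_ae_mu2 (ae_swap h)

lemma ae_fst {p : ℝ → Prop} (h : ∀ᵐ x ∂(mu1 a b), p x) : ∀ᵐ z ∂(mu2 a b c d), p z.1 := by
  rw [mu2_eq_prod]
  exact Measure.quasiMeasurePreserving_fst.ae h

lemma ae_snd {p : ℝ → Prop} (h : ∀ᵐ y ∂(mu1 c d), p y) : ∀ᵐ z ∂(mu2 a b c d), p z.2 := by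
  rw [mu2_eq_prod]
  exact Measure.quasiMeasurePreserving_snd.ae h

lemma memLp_fst {p : ℝ≥0∞} {f : ℝ → ℝ} (h : MemLp f p (mu1 a b)) :
    MemLp (fun z => f z.1) p (mu2 a b c d) := by
  rw [mu2_eq_prod]; exact h.comp_fst _

lemma memLp_snd {p : ℝ≥0∞} {f : ℝ → ℝ} (h : MemLp f p (mu1 c d)) :
    MemLp (fun z => f z.2) p (mu2 a b c d) := by
  rw [mu2_eq_prod]; exact h.comp_snd _

lemma memLp_primitive {f : ℝ → ℝ} (hf : Integrable f (mu1 a b)) (p : ℝ≥0∞) :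
    MemLp (fun x => ∫ θ in a..x, f θ) p (mu1 a b) := by
  rcases le_or_gt a b with hab | hab
  · have hc : ContinuousOn (fun x => ∫ θ in a..x, f θ) (Icc a b) := by
      have := intervalIntegral.continuousOn_primitive_interval' (intervalIntegrable_of_mu1 hf
        (left_mem_Icc.2 hab) (right_mem_Icc.2 hab)) left_mem_uIcc
      rwa [uIcc_of_le hab] at this
    obtain ⟨C, hC⟩ := isCompact_Icc.exists_bound_of_continuousOn hc
    refine MemLp.of_bound (hc.aestronglyMeasurable measurableSet_Icc) C ?_
    filter_upwards [ae_mem_Icc a b] with x hx using hC x hx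
  · rw [mu1, Icc_eq_empty (not_le.2 hab), Measure.restrict_empty]
    exact MemLp.of_bound (aestronglyMeasurable_zero_measure _) 0 (by simp)

lemma ae_slice_x {r : ℝ × ℝ → ℝ} (hr : MemLp r 2 (mu2 a b c d)) :
    ∀ᵐ x ∂(mu1 a b), MemLp (fun y => r (x, y)) 2 (mu1 c d) :=
  ae_memLp_two_right (mu2_eq_prod a b c d ▸ hr)

lemma ae_slice_y {r : ℝ × ℝ → ℝ} (hr : MemLp r 2 (mu2 a b c d)) :
    ∀ᵐ y ∂(mu1 c d), MemLp (fun x => r (x, y)) 2 (mu1 a b) :=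
  ae_slice_x (memLp_swap hr)

/-- On each horizontal line the primitive is an integral operator with kernel the indicator of `θ ≤
x`. Cauchy–Schwarz applies with a constant bound for the indicator and the line integral of `r²` for
the other factor. -/
lemma memLp_Ix {r : ℝ × ℝ → ℝ} (hr : MemLp r 2 (mu2 a b c d)) :
    MemLp (Ix a r) 2 (mu2 a b c d) := by
  have hr' : MemLp (fun z : ℝ × ℝ => r z.swap) 2 ((mu1 c d).prod (mu1 a b)) :=
    mu2_eq_prod c d a b ▸ memLp_swap hr
  have q2 : Measure.QuasiMeasurePreserving (Prod.map Prod.snd id : (ℝ × ℝ) × ℝ → ℝ × ℝ)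
      (((mu1 a b).prod (mu1 c d)).prod (mu1 a b)) ((mu1 c d).prod (mu1 a b)) :=
    MeasureTheory.QuasiMeasurePreserving.prodMap Measure.quasiMeasurePreserving_snd (.id _)
  have hm : Measurable fun w : (ℝ × ℝ) × ℝ => if w.2 ≤ w.1.1 then (1 : ℝ) else 0 :=
    Measurable.ite (measurableSet_le (by fun_prop) (by fun_prop)) measurable_const
      measurable_const
  have hle : ∀ (z : ℝ × ℝ) (t : ℝ), ‖if t ≤ z.1 then (1 : ℝ) else 0‖ ≤ 1 := fun z t => by
    split_ifs <;> simp
  have hmem : ∀ z : ℝ × ℝ, MemLp (fun t => if t ≤ z.1 then (1 : ℝ) else 0) 2 (mu1 a b) :=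
    fun z => MemLp.of_bound (hm.comp (measurable_const.prodMk measurable_id)).aestronglyMeasurable
      1 (.of_forall (hle z))
  have key := memLp_two_integral_mul (μ := (mu1 a b).prod (mu1 c d)) (ν := mu1 a b)
    (u := fun w => if w.2 ≤ w.1.1 then (1 : ℝ) else 0) (v := fun w => r (w.2, w.1.2))
    (U := fun _ => ∫ t, (1 : ℝ) ∂(mu1 a b)) (V := fun z => ∫ t, r (t, z.2) ^ 2 ∂(mu1 a b))
    hm.aestronglyMeasurable (hr'.1.comp_quasiMeasurePreserving q2)
    (.of_forall fun z => ⟨hmem z, integral_mono_of_nonneg (.of_forall fun t => sq_nonneg _)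
      (integrable_const _) (.of_forall fun t => by dsimp only; split_ifs <;> simp)⟩)
    (by
      filter_upwards [Measure.quasiMeasurePreserving_snd.ae (ae_memLp_two_right hr')] with s hs
      exact ⟨hs, le_rfl⟩)
    (by
      refine Integrable.const_mul (Integrable.comp_snd (f := fun y => ∫ t, r (t, y) ^ 2 ∂(mu1 a b))
        ?_ _) _
      exact ((memLp_two_iff_integrable_sq hr'.1).1 hr').integral_prod_left)
  rw [mu2_eq_prod]
  refine key.ae_eq ?_
  rw [← mu2_eq_prod]
  filter_upwards [ae_fst (ae_mem_Icc a b)] with z hz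
  rw [Ix, ← integral_ite_le _ hz]
  simp only [ite_mul, one_mul, zero_mul]

lemma memLp_Iy {r : ℝ × ℝ → ℝ} (hr : MemLp r 2 (mu2 a b c d)) :
    MemLp (Iy c r) 2 (mu2 a b c d) :=
  memLp_swap (memLp_Ix (memLp_swap hr))

lemma integrable_of_memLp_two {α : Type*} [MeasurableSpace α] {μ : Measure α} [IsFiniteMeasure μ]
    {f : α → ℝ} (hf : MemLp f 2 μ) : Integrable f μ :=
  hf.integrable (by norm_num)

lemma Ix_congr {r r' : ℝ × ℝ → ℝ} (h : r =ᵐ[mu2 a b c d] r') :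
    Ix a r =ᵐ[mu2 a b c d] Ix a r' := by
  filter_upwards [ae_fst (ae_mem_Icc a b), ae_snd (ae_ae_mu2' h)] with z hz h1
  have hab := hz.1.trans hz.2
  exact intervalIntegral_congr_mu1 h1 (left_mem_Icc.2 hab) hz

lemma Iy_congr {r r' : ℝ × ℝ → ℝ} (h : r =ᵐ[mu2 a b c d] r') :
    Iy c r =ᵐ[mu2 a b c d] Iy c r' :=
  ae_swap (Ix_congr (ae_swap h))

lemma Ix_add {r r' : ℝ × ℝ → ℝ} (hr : MemLp r 2 (mu2 a b c d)) (hr' : MemLp r' 2 (mu2 a b c d)) :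
    Ix a (fun z => r z + r' z) =ᵐ[mu2 a b c d] fun z => Ix a r z + Ix a r' z := by
  filter_upwards [ae_fst (ae_mem_Icc a b), ae_snd (ae_slice_y hr), ae_snd (ae_slice_y hr')]
    with z hz h1 h2
  have hab := hz.1.trans hz.2
  exact intervalIntegral.integral_add
    (intervalIntegrable_of_mu1 (integrable_of_memLp_two h1) (left_mem_Icc.2 hab) hz)
    (intervalIntegrable_of_mu1 (integrable_of_memLp_two h2) (left_mem_Icc.2 hab) hz)

lemma Iy_add {r r' : ℝ × ℝ → ℝ} (hr : MemLp r 2 (mu2 a b c d)) (hr' : MemLp r' 2 (mu2 a b c d)) :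
    Iy c (fun z => r z + r' z) =ᵐ[mu2 a b c d] fun z => Iy c r z + Iy c r' z :=
  ae_swap (Ix_add (memLp_swap hr) (memLp_swap hr'))

lemma integral_rect {r : ℝ × ℝ → ℝ} (hr : Integrable r (mu2 a b c d)) {x y : ℝ}
    (hx : x ∈ Icc a b) (hy : y ∈ Icc c d) :
    ∫ θ in a..x, ∫ ν in c..y, r (θ, ν) = ∫ z, r z ∂(mu2 a x c y) := by
  have hr' : Integrable r ((mu1 a x).prod (mu1 c y)) := by
    rw [← mu2_eq_prod]
    have h : IntegrableOn r (Icc a b ×ˢ Icc c d) := hr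
    exact h.mono_set (prod_mono (Icc_subset_Icc_right hx.2) (Icc_subset_Icc_right hy.2))
  rw [mu2_eq_prod, integral_prod _ hr', intervalIntegral_eq_mu1 hx.1]
  simp_rw [intervalIntegral_eq_mu1 hy.1]

lemma integral_mu2_swap (r : ℝ × ℝ → ℝ) :
    ∫ z, r z.swap ∂(mu2 c d a b) = ∫ z, r z ∂(mu2 a b c d) := by
  rw [mu2_eq_prod, mu2_eq_prod]
  exact integral_prod_swap r

/-- Both orders give the integral of `r` over `[a, x] × [c, y]`, at every point of the rectangle. -/
lemma Ix_Iy {r : ℝ × ℝ → ℝ} (hr : Integrable r (mu2 a b c d)) {x y : ℝ}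
    (hx : x ∈ Icc a b) (hy : y ∈ Icc c d) : Ix a (Iy c r) (x, y) = Iy c (Ix a r) (x, y) := by
  have hr' : Integrable (fun z => r z.swap) (mu2 c d a b) := by
    rw [mu2_eq_prod] at hr ⊢; exact hr.swap
  have h1 := integral_rect hr hx hy
  have h2 := integral_rect hr' hy hx
  rw [integral_mu2_swap] at h2
  exact h1.trans h2.symm

end Primitives

/-! ### Partial derivatives of test functions. -/

section TestFunctions

/-- The partial derivative in the first variable. -/
def Dx (φ : ℝ × ℝ → ℝ) (z : ℝ × ℝ) : ℝ := deriv (fun s => φ (s, z.2)) z.1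

/-- The partial derivative in the second variable. -/
def Dy (φ : ℝ × ℝ → ℝ) (z : ℝ × ℝ) : ℝ := deriv (fun t => φ (z.1, t)) z.2

/-- Smooth functions with compact support in the open rectangle. -/
structure IsTest (a b c d : ℝ) (φ : ℝ × ℝ → ℝ) : Prop where
  smooth : ContDiff ℝ (⊤ : ℕ∞) φ
  compact : HasCompactSupport φ
  subset : tsupport φ ⊆ Ioo a b ×ˢ Ioo c d

variable {a b c d : ℝ} {φ : ℝ × ℝ → ℝ}

lemma Dx_eq_fderiv (hφ : ContDiff ℝ (⊤ : ℕ∞) φ) (z : ℝ × ℝ) : Dx φ z = fderiv ℝ φ z (1, 0) := by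
  have h1 : HasFDerivAt φ (fderiv ℝ φ z) (z.1, z.2) :=
    (hφ.differentiable (by simp) z).hasFDerivAt
  have h2 : HasDerivAt (fun s : ℝ => (s, z.2)) ((1 : ℝ), (0 : ℝ)) z.1 :=
    (hasDerivAt_id _).prodMk (hasDerivAt_const _ _)
  exact (h1.comp_hasDerivAt z.1 h2).deriv

lemma Dy_eq_fderiv (hφ : ContDiff ℝ (⊤ : ℕ∞) φ) (z : ℝ × ℝ) : Dy φ z = fderiv ℝ φ z (0, 1) := by
  have h1 : HasFDerivAt φ (fderiv ℝ φ z) (z.1, z.2) :=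
    (hφ.differentiable (by simp) z).hasFDerivAt
  have h2 : HasDerivAt (fun t : ℝ => (z.1, t)) ((0 : ℝ), (1 : ℝ)) z.2 :=
    (hasDerivAt_const _ _).prodMk (hasDerivAt_id _)
  exact (h1.comp_hasDerivAt z.2 h2).deriv

lemma contDiff_fderiv_apply (hφ : ContDiff ℝ (⊤ : ℕ∞) φ) (e : ℝ × ℝ) :
    ContDiff ℝ (⊤ : ℕ∞) fun z => fderiv ℝ φ z e :=
  (hφ.fderiv_right (m := (⊤ : ℕ∞)) (by simp)).clm_apply contDiff_const

lemma contDiff_Dx (hφ : ContDiff ℝ (⊤ : ℕ∞) φ) : ContDiff ℝ (⊤ : ℕ∞) (Dx φ) := by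
  rw [funext (Dx_eq_fderiv hφ)]; exact contDiff_fderiv_apply hφ _

lemma contDiff_Dy (hφ : ContDiff ℝ (⊤ : ℕ∞) φ) : ContDiff ℝ (⊤ : ℕ∞) (Dy φ) := by
  rw [funext (Dy_eq_fderiv hφ)]; exact contDiff_fderiv_apply hφ _

lemma Dy_Dx (hφ : ContDiff ℝ (⊤ : ℕ∞) φ) : Dy (Dx φ) = Dx (Dy φ) := by
  ext z
  rw [Dy_eq_fderiv (contDiff_Dx hφ), Dx_eq_fderiv (contDiff_Dy hφ), funext (Dx_eq_fderiv hφ),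
    funext (Dy_eq_fderiv hφ)]
  have hd : DifferentiableAt ℝ (fderiv ℝ φ) z :=
    (hφ.fderiv_right (m := (⊤ : ℕ∞)) (by simp)).differentiable (by simp) z
  have hsymm : IsSymmSndFDerivAt ℝ φ z := hφ.contDiffAt.isSymmSndFDerivAt
    (by simp only [minSmoothness_of_isRCLikeNormedField]; exact WithTop.coe_le_coe.2 (le_top (a := (2 : ℕ∞))))
  rw [fderiv_clm_apply hd (differentiableAt_const _), fderiv_clm_apply hd (differentiableAt_const _)]
  simpa using hsymm.eq (0, 1) (1, 0)

lemma pderiv_zero_zero (φ : ℝ × ℝ → ℝ) : pderiv 0 0 φ = φ := by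
  ext z; simp [pderiv]

lemma pderiv_succ_left (k l : ℕ) (φ : ℝ × ℝ → ℝ) : pderiv (k + 1) l φ = Dx (pderiv k l φ) := by
  ext z; simp only [pderiv, Dx, iteratedDeriv_succ]

lemma pderiv_zero_succ (l : ℕ) (φ : ℝ × ℝ → ℝ) : pderiv 0 (l + 1) φ = Dy (pderiv 0 l φ) := by
  ext z; simp only [pderiv, Dy, iteratedDeriv_succ, iteratedDeriv_zero]

lemma pderiv_one_zero (φ : ℝ × ℝ → ℝ) : pderiv 1 0 φ = Dx φ := by
  rw [pderiv_succ_left, pderiv_zero_zero]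

lemma pderiv_zero_one (φ : ℝ × ℝ → ℝ) : pderiv 0 1 φ = Dy φ := by
  rw [pderiv_zero_succ, pderiv_zero_zero]

lemma pderiv_Dy (k l : ℕ) (φ : ℝ × ℝ → ℝ) : pderiv k l (Dy φ) = pderiv k (l + 1) φ := by
  ext z; simp only [pderiv, Dy, iteratedDeriv_succ']

lemma contDiff_pderiv_zero (hφ : ContDiff ℝ (⊤ : ℕ∞) φ) (l : ℕ) :
    ContDiff ℝ (⊤ : ℕ∞) (pderiv 0 l φ) := by
  induction l with
  | zero => rwa [pderiv_zero_zero]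
  | succ l ih => rw [pderiv_zero_succ]; exact contDiff_Dy ih

/-- `pderiv` applies the `x`-derivatives last, so an inner `Dx` has to be commuted past the
`y`-derivatives by symmetry of second derivatives. An inner `Dy` is already in place. -/
lemma pderiv_Dx (hφ : ContDiff ℝ (⊤ : ℕ∞) φ) (k l : ℕ) :
    pderiv k l (Dx φ) = pderiv (k + 1) l φ := by
  induction k with
  | zero =>
    induction l with
    | zero => rw [pderiv_succ_left, pderiv_zero_zero, pderiv_zero_zero]
    | succ l ih =>
      rw [pderiv_zero_succ, ih, pderiv_succ_left, pderiv_succ_left, Dy_Dx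
        (contDiff_pderiv_zero hφ l), pderiv_zero_succ]
  | succ k ih => rw [pderiv_succ_left, ih, pderiv_succ_left (k + 1)]

lemma tsupport_Dx_subset (hφ : ContDiff ℝ (⊤ : ℕ∞) φ) : tsupport (Dx φ) ⊆ tsupport φ := by
  rw [funext (Dx_eq_fderiv hφ)]
  refine (closure_mono fun z hz => ?_).trans (tsupport_fderiv_subset ℝ (f := φ))
  simp only [Function.mem_support] at hz ⊢
  intro h; rw [h] at hz; exact hz rfl

lemma tsupport_Dy_subset (hφ : ContDiff ℝ (⊤ : ℕ∞) φ) : tsupport (Dy φ) ⊆ tsupport φ := by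
  rw [funext (Dy_eq_fderiv hφ)]
  refine (closure_mono fun z hz => ?_).trans (tsupport_fderiv_subset ℝ (f := φ))
  simp only [Function.mem_support] at hz ⊢
  intro h; rw [h] at hz; exact hz rfl

namespace IsTest

variable (hφ : IsTest a b c d φ)
include hφ

lemma Dx : IsTest a b c d (Dx φ) :=
  ⟨contDiff_Dx hφ.smooth, hφ.compact.mono' (subset_closure.trans (tsupport_Dx_subset hφ.smooth)),
    (tsupport_Dx_subset hφ.smooth).trans hφ.subset⟩

lemma Dy : IsTest a b c d (Dy φ) :=
  ⟨contDiff_Dy hφ.smooth, hφ.compact.mono' (subset_closure.trans (tsupport_Dy_subset hφ.smooth)),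
    (tsupport_Dy_subset hφ.smooth).trans hφ.subset⟩

lemma pderiv (k l : ℕ) : IsTest a b c d (pderiv k l φ) := by
  induction k with
  | zero =>
    induction l with
    | zero => rwa [pderiv_zero_zero]
    | succ l ih => rw [pderiv_zero_succ]; exact ih.Dy
  | succ k ih => rw [pderiv_succ_left]; exact ih.Dx

lemma swap : IsTest c d a b fun z => φ z.swap := by
  refine ⟨hφ.smooth.comp (contDiff_snd.prodMk contDiff_fst),
    hφ.compact.comp_homeomorph (Homeomorph.prodComm ℝ ℝ), ?_⟩
  have := tsupport_comp_eq_preimage φ (Homeomorph.prodComm ℝ ℝ)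
  change tsupport (φ ∘ Homeomorph.prodComm ℝ ℝ) ⊆ _
  rw [this]
  intro z hz
  have := hφ.subset hz
  exact ⟨this.2, this.1⟩

lemma eq_zero {z : ℝ × ℝ} (hz : z ∉ Ioo a b ×ˢ Ioo c d) : φ z = 0 :=
  image_eq_zero_of_notMem_tsupport fun h => hz (hφ.subset h)

lemma integrable_mul {v : ℝ × ℝ → ℝ} (hv : Integrable v (mu2 a b c d)) :
    Integrable (fun z => φ z * v z) (mu2 a b c d) :=
  hv.mul_of_top_right (memLp_mu2_of_continuous (p := ∞) hφ.smooth.continuous)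

end IsTest

end TestFunctions

/-! ### Calculus of weak derivatives. -/

section WeakDerivatives

variable {a b c d : ℝ} {k l : ℕ} {v w z v' w' : ℝ × ℝ → ℝ}

/-- `w` is the weak derivative `∂ₓᵏ ∂_yˡ v` of the scalar function `v`. -/
def WeakD (a b c d : ℝ) (k l : ℕ) (v w : ℝ × ℝ → ℝ) : Prop :=
  ∀ φ, IsTest a b c d φ → ∫ z, pderiv k l φ z * v z ∂(mu2 a b c d)
    = (-1) ^ (k + l) * ∫ z, φ z * w z ∂(mu2 a b c d)

lemma restrict_Ioo_prod (a b c d : ℝ) :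
    (volume.restrict (Ioo a b ×ˢ Ioo c d) : Measure (ℝ × ℝ)) = mu2 a b c d := by
  rw [mu2_eq_prod, mu1, mu1, ← Measure.restrict_congr_set (Ioo_ae_eq_Icc (a := a) (b := b)),
    ← Measure.restrict_congr_set (Ioo_ae_eq_Icc (a := c) (b := d)), Measure.prod_restrict,
    Measure.volume_eq_prod]

lemma hasWeakDeriv_iff {n : ℕ} {v w : ℝ × ℝ → Fin n → ℝ} :
    HasWeakDeriv a b c d k l v w ↔
      ∀ i, WeakD a b c d k l (fun z => v z i) (fun z => w z i) := by
  unfold HasWeakDeriv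
  rw [restrict_Ioo_prod]
  exact ⟨fun h i φ hφ => h φ hφ.1 hφ.2 hφ.3 i, fun h φ h1 h2 h3 i => h i φ ⟨h1, h2, h3⟩⟩

lemma ae_mem_Ioo_prod (a b c d : ℝ) : ∀ᵐ z ∂(mu2 a b c d), z ∈ Ioo a b ×ˢ Ioo c d := by
  rw [← restrict_Ioo_prod]
  exact ae_restrict_mem (measurableSet_Ioo.prod measurableSet_Ioo)

lemma WeakD.congr (h : WeakD a b c d k l v w) (hv : v =ᵐ[mu2 a b c d] v')
    (hw : w =ᵐ[mu2 a b c d] w') : WeakD a b c d k l v' w' := by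
  intro φ hφ
  rw [← integral_congr_ae (hv.mono fun z hz => congrArg (pderiv k l φ z * ·) hz),
    ← integral_congr_ae (hw.mono fun z hz => congrArg (φ z * ·) hz)]
  exact h φ hφ

lemma WeakD.unique (h : WeakD a b c d k l v w) (h' : WeakD a b c d k l v w')
    (hw : Integrable w (mu2 a b c d)) (hw' : Integrable w' (mu2 a b c d)) :
    w =ᵐ[mu2 a b c d] w' := by
  have := (isOpen_Ioo.prod isOpen_Ioo).ae_eq_zero_of_integral_contDiff_smul_eq_zero
    (U := Ioo a b ×ˢ Ioo c d) ((hw.sub hw').locallyIntegrable.locallyIntegrableOn _)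
    fun φ h1 h2 h3 => by
      have hφ : IsTest a b c d φ := ⟨h1, h2, h3⟩
      simp only [Pi.sub_apply, smul_eq_mul, mul_sub]
      rw [integral_sub (hφ.integrable_mul hw) (hφ.integrable_mul hw'), sub_eq_zero]
      exact mul_left_cancel₀ (pow_ne_zero _ (by norm_num)) ((h φ hφ).symm.trans (h' φ hφ))
  filter_upwards [this, ae_mem_Ioo_prod a b c d] with z hz hz'
  exact sub_eq_zero.1 (hz hz')

lemma WeakD.sub (h : WeakD a b c d k l v w) (h' : WeakD a b c d k l v' w')
    (hv : Integrable v (mu2 a b c d)) (hv' : Integrable v' (mu2 a b c d))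
    (hw : Integrable w (mu2 a b c d)) (hw' : Integrable w' (mu2 a b c d)) :
    WeakD a b c d k l (fun z => v z - v' z) (fun z => w z - w' z) := by
  intro φ hφ
  simp only [mul_sub]
  rw [integral_sub ((hφ.pderiv k l).integrable_mul hv) ((hφ.pderiv k l).integrable_mul hv'),
    integral_sub (hφ.integrable_mul hw) (hφ.integrable_mul hw'), h φ hφ, h' φ hφ, mul_sub]

lemma weakD_zero_zero (v : ℝ × ℝ → ℝ) : WeakD a b c d 0 0 v v := fun φ _ => by
  simp [pderiv_zero_zero]

lemma WeakD.comp_x (h : WeakD a b c d 1 0 v w) (h' : WeakD a b c d k l w z) :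
    WeakD a b c d (k + 1) l v z := by
  intro φ hφ
  have h1 := h _ (hφ.pderiv k l)
  rw [pderiv_one_zero] at h1
  rw [pderiv_succ_left, h1, h' φ hφ]
  ring

/-- Order zero in `x` is required, because a `y`-derivative of `pderiv` can be peeled off from the
outside only when no `x`-derivative precedes it. -/
lemma WeakD.comp_y (h : WeakD a b c d 0 1 v w) (h' : WeakD a b c d 0 l w z) :
    WeakD a b c d 0 (l + 1) v z := by
  intro φ hφ
  have h1 := h _ (hφ.pderiv 0 l)
  rw [pderiv_zero_one] at h1
  rw [pderiv_zero_succ, h1, h' φ hφ]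
  ring

/-- Test with `∂_y φ`. Membership in `InH` relates every derivative only to `v` itself; this lemma
and `WeakD.div_x` recover the first-order relations between neighbouring derivatives. -/
lemma WeakD.div_y (h : WeakD a b c d k l v w) (h' : WeakD a b c d k (l + 1) v z) :
    WeakD a b c d 0 1 w z := by
  intro φ hφ
  have h1 := h _ hφ.Dy
  rw [pderiv_Dy, h' φ hφ] at h1
  rw [pderiv_zero_one]
  refine mul_left_cancel₀ (pow_ne_zero (k + l) (by norm_num : (-1 : ℝ) ≠ 0)) (h1.symm.trans ?_)
  ring

lemma WeakD.div_x (h : WeakD a b c d k l v w) (h' : WeakD a b c d (k + 1) l v z) :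
    WeakD a b c d 1 0 w z := by
  intro φ hφ
  have h1 := h _ hφ.Dx
  rw [pderiv_Dx hφ.smooth, h' φ hφ] at h1
  rw [pderiv_one_zero]
  refine mul_left_cancel₀ (pow_ne_zero (k + l) (by norm_num : (-1 : ℝ) ≠ 0)) (h1.symm.trans ?_)
  ring

lemma WeakD.swap (h : WeakD a b c d 1 0 v w) :
    WeakD c d a b 0 1 (fun z => v z.swap) (fun z => w z.swap) := by
  intro φ hφ
  have h1 := h _ hφ.swap
  rw [← integral_mu2_swap, ← integral_mu2_swap (a := a)] at h1
  rw [pderiv_one_zero] at h1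
  rw [pderiv_zero_one]
  exact h1

lemma WeakD.swap' (h : WeakD a b c d 0 1 v w) :
    WeakD c d a b 1 0 (fun z => v z.swap) (fun z => w z.swap) := by
  intro φ hφ
  have h1 := h _ hφ.swap
  rw [← integral_mu2_swap, ← integral_mu2_swap (a := a)] at h1
  rw [pderiv_zero_one] at h1
  rw [pderiv_one_zero]
  exact h1

/-- A function that is absolutely continuous in `x` has the expected weak derivative. -/
lemma weakD_primitive_x (hab : a ≤ b) {g : ℝ → ℝ} {f : ℝ × ℝ → ℝ} (hg : MemLp g 2 (mu1 c d))
    (hf : MemLp f 2 (mu2 a b c d)) :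
    WeakD a b c d 1 0 (fun z => g z.2 + Ix a f z) f := by
  intro φ hφ
  rw [pderiv_one_zero]
  have hv : Integrable (fun z => g z.2 + Ix a f z) (mu2 a b c d) :=
    integrable_of_memLp_two ((memLp_snd hg).add (memLp_Ix hf))
  have i1 := hφ.Dx.integrable_mul hv
  have i2 := hφ.integrable_mul (integrable_of_memLp_two hf)
  rw [mu2_eq_prod] at i1 i2
  rw [mu2_eq_prod, integral_prod_symm _ i1, integral_prod_symm _ i2, ← integral_const_mul]
  refine integral_congr_ae ?_
  filter_upwards [ae_slice_y hf] with y hy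
  have hψ : ContDiff ℝ 1 (fun s => φ (s, y)) :=
    (hφ.smooth.of_le (by simp)).comp (contDiff_id.prodMk contDiff_const)
  have := integral_deriv_mul_primitive hab hψ (hφ.eq_zero fun h => lt_irrefl _ h.1.1)
    (hφ.eq_zero fun h => lt_irrefl _ h.1.2) (integrable_of_memLp_two hy) (g y)
  simp only [add_zero, pow_one, neg_one_mul]
  exact this

lemma weakD_primitive_y (hcd : c ≤ d) {g : ℝ → ℝ} {f : ℝ × ℝ → ℝ} (hg : MemLp g 2 (mu1 a b))
    (hf : MemLp f 2 (mu2 a b c d)) :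
    WeakD a b c d 0 1 (fun z => g z.1 + Iy c f z) f :=
  (weakD_primitive_x hcd hg (memLp_swap hf)).swap

end WeakDerivatives

/-! ### Products of one-variable test functions are enough. -/

section TensorTests

variable {a b c d : ℝ}

/-- Smooth functions with compact support in the open interval. -/
structure IsTest1 (a b : ℝ) (χ : ℝ → ℝ) : Prop where
  smooth : ContDiff ℝ (⊤ : ℕ∞) χ
  compact : HasCompactSupport χ
  subset : tsupport χ ⊆ Ioo a b

lemma ae_eq_zero_of_test1 {f : ℝ → ℝ} (hf : Integrable f (mu1 a b))
    (h : ∀ χ, IsTest1 a b χ → ∫ x, χ x * f x ∂(mu1 a b) = 0) : f =ᵐ[mu1 a b] 0 := by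
  have := isOpen_Ioo.ae_eq_zero_of_integral_contDiff_smul_eq_zero (U := Ioo a b)
    (hf.locallyIntegrable.locallyIntegrableOn _) fun χ h1 h2 h3 => h χ ⟨h1, h2, h3⟩
  have hI : ∀ᵐ x ∂(mu1 a b), x ∈ Ioo a b := by
    rw [mu1, ← Measure.restrict_congr_set Ioo_ae_eq_Icc]
    exact ae_restrict_mem measurableSet_Ioo
  filter_upwards [this, hI] with x h1 h2 using h1 h2

lemma IsTest1.memLp {χ : ℝ → ℝ} (hχ : IsTest1 a b χ) (p : ℝ≥0∞) (s t : ℝ) :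
    MemLp χ p (mu1 s t) := memLp_mu1_of_continuous hχ.smooth.continuous

/-- Measurable rectangles form a π-system generating the product σ-algebra. Complements are handled
through the total integral, which vanishes since the whole plane is a rectangle. -/
lemma ae_eq_zero_of_setIntegral_prod {Q : ℝ × ℝ → ℝ} (hQ : Integrable Q (mu2 a b c d))
    (h : ∀ A B : Set ℝ, MeasurableSet A → MeasurableSet B →
      ∫ z in A ×ˢ B, Q z ∂(mu2 a b c d) = 0) : Q =ᵐ[mu2 a b c d] 0 := by
  have huniv : ∫ z, Q z ∂(mu2 a b c d) = 0 := by
    have := h univ univ .univ .univ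
    rwa [univ_prod_univ, setIntegral_univ] at this
  have key : ∀ s, MeasurableSet s → ∫ z in s, Q z ∂(mu2 a b c d) = 0 := by
    intro s hs
    induction s, hs using MeasurableSpace.induction_on_inter generateFrom_prod.symm
      isPiSystem_prod with
    | empty => simp
    | basic t ht =>
      obtain ⟨A, hA, B, hB, rfl⟩ := ht
      exact h A B hA hB
    | compl t ht ih =>
      have := integral_add_compl ht hQ
      rwa [ih, huniv, zero_add] at this
    | iUnion f hd hm ih =>
      rw [integral_iUnion hm hd hQ.integrableOn]
      simp [ih]
  exact hQ.ae_eq_zero_of_forall_setIntegral_eq_zero fun s hs _ => key s hs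

/-- Tensor products of test functions are total. -/
lemma ae_eq_zero_of_tensor {Q : ℝ × ℝ → ℝ} (hQ : Integrable Q (mu2 a b c d))
    (h : ∀ χ₁ χ₂, IsTest1 a b χ₁ → IsTest1 c d χ₂ →
      ∫ z, χ₁ z.1 * χ₂ z.2 * Q z ∂(mu2 a b c d) = 0) : Q =ᵐ[mu2 a b c d] 0 := by
  have hQ' : Integrable Q ((mu1 a b).prod (mu1 c d)) := mu2_eq_prod a b c d ▸ hQ
  -- The one-variable fundamental lemma is used twice: here in `x` with `χ₂` fixed, and in `step2`
  -- in `y` after integrating over `A`.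
  have step1 : ∀ χ₂, IsTest1 c d χ₂ → ∀ᵐ x ∂(mu1 a b),
      ∫ y, χ₂ y * Q (x, y) ∂(mu1 c d) = 0 := fun χ₂ h2 => by
    have i2 : Integrable (fun z : ℝ × ℝ => χ₂ z.2 * Q z) ((mu1 a b).prod (mu1 c d)) :=
      hQ'.mul_of_top_right ((h2.memLp ∞ c d).comp_snd _)
    refine ae_eq_zero_of_test1 i2.integral_prod_left fun χ₁ h1 => ?_
    have i1 : Integrable (fun z : ℝ × ℝ => χ₁ z.1 * (χ₂ z.2 * Q z)) ((mu1 a b).prod (mu1 c d)) :=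
      i2.mul_of_top_right ((h1.memLp ∞ a b).comp_fst _)
    rw [← h χ₁ χ₂ h1 h2, mu2_eq_prod]
    simp only [mul_assoc]
    rw [integral_prod _ i1]
    simp only [integral_const_mul]
  refine ae_eq_zero_of_setIntegral_prod hQ fun A B hA hB => ?_
  have hA' : Integrable Q (((mu1 a b).restrict A).prod (mu1 c d)) := by
    rw [← Measure.restrict_univ (μ := mu1 c d), Measure.prod_restrict]
    exact hQ'.restrict
  have step2 : (fun y => ∫ x in A, Q (x, y) ∂(mu1 a b)) =ᵐ[mu1 c d] 0 := by
    refine ae_eq_zero_of_test1 hA'.integral_prod_right fun χ₂ h2 => ?_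
    have i2 : Integrable (fun z : ℝ × ℝ => χ₂ z.2 * Q z)
        (((mu1 a b).restrict A).prod (mu1 c d)) :=
      hA'.mul_of_top_right ((h2.memLp ∞ c d).comp_snd _)
    simp only [← integral_const_mul]
    rw [← integral_integral_swap (f := fun x y => χ₂ y * Q (x, y)) i2]
    exact integral_eq_zero_of_ae (ae_restrict_of_ae (step1 χ₂ h2))
  rw [mu2_eq_prod, ← Measure.prod_restrict, integral_prod_symm _ (by
    rw [Measure.prod_restrict]; exact hQ'.restrict)]
  exact integral_eq_zero_of_ae (ae_restrict_of_ae step2)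

lemma IsTest1.tensor {χ₁ χ₂ : ℝ → ℝ} (h1 : IsTest1 a b χ₁) (h2 : IsTest1 c d χ₂) :
    IsTest a b c d fun z => χ₁ z.1 * χ₂ z.2 := by
  have hsub : tsupport (fun z : ℝ × ℝ => χ₁ z.1 * χ₂ z.2) ⊆ tsupport χ₁ ×ˢ tsupport χ₂ := by
    refine closure_minimal (fun z hz => ?_)
      ((isClosed_tsupport _).prod (isClosed_tsupport _))
    simp only [Function.mem_support, ne_eq, mul_eq_zero, not_or] at hz
    exact ⟨subset_tsupport _ hz.1, subset_tsupport _ hz.2⟩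
  refine ⟨(h1.smooth.comp contDiff_fst).mul (h2.smooth.comp contDiff_snd), ?_,
    hsub.trans (prod_mono h1.subset h2.subset)⟩
  exact (h1.compact.isCompact.prod h2.compact.isCompact).of_isClosed_subset
    (isClosed_tsupport _) hsub

/-- A test function with integral zero is the derivative of a test function. -/
lemma IsTest1.exists_primitive {χ : ℝ → ℝ} (h : IsTest1 a b χ)
    (h0 : ∫ x, χ x ∂(mu1 a b) = 0) : ∃ Ψ, IsTest1 a b Ψ ∧ deriv Ψ = χ := by
  have hc : Continuous χ := h.smooth.continuous
  rcases (tsupport χ).eq_empty_or_nonempty with he | hne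
  · have : χ = 0 := tsupport_eq_empty_iff.1 he
    exact ⟨χ, h, by simp [this]⟩
  -- The primitive is supported in the hull `[m, M]` of the support of `χ`. It vanishes to the left
  -- trivially and to the right because the total integral is zero.
  obtain ⟨m, hm⟩ := h.compact.isCompact.exists_isLeast hne
  obtain ⟨M, hM⟩ := h.compact.isCompact.exists_isGreatest hne
  have ham : a < m := (h.subset hm.1).1
  have hMb : M < b := (h.subset hM.1).2
  have hab : a ≤ b := (ham.trans (h.subset hm.1).2).le
  have hz : ∀ x, x < m ∨ M < x → χ x = 0 := fun x hx =>
    image_eq_zero_of_notMem_tsupport fun hx' =>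
      hx.elim (fun h => (hm.2 hx').not_gt h) fun h => (hM.2 hx').not_gt h
  have hderiv : ∀ x, HasDerivAt (fun x => ∫ t in a..x, χ t) (χ x) x := fun x =>
    intervalIntegral.integral_hasDerivAt_right (hc.intervalIntegrable _ _)
      hc.aestronglyMeasurable.stronglyMeasurableAtFilter hc.continuousAt
  have hd : deriv (fun x => ∫ t in a..x, χ t) = χ := funext fun x => (hderiv x).deriv
  have hsub : tsupport (fun x => ∫ t in a..x, χ t) ⊆ Icc m M := by
    refine closure_minimal (fun x hx => ?_) isClosed_Icc
    by_contra hx'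
    refine hx ?_
    simp only [mem_Icc, not_and_or, not_le] at hx'
    rcases hx' with hx' | hx'
    · refine (intervalIntegral.integral_congr (g := fun _ => (0 : ℝ)) fun t ht => ?_).trans
        (by simp)
      exact hz t (Or.inl ((mem_uIcc.1 ht).elim (fun h => h.2.trans_lt hx')
        fun h => h.2.trans_lt ham))
    · have h1 : ∫ t in x..b, χ t = 0 := by
        refine (intervalIntegral.integral_congr (g := fun _ => (0 : ℝ)) fun t ht => ?_).trans
          (by simp)
        exact hz t (Or.inr ((mem_uIcc.1 ht).elim (fun h => hx'.trans_le h.1)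
          fun h => hMb.trans_le h.1))
      have h2 := intervalIntegral.integral_add_adjacent_intervals
        (hc.intervalIntegrable (μ := volume) a x) (hc.intervalIntegrable x b)
      rw [h1, intervalIntegral_eq_mu1 hab, h0, add_zero] at h2
      exact h2
  refine ⟨_, ⟨?_, isCompact_Icc.of_isClosed_subset (isClosed_tsupport _) hsub,
    hsub.trans fun x hx => ⟨ham.trans_le hx.1, hx.2.trans_lt hMb⟩⟩, hd⟩
  exact contDiff_infty_iff_deriv.2 ⟨fun x => (hderiv x).differentiableAt, by rw [hd]; exact h.smooth⟩

lemma exists_test1 (hab : a < b) : ∃ χ, IsTest1 a b χ ∧ ∫ x, χ x ∂(mu1 a b) = 1 := by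
  let f : ContDiffBump ((a + b) / 2) :=
    -- An outer radius below `(b - a) / 2` keeps the support inside the open interval.
    ⟨(b - a) / 8, (b - a) / 4, by linarith, by linarith⟩
  have hsub : tsupport (f.normed volume) ⊆ Ioo a b := by
    rw [f.tsupport_normed_eq, Real.closedBall_eq_Icc]
    intro x hx
    have h1 : f.rOut = (b - a) / 4 := rfl
    rw [h1] at hx
    exact ⟨by linarith [hx.1], by linarith [hx.2]⟩
  refine ⟨f.normed volume, ⟨f.contDiff_normed, f.hasCompactSupport_normed, hsub⟩, ?_⟩
  rw [mu1, setIntegral_eq_integral_of_forall_compl_eq_zero fun x hx =>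
    image_eq_zero_of_notMem_tsupport fun h => hx (Ioo_subset_Icc_self (hsub h))]
  exact f.integral_normed

end TensorTests

/-! ### Du Bois-Reymond: functions with one weak derivative. -/

section FirstOrder

variable {a b c d : ℝ}

/-- A function with a weak derivative in `x` is absolutely continuous in `x`. -/
lemma exists_eq_add_Ix (hab : a < b) {p r : ℝ × ℝ → ℝ} (hp : MemLp p 2 (mu2 a b c d))
    (hr : MemLp r 2 (mu2 a b c d)) (h : WeakD a b c d 1 0 p r) :
    ∃ β, MemLp β 2 (mu1 c d) ∧ p =ᵐ[mu2 a b c d] fun z => β z.2 + Ix a r z := by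
  set P : ℝ × ℝ → ℝ := fun z => p z - Ix a r z with hPdef
  have hP : MemLp P 2 (mu2 a b c d) := hp.sub (memLp_Ix hr)
  have hP1 : Integrable P ((mu1 a b).prod (mu1 c d)) :=
    mu2_eq_prod a b c d ▸ integrable_of_memLp_two hP
  have hD : ∀ φ, IsTest a b c d φ → ∫ z, Dx φ z * P z ∂(mu2 a b c d) = 0 := by
    intro φ hφ
    have h1 := weakD_primitive_x hab.le (c := c) (d := d) (g := fun _ => 0)
      (MemLp.zero (p := 2)) hr
    simp only [zero_add] at h1
    have h2 := (h.sub h1 (integrable_of_memLp_two hp) (integrable_of_memLp_two (memLp_Ix hr))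
      (integrable_of_memLp_two hr) (integrable_of_memLp_two hr)) φ hφ
    simpa [pderiv_one_zero] using h2
  obtain ⟨ψ, hψ, hψ1⟩ := exists_test1 hab
  -- `P` has zero weak derivative in `x`. If it does not depend on `x`, its average against the
  -- unit-mass bump `ψ` is `P` itself, which makes this the only candidate for `β`.
  set β : ℝ → ℝ := fun y => ∫ x, P (x, y) * ψ x ∂(mu1 a b)
  have hβ : MemLp β 2 (mu1 c d) :=
    memLp_two_hs (k := fun z : ℝ × ℝ => P z.swap) (mu2_eq_prod c d a b ▸ memLp_swap hP)
      (hψ.memLp 2 a b)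
  refine ⟨β, hβ, ?_⟩
  have hβ1 := integrable_of_memLp_two (memLp_snd (a := a) (b := b) hβ)
  have hQ := (integrable_of_memLp_two hP).sub hβ1
  have hval : ∀ χ₁ χ₂, IsTest1 a b χ₁ → IsTest1 c d χ₂ →
      Integrable (fun z : ℝ × ℝ => χ₁ z.1 * χ₂ z.2 * P z) (mu2 a b c d) :=
    fun χ₁ χ₂ h1 h2 => (h1.tensor h2).integrable_mul (integrable_of_memLp_two hP)
  have key := ae_eq_zero_of_tensor hQ fun χ₁ χ₂ h1 h2 => by
    -- `χ₁ - m ψ` has mean zero, hence is the derivative of a test function `Ψ`. Testing with `Ψ ⊗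
    -- χ₂` therefore allows `χ₁` to be replaced by `m ψ`.
    set m := ∫ x, χ₁ x ∂(mu1 a b)
    have hχ : IsTest1 a b fun x => χ₁ x - m * ψ x := by
      refine ⟨h1.smooth.sub (contDiff_const.mul hψ.smooth),
        h1.compact.sub hψ.compact.mul_left, ?_⟩
      refine (tsupport_sub _ _).trans (union_subset h1.subset ?_)
      exact (tsupport_mul_subset_right).trans hψ.subset
    have hχ0 : ∫ x, (χ₁ x - m * ψ x) ∂(mu1 a b) = 0 := by
      rw [integral_sub ((h1.memLp 1 a b).integrable le_rfl)
        (((hψ.memLp 1 a b).integrable le_rfl).const_mul m), integral_const_mul, hψ1]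
      simp [m]
    obtain ⟨Ψ, hΨ, hΨd⟩ := hχ.exists_primitive hχ0
    have h3 := hD _ (hΨ.tensor h2)
    have h4 : ∀ z : ℝ × ℝ, Dx (fun z => Ψ z.1 * χ₂ z.2) z * P z
        = χ₁ z.1 * χ₂ z.2 * P z - m * (ψ z.1 * χ₂ z.2 * P z) := fun z => by
      simp only [Dx]
      rw [deriv_mul_const (hΨ.smooth.differentiable (by simp) _), hΨd]
      ring
    simp only [h4] at h3
    rw [integral_sub (hval _ _ h1 h2) ((hval _ _ hψ h2).const_mul m), integral_const_mul,
      sub_eq_zero] at h3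
    have h5 : ∫ z, ψ z.1 * χ₂ z.2 * P z ∂(mu2 a b c d) = ∫ y, χ₂ y * β y ∂(mu1 c d) := by
      have i1 := hval _ _ hψ h2
      rw [mu2_eq_prod] at i1
      rw [mu2_eq_prod, integral_prod_symm _ i1]
      refine integral_congr_ae (.of_forall fun y => ?_)
      simp only [β]
      rw [← integral_const_mul]
      exact integral_congr_ae (.of_forall fun x => by ring)
    have h6 : ∫ z, χ₁ z.1 * χ₂ z.2 * β z.2 ∂(mu2 a b c d) = m * ∫ y, χ₂ y * β y ∂(mu1 c d) := by
      rw [mu2_eq_prod, ← integral_prod_mul χ₁ fun y => χ₂ y * β y]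
      simp only [mul_assoc]
    simp only [Pi.sub_apply, mul_sub]
    rw [integral_sub (hval _ _ h1 h2) ((h1.tensor h2).integrable_mul hβ1), h3, h6, h5, sub_self]
  filter_upwards [key] with z hz
  simp only [Pi.sub_apply, Pi.zero_apply, hPdef] at hz
  linarith

lemma exists_eq_add_Iy (hcd : c < d) {p r : ℝ × ℝ → ℝ} (hp : MemLp p 2 (mu2 a b c d))
    (hr : MemLp r 2 (mu2 a b c d)) (h : WeakD a b c d 0 1 p r) :
    ∃ β, MemLp β 2 (mu1 a b) ∧ p =ᵐ[mu2 a b c d] fun z => β z.1 + Iy c r z := by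
  obtain ⟨β, hβ, h1⟩ := exists_eq_add_Ix hcd (memLp_swap hp) (memLp_swap hr) h.swap'
  exact ⟨β, hβ, ae_swap h1⟩

end FirstOrder

/-! ### Functions with a mixed derivative `∂ₓ∂_y`. -/

section MixedPrimitive

variable {a b c d α : ℝ} {β γ : ℝ → ℝ} {r : ℝ × ℝ → ℝ}

/-- The function with value `α` at `(a, c)`, edge derivatives `β`, `γ` and mixed derivative `r`. -/
def S1 (a c α : ℝ) (β γ : ℝ → ℝ) (r : ℝ × ℝ → ℝ) (z : ℝ × ℝ) : ℝ :=
  α + (∫ θ in a..z.1, β θ) + (∫ ν in c..z.2, γ ν) + Ix a (Iy c r) z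

lemma ae_Ix_Iy (hr : MemLp r 2 (mu2 a b c d)) :
    Ix a (Iy c r) =ᵐ[mu2 a b c d] Iy c (Ix a r) := by
  filter_upwards [ae_mem_rect a b c d] with z hz
  exact Ix_Iy (integrable_of_memLp_two hr) hz.1 hz.2

lemma Ix_fst_add_Iy (hβ : MemLp β 2 (mu1 a b)) (hr : MemLp r 2 (mu2 a b c d)) :
    Ix a (fun z => β z.1 + Iy c r z) =ᵐ[mu2 a b c d]
      fun z => (∫ θ in a..z.1, β θ) + Ix a (Iy c r) z :=
  Ix_add (memLp_fst hβ) (memLp_Iy hr)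

lemma Iy_snd_add_Ix (hγ : MemLp γ 2 (mu1 c d)) (hr : MemLp r 2 (mu2 a b c d)) :
    Iy c (fun z => γ z.2 + Ix a r z) =ᵐ[mu2 a b c d]
      fun z => (∫ ν in c..z.2, γ ν) + Ix a (Iy c r) z := by
  filter_upwards [Iy_add (memLp_snd hγ) (memLp_Ix hr), ae_Ix_Iy hr] with z h1 h2
  rw [h1, h2]; rfl

lemma memLp_const_add_primitive (α : ℝ) (hβ : MemLp β 2 (mu1 a b)) :
    MemLp (fun x => α + ∫ θ in a..x, β θ) 2 (mu1 a b) :=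
  (memLp_const α).add (memLp_primitive (integrable_of_memLp_two hβ) 2)

/-- This groups the four terms as a function of `y` plus a primitive in `x`, the shape whose weak
derivative is known from `weakD_primitive_x`. -/
lemma S1_eq_add_Ix (α : ℝ) (γ : ℝ → ℝ) (hβ : MemLp β 2 (mu1 a b)) (hr : MemLp r 2 (mu2 a b c d)) :
    S1 a c α β γ r =ᵐ[mu2 a b c d]
      fun z => (α + ∫ ν in c..z.2, γ ν) + Ix a (fun z => β z.1 + Iy c r z) z := by
  filter_upwards [Ix_fst_add_Iy hβ hr] with z hz
  rw [hz, S1]; ring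

lemma S1_eq_add_Iy (α : ℝ) (β : ℝ → ℝ) (hγ : MemLp γ 2 (mu1 c d)) (hr : MemLp r 2 (mu2 a b c d)) :
    S1 a c α β γ r =ᵐ[mu2 a b c d]
      fun z => (α + ∫ θ in a..z.1, β θ) + Iy c (fun z => γ z.2 + Ix a r z) z := by
  filter_upwards [Iy_snd_add_Ix hγ hr] with z hz
  rw [hz, S1]; ring

lemma memLp_S1 (α : ℝ) (hβ : MemLp β 2 (mu1 a b)) (hγ : MemLp γ 2 (mu1 c d))
    (hr : MemLp r 2 (mu2 a b c d)) : MemLp (S1 a c α β γ r) 2 (mu2 a b c d) :=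
  ((memLp_fst (memLp_const_add_primitive α hβ)).add
    (memLp_snd (memLp_primitive (integrable_of_memLp_two hγ) 2))).add (memLp_Ix (memLp_Iy hr))

lemma weakD_S1_x (hab : a ≤ b) (α : ℝ) (hβ : MemLp β 2 (mu1 a b)) (hγ : MemLp γ 2 (mu1 c d))
    (hr : MemLp r 2 (mu2 a b c d)) :
    WeakD a b c d 1 0 (S1 a c α β γ r) (fun z => β z.1 + Iy c r z) :=
  (weakD_primitive_x hab (memLp_const_add_primitive α hγ)
    ((memLp_fst hβ).add (memLp_Iy hr))).congr (S1_eq_add_Ix α γ hβ hr).symm .rfl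

lemma weakD_S1_y (hcd : c ≤ d) (α : ℝ) (hβ : MemLp β 2 (mu1 a b)) (hγ : MemLp γ 2 (mu1 c d))
    (hr : MemLp r 2 (mu2 a b c d)) :
    WeakD a b c d 0 1 (S1 a c α β γ r) (fun z => γ z.2 + Ix a r z) :=
  (weakD_primitive_y hcd (memLp_const_add_primitive α hβ)
    ((memLp_snd hγ).add (memLp_Ix hr))).congr (S1_eq_add_Iy α β hγ hr).symm .rfl

lemma S1_congr (hab : a ≤ b) (hcd : c ≤ d) {β' γ' : ℝ → ℝ} {r' : ℝ × ℝ → ℝ}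
    (hβ : β =ᵐ[mu1 a b] β')
    (hγ : γ =ᵐ[mu1 c d] γ') (hr : r =ᵐ[mu2 a b c d] r') :
    S1 a c α β γ r =ᵐ[mu2 a b c d] S1 a c α β' γ' r' := by
  filter_upwards [Ix_congr (Iy_congr hr), ae_mem_rect a b c d] with z h1 hz
  simp only [S1]
  rw [h1, intervalIntegral_congr_mu1 hβ (left_mem_Icc.2 hab) hz.1,
    intervalIntegral_congr_mu1 hγ (left_mem_Icc.2 hcd) hz.2]

/-- Strictness of `c < d` matters: on a null interval the hypothesis would say nothing. -/
lemma ae_eq_of_fst (hcd : c < d) {β' : ℝ → ℝ}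
    (h : (fun z : ℝ × ℝ => β z.1) =ᵐ[mu2 a b c d] fun z => β' z.1) : β =ᵐ[mu1 a b] β' := by
  have : (ae (mu1 c d)).NeBot := by
    rw [ae_neBot, mu1, Ne, Measure.restrict_eq_zero]
    simp [hcd]
  filter_upwards [ae_ae_mu2 h] with x hx
  exact hx.exists.choose_spec

lemma ae_eq_of_snd (hab : a < b) {γ' : ℝ → ℝ}
    (h : (fun z : ℝ × ℝ => γ z.2) =ᵐ[mu2 a b c d] fun z => γ' z.2) : γ =ᵐ[mu1 c d] γ' :=
  ae_eq_of_fst hab (ae_swap h)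

/-- Structure of functions with weak derivatives `∂ₓ v = p`, `∂_y v = q` and `∂ₓ∂_y v = r`. -/
lemma exists_S1 (hab : a < b) (hcd : c < d) {v p q : ℝ × ℝ → ℝ} (hv : MemLp v 2 (mu2 a b c d))
    (hp : MemLp p 2 (mu2 a b c d)) (hq : MemLp q 2 (mu2 a b c d)) (hr : MemLp r 2 (mu2 a b c d))
    (hvp : WeakD a b c d 1 0 v p) (hvq : WeakD a b c d 0 1 v q) (hpr : WeakD a b c d 0 1 p r)
    (hqr : WeakD a b c d 1 0 q r) :
    ∃ α β γ, MemLp β 2 (mu1 a b) ∧ MemLp γ 2 (mu1 c d) ∧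
      v =ᵐ[mu2 a b c d] S1 a c α β γ r ∧ (p =ᵐ[mu2 a b c d] fun z => β z.1 + Iy c r z) ∧
      q =ᵐ[mu2 a b c d] fun z => γ z.2 + Ix a r z := by
  obtain ⟨β, hβ, h1⟩ := exists_eq_add_Iy hcd hp hr hpr
  obtain ⟨γ, hγ, h2⟩ := exists_eq_add_Ix hab hq hr hqr
  obtain ⟨g, hg, h3⟩ := exists_eq_add_Ix hab hv hp hvp
  obtain ⟨f, hf, h4⟩ := exists_eq_add_Iy hcd hv hq hvq
  have h5 := Ix_congr h1
  have h6 := Iy_congr h2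
  have h7 := Ix_fst_add_Iy hβ hr
  have h8 := Iy_snd_add_Ix (a := a) (b := b) hγ hr
  -- The two expressions for `v` differ by a function of `y` alone against a function of `x` alone,
  -- so both are constant. The value on one good line `y₀` serves as `α`.
  have h9 : (fun z : ℝ × ℝ => g z.2 - ∫ ν in c..z.2, γ ν) =ᵐ[mu2 a b c d]
      fun z => f z.1 - ∫ θ in a..z.1, β θ := by
    filter_upwards [h3, h4, h5, h6, h7, h8] with z h3 h4 h5 h6 h7 h8
    rw [h5, h7] at h3
    rw [h6, h8] at h4
    linarith
  have hne : (ae (mu1 c d)).NeBot := by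
    rw [ae_neBot, mu1, Ne, Measure.restrict_eq_zero]
    simp [hcd]
  obtain ⟨y₀, hy₀⟩ := (ae_ae_mu2' h9).exists
  refine ⟨g y₀ - ∫ ν in c..y₀, γ ν, β, γ, hβ, hγ, ?_, h1, h2⟩
  filter_upwards [h4, h6, h8, ae_fst hy₀] with z h4 h6 h8 h9
  rw [h4, h6, h8, S1, h9]
  ring

end MixedPrimitive

/-! ### Functions with derivatives up to `∂ₓ²∂_y²`. -/

section SecondOrder

variable {a b c d : ℝ} {α : Fin 4 → ℝ} {β γ : Fin 2 → ℝ → ℝ} {r : ℝ × ℝ → ℝ}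

/-- The function with derivatives `α` at `(a, c)`, edge derivatives `β`, `γ` and highest mixed
derivative `r`, and its derivatives `∂ₓⁱ ∂_yʲ` for `i, j ≤ 2`. -/
def S2 (a c : ℝ) (α : Fin 4 → ℝ) (β γ : Fin 2 → ℝ → ℝ) (r : ℝ × ℝ → ℝ) : ℕ → ℕ → ℝ × ℝ → ℝ
  | 0, 0 => S1 a c (α 0) (fun x => α 1 + ∫ θ in a..x, β 0 θ) (fun y => α 2 + ∫ ν in c..y, γ 0 ν)
      (S1 a c (α 3) (β 1) (γ 1) r)
  | 1, 0 => S1 a c (α 1) (β 0) (fun y => α 3 + ∫ ν in c..y, γ 1 ν) (fun z => β 1 z.1 + Iy c r z)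
  | 0, 1 => S1 a c (α 2) (fun x => α 3 + ∫ θ in a..x, β 1 θ) (γ 0) (fun z => γ 1 z.2 + Ix a r z)
  | 1, 1 => S1 a c (α 3) (β 1) (γ 1) r
  | 2, 0 => fun z => β 0 z.1 + Iy c (fun z => β 1 z.1 + Iy c r z) z
  | 2, 1 => fun z => β 1 z.1 + Iy c r z
  | 0, 2 => fun z => γ 0 z.2 + Ix a (fun z => γ 1 z.2 + Ix a r z) z
  | 1, 2 => fun z => γ 1 z.2 + Ix a r z
  | 2, 2 => r
  | _, _ => 0

section

variable (hβ : ∀ k, MemLp (β k) 2 (mu1 a b)) (hγ : ∀ k, MemLp (γ k) 2 (mu1 c d))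
  (hr : MemLp r 2 (mu2 a b c d))
include hβ hγ hr

lemma memLp_S2 (i j : ℕ) : MemLp (S2 a c α β γ r i j) 2 (mu2 a b c d) := by
  have h21 : MemLp (fun z => β 1 z.1 + Iy c r z) 2 (mu2 a b c d) :=
    (memLp_fst (hβ 1)).add (memLp_Iy hr)
  have h12 : MemLp (fun z => γ 1 z.2 + Ix a r z) 2 (mu2 a b c d) :=
    (memLp_snd (hγ 1)).add (memLp_Ix hr)
  unfold S2
  split
  · exact memLp_S1 _ (memLp_const_add_primitive _ (hβ 0)) (memLp_const_add_primitive _ (hγ 0))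
      (memLp_S1 _ (hβ 1) (hγ 1) hr)
  · exact memLp_S1 _ (hβ 0) (memLp_const_add_primitive _ (hγ 1)) h21
  · exact memLp_S1 _ (memLp_const_add_primitive _ (hβ 1)) (hγ 0) h12
  · exact memLp_S1 _ (hβ 1) (hγ 1) hr
  · exact (memLp_fst (hβ 0)).add (memLp_Iy h21)
  · exact h21
  · exact (memLp_snd (hγ 0)).add (memLp_Ix h12)
  · exact h12
  · exact hr
  · exact MemLp.zero'

/-- Only first-order steps between neighbouring entries of the table need analysis. Every other
derivative is a chain of them, with the `x`-steps taken first so that `comp_y` applies. -/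
lemma weakD_S2 (hab : a ≤ b) (hcd : c ≤ d) {i j : ℕ} (hi : i ≤ 2) (hj : j ≤ 2) :
    WeakD a b c d i j (S2 a c α β γ r 0 0) (S2 a c α β γ r i j) := by
  have hm : ∀ i j, MemLp (S2 a c α β γ r i j) 2 (mu2 a b c d) := memLp_S2 hβ hγ hr
  have q0 := memLp_const_add_primitive (α 1) (hβ 0)
  have q1 := memLp_const_add_primitive (α 2) (hγ 0)
  have q2 := memLp_const_add_primitive (α 3) (hβ 1)
  have q3 := memLp_const_add_primitive (α 3) (hγ 1)
  have h11x := S1_eq_add_Ix (c := c) (d := d) (α 3) (γ 1) (hβ 1) hr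
  have h11y := S1_eq_add_Iy (a := a) (b := b) (α 3) (β 1) (hγ 1) hr
  have w00x : WeakD a b c d 1 0 (S2 a c α β γ r 0 0) (S2 a c α β γ r 1 0) := by
    refine (weakD_S1_x hab (α 0) q0 q1 (hm 1 1)).congr .rfl ?_
    -- Differentiation yields a function of `x` plus a `y`-primitive, whereas `S2 1 0` is written as
    -- a mixed primitive. Exchanging the integrations reconciles the two.
    refine .trans ?_ (S1_eq_add_Iy (α 1) (β 0) q3 (hm 2 1)).symm
    filter_upwards [Iy_congr h11x] with z h1
    exact congrArg (_ + ·) h1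
  have w00y : WeakD a b c d 0 1 (S2 a c α β γ r 0 0) (S2 a c α β γ r 0 1) := by
    refine (weakD_S1_y hcd (α 0) q0 q1 (hm 1 1)).congr .rfl ?_
    refine .trans ?_ (S1_eq_add_Ix (α 2) (γ 0) q2 (hm 1 2)).symm
    filter_upwards [Ix_congr h11y] with z h1
    exact congrArg (_ + ·) h1
  have w10x : WeakD a b c d 1 0 (S2 a c α β γ r 1 0) (S2 a c α β γ r 2 0) :=
    weakD_S1_x hab _ (hβ 0) q3 (hm 2 1)
  have w10y : WeakD a b c d 0 1 (S2 a c α β γ r 1 0) (S2 a c α β γ r 1 1) :=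
    (weakD_S1_y hcd _ (hβ 0) q3 (hm 2 1)).congr .rfl h11x.symm
  have w01y : WeakD a b c d 0 1 (S2 a c α β γ r 0 1) (S2 a c α β γ r 0 2) :=
    weakD_S1_y hcd _ q2 (hγ 0) (hm 1 2)
  have w11y : WeakD a b c d 0 1 (S2 a c α β γ r 1 1) (S2 a c α β γ r 1 2) :=
    weakD_S1_y hcd _ (hβ 1) (hγ 1) hr
  have w20y : WeakD a b c d 0 1 (S2 a c α β γ r 2 0) (S2 a c α β γ r 2 1) :=
    weakD_primitive_y hcd (hβ 0) (hm 2 1)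
  have w21y : WeakD a b c d 0 1 (S2 a c α β γ r 2 1) (S2 a c α β γ r 2 2) :=
    weakD_primitive_y hcd (hβ 1) hr
  interval_cases i <;> interval_cases j
  · exact weakD_zero_zero _
  · exact w00y
  · exact w00y.comp_y w01y
  · exact w00x
  · exact w00x.comp_x w10y
  · exact w00x.comp_x (w10y.comp_y w11y)
  · exact w00x.comp_x w10x
  · exact w00x.comp_x (w10x.comp_x w20y)
  · exact w00x.comp_x (w10x.comp_x (w20y.comp_y w21y))

end

/-- Structure of functions in `H₂`. -/
lemma exists_S2 (hab : a < b) (hcd : c < d) {w : ℕ → ℕ → ℝ × ℝ → ℝ}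
    (hm : ∀ i ≤ 2, ∀ j ≤ 2, MemLp (w i j) 2 (mu2 a b c d))
    (hw : ∀ i ≤ 2, ∀ j ≤ 2, WeakD a b c d i j (w 0 0) (w i j)) :
    ∃ α β γ, (∀ k, MemLp (β k) 2 (mu1 a b)) ∧ (∀ k, MemLp (γ k) 2 (mu1 c d)) ∧
      w 0 0 =ᵐ[mu2 a b c d] S2 a c α β γ (w 2 2) 0 0 := by
  have hx : ∀ i ≤ 1, ∀ j ≤ 2, WeakD a b c d 1 0 (w i j) (w (i + 1) j) := fun i hi j hj =>
    (hw i (by lia) j hj).div_x (hw (i + 1) (by lia) j hj)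
  have hy : ∀ i ≤ 2, ∀ j ≤ 1, WeakD a b c d 0 1 (w i j) (w i (j + 1)) := fun i hi j hj =>
    (hw i hi j (by lia)).div_y (hw i hi (j + 1) (by lia))
  have H : ∀ i ≤ 1, ∀ j ≤ 1, ∃ α β γ, MemLp β 2 (mu1 a b) ∧ MemLp γ 2 (mu1 c d) ∧
      w i j =ᵐ[mu2 a b c d] S1 a c α β γ (w (i + 1) (j + 1)) ∧
      (w (i + 1) j =ᵐ[mu2 a b c d] fun z => β z.1 + Iy c (w (i + 1) (j + 1)) z) ∧
      w i (j + 1) =ᵐ[mu2 a b c d] fun z => γ z.2 + Ix a (w (i + 1) (j + 1)) z :=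
    fun i hi j hj => exists_S1 hab hcd (hm _ (by lia) _ (by lia)) (hm _ (by lia) _ (by lia))
      (hm _ (by lia) _ (by lia)) (hm _ (by lia) _ (by lia)) (hx i hi j (by lia))
      (hy i (by lia) j hj) (hy (i + 1) (by lia) j hj) (hx i hi (j + 1) (by lia))
  obtain ⟨α3, β1, γ1, hβ1, hγ1, h11, h21, h12⟩ := H 1 le_rfl 1 le_rfl
  obtain ⟨α1, β0, γ', hβ0, -, h10, h20, h11x⟩ := H 1 le_rfl 0 zero_le_one
  obtain ⟨α2, β', γ0, -, hγ0, h01, h11y, h02⟩ := H 0 zero_le_one 1 le_rfl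
  obtain ⟨α0, β'', γ'', -, -, h00, h10y, h01x⟩ := H 0 zero_le_one 0 zero_le_one
  simp only [zero_add, Nat.reduceAdd] at *
  have hm22 := hm 2 le_rfl 2 le_rfl
  -- The edge functions of the four applications of `H` are not independent. Here `w 1 1` has been
  -- represented twice, and comparing the parts depending on `y` alone shows that `γ'` is the
  -- primitive of `γ1` starting at `α3`. The next three comparisons are alike.
  have e1 : γ' =ᵐ[mu1 c d] fun y => α3 + ∫ ν in c..y, γ1 ν := by
    refine ae_eq_of_snd hab ?_
    filter_upwards [h11, h11x, S1_eq_add_Ix α3 γ1 hβ1 hm22, Ix_congr h21] with z h1 h2 h3 h4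
    rw [h1, h3, h4] at h2
    exact (add_right_cancel h2).symm
  have e2 : β' =ᵐ[mu1 a b] fun x => α3 + ∫ θ in a..x, β1 θ := by
    refine ae_eq_of_fst hcd ?_
    filter_upwards [h11, h11y, S1_eq_add_Iy α3 β1 hγ1 hm22, Iy_congr h12] with z h1 h2 h3 h4
    rw [h1, h3, h4] at h2
    exact (add_right_cancel h2).symm
  have hγ' : MemLp γ' 2 (mu1 c d) := (memLp_const_add_primitive α3 hγ1).ae_eq e1.symm
  have hβ' : MemLp β' 2 (mu1 a b) := (memLp_const_add_primitive α3 hβ1).ae_eq e2.symm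
  have e3 : β'' =ᵐ[mu1 a b] fun x => α1 + ∫ θ in a..x, β0 θ := by
    refine ae_eq_of_fst hcd ?_
    filter_upwards [h10, h10y, S1_eq_add_Iy α1 β0 hγ' (hm 2 le_rfl 1 one_le_two), Iy_congr h11x]
      with z h1 h2 h3 h4
    rw [h1, h3, h4] at h2
    exact (add_right_cancel h2).symm
  have e4 : γ'' =ᵐ[mu1 c d] fun y => α2 + ∫ ν in c..y, γ0 ν := by
    refine ae_eq_of_snd hab ?_
    filter_upwards [h01, h01x, S1_eq_add_Ix α2 γ0 hβ' (hm 1 one_le_two 2 le_rfl), Ix_congr h11y]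
      with z h1 h2 h3 h4
    rw [h1, h3, h4] at h2
    exact (add_right_cancel h2).symm
  refine ⟨![α0, α1, α2, α3], ![β0, β1], ![γ0, γ1], ?_, ?_, h00.trans
    (S1_congr hab.le hcd.le e3 e4 h11)⟩
  · simp [Fin.forall_fin_two, hβ0, hβ1]
  · simp [Fin.forall_fin_two, hγ0, hγ1]

end SecondOrder

/-! ### Traces do not depend on the chosen representative. -/

section Traces

variable {a b c d : ℝ} {n : ℕ}

/-- On almost every line two continuous functions agree almost everywhere on `[c, d]`. The interval
is nondegenerate, so they agree on all of it, endpoints included. -/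
lemma traceY_eq (hcd : c < d) {y₀ : ℝ} (hy : y₀ ∈ Icc c d) {v v' : ℝ × ℝ → Fin n → ℝ}
    (hv : v' =ᵐ[mu2 a b c d] v)
    (hc : ∀ᵐ x ∂(mu1 a b), ContinuousOn (fun y => v' (x, y)) (Icc c d)) :
    traceY a b c d y₀ v =ᵐ[mu1 a b] fun x => v' (x, y₀) := by
  have h : ∃ v' : ℝ × ℝ → Fin n → ℝ, v' =ᵐ[mu2 a b c d] v ∧
      ∀ᵐ x ∂(mu1 a b), ContinuousOn (fun y => v' (x, y)) (Icc c d) := ⟨v', hv, hc⟩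
  have h1 : h.choose =ᵐ[mu2 a b c d] v' := h.choose_spec.1.trans hv.symm
  rw [traceY, dif_pos h]
  filter_upwards [ae_ae_mu2 h1, hc, h.choose_spec.2] with x h1 h2 h3
  exact Measure.eqOn_Icc_of_ae_eq volume hcd.ne h1 h3 h2 hy

lemma traceX_eq (hab : a < b) {x₀ : ℝ} (hx : x₀ ∈ Icc a b) {v v' : ℝ × ℝ → Fin n → ℝ}
    (hv : v' =ᵐ[mu2 a b c d] v)
    (hc : ∀ᵐ y ∂(mu1 c d), ContinuousOn (fun x => v' (x, y)) (Icc a b)) :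
    traceX a b c d x₀ v =ᵐ[mu1 c d] fun y => v' (x₀, y) := by
  have h : ∃ v' : ℝ × ℝ → Fin n → ℝ, v' =ᵐ[mu2 a b c d] v ∧
      ∀ᵐ y ∂(mu1 c d), ContinuousOn (fun x => v' (x, y)) (Icc a b) := ⟨v', hv, hc⟩
  have h1 : h.choose =ᵐ[mu2 a b c d] v' := h.choose_spec.1.trans hv.symm
  rw [traceX, dif_pos h]
  filter_upwards [ae_ae_mu2' h1, hc, h.choose_spec.2] with x h1 h2 h3
  exact Measure.eqOn_Icc_of_ae_eq volume hab.ne h1 h3 h2 hx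

lemma corner_eq (hab : a < b) (hcd : c < d) {x₀ y₀ : ℝ} (hx : x₀ ∈ Icc a b) (hy : y₀ ∈ Icc c d)
    {v v' : ℝ × ℝ → Fin n → ℝ} (hv : v' =ᵐ[mu2 a b c d] v)
    (hc : ContinuousOn v' (Icc a b ×ˢ Icc c d)) :
    corner a b c d x₀ y₀ v = v' (x₀, y₀) := by
  have h : ∃ v' : ℝ × ℝ → Fin n → ℝ, v' =ᵐ[mu2 a b c d] v ∧
      ContinuousOn v' (Icc a b ×ˢ Icc c d) := ⟨v', hv, hc⟩
  have h1 : h.choose =ᵐ[mu2 a b c d] v' := h.choose_spec.1.trans hv.symm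
  rw [corner, dif_pos h]
  -- Almost everywhere equality of continuous functions extends to corners because a nondegenerate
  -- rectangle is the closure of its interior.
  have hsub : Icc a b ×ˢ Icc c d ⊆ closure (interior (Icc a b ×ˢ Icc c d)) := by
    rw [interior_prod_eq, closure_prod_eq, interior_Icc, interior_Icc, closure_Ioo hab.ne,
      closure_Ioo hcd.ne]
  exact Measure.eqOn_of_ae_eq h1 h.choose_spec.2 hc hsub ⟨hx, hy⟩

lemma wderiv_eq {k l : ℕ} {v w : ℝ × ℝ → Fin n → ℝ} (hw : MemLp w 2 (mu2 a b c d))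
    (h : HasWeakDeriv a b c d k l v w) : wderiv a b c d k l v =ᵐ[mu2 a b c d] w := by
  have h' : ∃ w, MemLp w 2 (mu2 a b c d) ∧ HasWeakDeriv a b c d k l v w := ⟨w, hw, h⟩
  rw [wderiv, dif_pos h']
  have key : ∀ i, (fun z => h'.choose z i) =ᵐ[mu2 a b c d] fun z => w z i := fun i =>
    (hasWeakDeriv_iff.1 h'.choose_spec.2 i).unique (hasWeakDeriv_iff.1 h i)
      (integrable_of_memLp_two (memLp_pi_iff.1 h'.choose_spec.1 i))
      (integrable_of_memLp_two (memLp_pi_iff.1 hw i))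
  filter_upwards [ae_all_iff.2 key] with z hz using funext hz

end Traces

/-! ### Integrals and corner values of iterated primitives. -/

section ClosedForms

variable {a b c d α : ℝ} {β γ : ℝ → ℝ} {r : ℝ × ℝ → ℝ}

lemma integral_mu2_eq_Ix_Iy (hr : Integrable r (mu2 a b c d)) (hab : a ≤ b) (hcd : c ≤ d) :
    Ix a (Iy c r) (b, d) = ∫ z, r z ∂(mu2 a b c d) :=
  integral_rect hr (right_mem_Icc.2 hab) (right_mem_Icc.2 hcd)

/-- Integrating a primitive over the whole interval produces the weight `b - x`. The weights `b - x`
and `d - y` in `H01`, `H02`, `H03`, `H13` and `H23` arise in this way. -/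
lemma integral_Ix (hab : a ≤ b) (hr : MemLp r 2 (mu2 a b c d)) :
    ∫ z, Ix a r z ∂(mu2 a b c d) = ∫ z, (b - z.1) * r z ∂(mu2 a b c d) := by
  have i1 := integrable_of_memLp_two (memLp_Ix hr)
  have i2 : Integrable (fun z : ℝ × ℝ => (b - z.1) * r z) (mu2 a b c d) :=
    (integrable_of_memLp_two hr).mul_of_top_right
      (memLp_mu2_of_continuous (p := ∞) (by fun_prop))
  rw [mu2_eq_prod] at i1 i2
  rw [mu2_eq_prod, integral_prod_symm _ i1, integral_prod_symm _ i2]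
  refine integral_congr_ae ?_
  filter_upwards [ae_slice_y hr] with y hy
  have := integral_primitive (integrable_of_memLp_two hy) (right_mem_Icc.2 hab)
  rwa [intervalIntegral_eq_mu1 hab, intervalIntegral_eq_mu1 hab] at this

lemma integral_Iy (hcd : c ≤ d) (hr : MemLp r 2 (mu2 a b c d)) :
    ∫ z, Iy c r z ∂(mu2 a b c d) = ∫ z, (d - z.2) * r z ∂(mu2 a b c d) := by
  rw [← integral_mu2_swap, ← integral_mu2_swap (fun z => (d - z.2) * r z)]
  exact integral_Ix hcd (memLp_swap hr)

lemma memLp_mul_of_continuous {f : ℝ × ℝ → ℝ} (hf : Continuous f) (hr : MemLp r 2 (mu2 a b c d)) :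
    MemLp (fun z => f z * r z) 2 (mu2 a b c d) :=
  hr.mul (memLp_mu2_of_continuous (p := ∞) hf)

lemma integral_Ix_Iy (hab : a ≤ b) (hcd : c ≤ d) (hr : MemLp r 2 (mu2 a b c d)) :
    ∫ z, Ix a (Iy c r) z ∂(mu2 a b c d) = ∫ z, (d - z.2) * (b - z.1) * r z ∂(mu2 a b c d) := by
  rw [integral_Ix hab (memLp_Iy hr)]
  have : ∀ z : ℝ × ℝ, (b - z.1) * Iy c r z = Iy c (fun z => (b - z.1) * r z) z := fun z =>
    (intervalIntegral.integral_const_mul _ _).symm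
  simp only [this]
  rw [integral_Iy hcd (memLp_mul_of_continuous (by fun_prop) hr)]
  exact integral_congr_ae (.of_forall fun z => by ring)

lemma measureReal_mu1 (hab : a ≤ b) : (mu1 a b).real univ = b - a := by
  simp [mu1, measureReal_def, hab]

lemma integral_fst (hcd : c ≤ d) (f : ℝ → ℝ) :
    ∫ z, f z.1 ∂(mu2 a b c d) = (d - c) * ∫ x, f x ∂(mu1 a b) := by
  rw [mu2_eq_prod, integral_fun_fst, measureReal_mu1 hcd, smul_eq_mul]

lemma integral_snd (hab : a ≤ b) (f : ℝ → ℝ) :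
    ∫ z, f z.2 ∂(mu2 a b c d) = (b - a) * ∫ y, f y ∂(mu1 c d) := by
  rw [mu2_eq_prod, integral_fun_snd, measureReal_mu1 hab, smul_eq_mul]

lemma integral_const_add_primitive (hab : a ≤ b) (α : ℝ) (hβ : MemLp β 2 (mu1 a b)) :
    ∫ x, (α + ∫ θ in a..x, β θ) ∂(mu1 a b)
      = (b - a) * α + ∫ x, (b - x) * β x ∂(mu1 a b) := by
  rw [integral_add (integrable_const _)
    ((memLp_primitive (integrable_of_memLp_two hβ) 1).integrable le_rfl), integral_const,
    measureReal_mu1 hab, smul_eq_mul, ← intervalIntegral_eq_mu1 hab,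
    integral_primitive (integrable_of_memLp_two hβ) (right_mem_Icc.2 hab),
    intervalIntegral_eq_mu1 hab]

lemma integral_fst_add_Iy (hcd : c ≤ d) (hβ : MemLp β 2 (mu1 a b)) (hr : MemLp r 2 (mu2 a b c d)) :
    ∫ z, (β z.1 + Iy c r z) ∂(mu2 a b c d)
      = (d - c) * (∫ x, β x ∂(mu1 a b)) + ∫ z, (d - z.2) * r z ∂(mu2 a b c d) := by
  rw [integral_add (integrable_of_memLp_two (memLp_fst hβ)) (integrable_of_memLp_two (memLp_Iy hr)),
    integral_fst hcd, integral_Iy hcd hr]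

lemma integral_snd_add_Ix (hab : a ≤ b) (hγ : MemLp γ 2 (mu1 c d)) (hr : MemLp r 2 (mu2 a b c d)) :
    ∫ z, (γ z.2 + Ix a r z) ∂(mu2 a b c d)
      = (b - a) * (∫ y, γ y ∂(mu1 c d)) + ∫ z, (b - z.1) * r z ∂(mu2 a b c d) := by
  rw [integral_add (integrable_of_memLp_two (memLp_snd hγ)) (integrable_of_memLp_two (memLp_Ix hr)),
    integral_snd hab, integral_Ix hab hr]

lemma integral_S1 (hab : a ≤ b) (hcd : c ≤ d) (α : ℝ) (hβ : MemLp β 2 (mu1 a b))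
    (hγ : MemLp γ 2 (mu1 c d)) (hr : MemLp r 2 (mu2 a b c d)) :
    ∫ z, S1 a c α β γ r z ∂(mu2 a b c d) = (d - c) * (b - a) * α
      + (d - c) * (∫ x, (b - x) * β x ∂(mu1 a b)) + (b - a) * (∫ y, (d - y) * γ y ∂(mu1 c d))
      + ∫ z, (d - z.2) * (b - z.1) * r z ∂(mu2 a b c d) := by
  have i1 := integrable_of_memLp_two (memLp_fst (c := c) (d := d)
    (memLp_const_add_primitive α hβ))
  have hγ' := memLp_primitive (integrable_of_memLp_two hγ) 2
  have i2 := integrable_of_memLp_two (memLp_snd (a := a) (b := b) hγ')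
  have i3 := integrable_of_memLp_two (memLp_Ix (memLp_Iy hr))
  simp only [S1]
  refine (integral_add (i1.add i2) i3).trans ?_
  simp only [Pi.add_apply]
  rw [integral_add i1 i2, integral_fst hcd (fun x => α + ∫ θ in a..x, β θ), integral_const_add_primitive hab α hβ,
    integral_snd hab (fun y => ∫ ν in c..y, γ ν), integral_Ix_Iy hab hcd hr]
  have := integral_const_add_primitive hcd 0 hγ
  simp only [zero_add, mul_zero] at this
  rw [this]
  ring

lemma S1_corner (hab : a ≤ b) (hcd : c ≤ d) (hr : MemLp r 2 (mu2 a b c d)) :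
    S1 a c α β γ r (b, d) = α + (∫ x, β x ∂(mu1 a b)) + (∫ y, γ y ∂(mu1 c d))
      + ∫ z, r z ∂(mu2 a b c d) := by
  rw [S1, integral_mu2_eq_Ix_Iy (integrable_of_memLp_two hr) hab hcd,
    intervalIntegral_eq_mu1 hab, intervalIntegral_eq_mu1 hcd]

lemma S1_corner_left (hcd : c ≤ d) : S1 a c α β γ r (a, d) = α + ∫ y, γ y ∂(mu1 c d) := by
  simp [S1, Ix, intervalIntegral_eq_mu1 hcd]

lemma S1_corner_bot (hab : a ≤ b) : S1 a c α β γ r (b, c) = α + ∫ x, β x ∂(mu1 a b) := by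
  simp [S1, Ix, Iy, intervalIntegral_eq_mu1 hab]

lemma S1_base : S1 a c α β γ r (a, c) = α := by
  simp [S1, Ix]

lemma integral_indicator_rect {E : Type*} [NormedAddCommGroup E] [NormedSpace ℝ E]
    (g : ℝ × ℝ → E) {x y : ℝ} (hx : x ∈ Icc a b) (hy : y ∈ Icc c d) :
    ∫ z, (Iic x ×ˢ Iic y).indicator g z ∂(mu2 a b c d) = ∫ z, g z ∂(mu2 a x c y) := by
  rw [integral_indicator (measurableSet_Iic.prod measurableSet_Iic), mu2, mu2,
    Measure.restrict_restrict (measurableSet_Iic.prod measurableSet_Iic)]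
  congr 2
  ext z
  simp only [mem_prod, mem_Icc, mem_inter_iff, mem_Iic]
  constructor
  · rintro ⟨⟨h1, h2⟩, ⟨h3, -⟩, h4, -⟩
    exact ⟨⟨h3, h1⟩, h4, h2⟩
  · rintro ⟨⟨h3, h1⟩, h4, h2⟩
    exact ⟨⟨h1, h2⟩, ⟨h3, h1.trans hx.2⟩, h4, h2.trans hy.2⟩

/-- The value at `p` is the integral of `r` times the indicator of the quadrant below and to the
left of `p`. For `z` off the two lines through `p`, this indicator is locally constant in `p`, so
dominated convergence applies. -/
lemma continuousOn_integral_rect (hr : Integrable r (mu2 a b c d)) :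
    ContinuousOn (Ix a (Iy c r)) (Icc a b ×ˢ Icc c d) := by
  have hF : Continuous fun p : ℝ × ℝ =>
      ∫ z, (Iic p.1 ×ˢ Iic p.2).indicator r z ∂(mu2 a b c d) := by
    rw [continuous_iff_continuousAt]
    intro p
    refine continuousAt_of_dominated (bound := fun z => ‖r z‖)
      (.of_forall fun q => hr.1.indicator (measurableSet_Iic.prod measurableSet_Iic))
      (.of_forall fun q => .of_forall fun z => norm_indicator_le_norm_self _ _) hr.norm ?_
    have h1 : ∀ᵐ z ∂(mu2 a b c d), z.1 ≠ p.1 :=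
      ae_fst (ae_restrict_of_ae (Measure.ae_ne volume p.1))
    have h2 : ∀ᵐ z ∂(mu2 a b c d), z.2 ≠ p.2 :=
      ae_snd (ae_restrict_of_ae (Measure.ae_ne volume p.2))
    filter_upwards [h1, h2] with z h1 h2
    have e1 : ∀ᶠ q in nhds p, (z.1 ≤ q.1 ↔ z.1 ≤ p.1) := by
      rcases lt_or_gt_of_ne h1 with h | h
      · filter_upwards [continuous_fst.continuousAt.eventually (lt_mem_nhds h)] with q hq
        exact iff_of_true hq.le h.le
      · filter_upwards [continuous_fst.continuousAt.eventually (gt_mem_nhds h)] with q hq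
        exact iff_of_false hq.not_ge h.not_ge
    have e2 : ∀ᶠ q in nhds p, (z.2 ≤ q.2 ↔ z.2 ≤ p.2) := by
      rcases lt_or_gt_of_ne h2 with h | h
      · filter_upwards [continuous_snd.continuousAt.eventually (lt_mem_nhds h)] with q hq
        exact iff_of_true hq.le h.le
      · filter_upwards [continuous_snd.continuousAt.eventually (gt_mem_nhds h)] with q hq
        exact iff_of_false hq.not_ge h.not_ge
    refine (continuousAt_const (y := (Iic p.1 ×ˢ Iic p.2).indicator r z)).congr ?_
    filter_upwards [e1, e2] with q e1 e2
    simp only [indicator, mem_prod, mem_Iic, e1, e2]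
  exact hF.continuousOn.congr fun p hp =>
    (integral_rect hr hp.1 hp.2).trans (integral_indicator_rect r hp.1 hp.2).symm

lemma continuousOn_primitive_mu1 (hβ : Integrable β (mu1 a b)) :
    ContinuousOn (fun x => ∫ θ in a..x, β θ) (Icc a b) := by
  rcases le_or_gt a b with hab | hab
  · have := intervalIntegral.continuousOn_primitive_interval' (intervalIntegrable_of_mu1 hβ
      (left_mem_Icc.2 hab) (right_mem_Icc.2 hab)) left_mem_uIcc
    rwa [uIcc_of_le hab] at this
  · simp [Icc_eq_empty hab.not_ge]

lemma continuousOn_S1 (hβ : MemLp β 2 (mu1 a b)) (hγ : MemLp γ 2 (mu1 c d))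
    (hr : MemLp r 2 (mu2 a b c d)) : ContinuousOn (S1 a c α β γ r) (Icc a b ×ˢ Icc c d) :=
  ((continuousOn_const.add ((continuousOn_primitive_mu1 (integrable_of_memLp_two hβ)).comp
    continuousOn_fst fun _ h => h.1)).add
    ((continuousOn_primitive_mu1 (integrable_of_memLp_two hγ)).comp
      continuousOn_snd fun _ h => h.2)).add (continuousOn_integral_rect (integrable_of_memLp_two hr))

end ClosedForms

/-! ### Corner and edge values of primitives. -/

section BoundaryValues

variable {a b c d : ℝ} {n : ℕ} {v : ℝ × ℝ → Fin n → ℝ} {α : Fin n → ℝ} {β γ : Fin n → ℝ → ℝ}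
  {r : Fin n → ℝ × ℝ → ℝ}

lemma Λ1_eq (hab : a < b) (hcd : c < d) (hβ : ∀ i, MemLp (β i) 2 (mu1 a b))
    (hγ : ∀ i, MemLp (γ i) 2 (mu1 c d)) (hr : ∀ i, MemLp (r i) 2 (mu2 a b c d))
    (h : v =ᵐ[mu2 a b c d] fun z i => S1 a c (α i) (β i) (γ i) (r i) z) :
    Λ1 a b c d v = ![fun i => α i, fun i => α i + ∫ x, β i x ∂(mu1 a b),
      fun i => α i + ∫ y, γ i y ∂(mu1 c d),
      fun i => α i + (∫ x, β i x ∂(mu1 a b)) + (∫ y, γ i y ∂(mu1 c d))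
        + ∫ z, r i z ∂(mu2 a b c d)] := by
  have hc : ContinuousOn (fun z i => S1 a c (α i) (β i) (γ i) (r i) z) (Icc a b ×ˢ Icc c d) :=
    continuousOn_pi.2 fun i => continuousOn_S1 (hβ i) (hγ i) (hr i)
  have ha := left_mem_Icc.2 hab.le
  have hb := right_mem_Icc.2 hab.le
  have hc' := left_mem_Icc.2 hcd.le
  have hd := right_mem_Icc.2 hcd.le
  simp only [Λ1, corner_eq hab hcd ha hc' h.symm hc, corner_eq hab hcd hb hc' h.symm hc,
    corner_eq hab hcd ha hd h.symm hc, corner_eq hab hcd hb hd h.symm hc, S1_base,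
    S1_corner_bot hab.le, S1_corner_left hcd.le, S1_corner hab.le hcd.le (hr _)]

lemma Λ2_eq (hcd : c < d) (hr : ∀ i, MemLp (r i) 2 (mu2 a b c d))
    (h : v =ᵐ[mu2 a b c d] fun z i => β i z.1 + Iy c (r i) z) :
    ∀ᵐ x ∂(mu1 a b), Λ2 a b c d v x
      = ![fun i => β i x, fun i => β i x + ∫ y, r i (x, y) ∂(mu1 c d)] := by
  have hc : ∀ᵐ x ∂(mu1 a b),
      ContinuousOn (fun y i => β i x + Iy c (r i) (x, y)) (Icc c d) := by
    filter_upwards [ae_all_iff.2 fun i => ae_slice_x (hr i)] with x hx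
    exact continuousOn_pi.2 fun i => continuousOn_const.add
      (continuousOn_primitive_mu1 (integrable_of_memLp_two (hx i)))
  filter_upwards [traceY_eq hcd (left_mem_Icc.2 hcd.le) h.symm hc,
    traceY_eq hcd (right_mem_Icc.2 hcd.le) h.symm hc] with x h1 h2
  simp only [Λ2, h1, h2]
  simp [Iy, intervalIntegral_eq_mu1 hcd.le]

lemma Λ3_eq (hab : a < b) (hr : ∀ i, MemLp (r i) 2 (mu2 a b c d))
    (h : v =ᵐ[mu2 a b c d] fun z i => γ i z.2 + Ix a (r i) z) :
    ∀ᵐ y ∂(mu1 c d), Λ3 a b c d v y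
      = ![fun i => γ i y, fun i => γ i y + ∫ x, r i (x, y) ∂(mu1 a b)] := by
  have hc : ∀ᵐ y ∂(mu1 c d),
      ContinuousOn (fun x i => γ i y + Ix a (r i) (x, y)) (Icc a b) := by
    filter_upwards [ae_all_iff.2 fun i => ae_slice_y (hr i)] with x hx
    exact continuousOn_pi.2 fun i => continuousOn_const.add
      (continuousOn_primitive_mu1 (integrable_of_memLp_two (hx i)))
  filter_upwards [traceX_eq hab (left_mem_Icc.2 hab.le) h.symm hc,
    traceX_eq hab (right_mem_Icc.2 hab.le) h.symm hc] with x h1 h2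
  simp only [Λ3, h1, h2]
  simp [Ix, intervalIntegral_eq_mu1 hab.le]

end BoundaryValues

/-! ### Action of the block matrices. -/

section Blocks

variable {κ l : Type} [Fintype κ] [Fintype l] {n : ℕ}

lemma colI_mulVec (v : κ → ℝ) (u : Fin n → ℝ) (p : κ × Fin n) :
    (colI n v *ᵥ u) p = v p.1 * u p.2 := by
  simp [colI, mulVec, dotProduct]

lemma blkI_mulVec (M : Matrix κ l ℝ) (u : l × Fin n → ℝ) (p : κ × Fin n) :
    (blkI n M *ᵥ u) p = ∑ k, M p.1 k * u (k, p.2) := by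
  simp [blkI, mulVec, dotProduct, Fintype.sum_prod_type]

lemma rowI_mulVec (v : κ → ℝ) (u : κ × Fin n → ℝ) (i : Fin n) :
    (rowI n v *ᵥ u) i = ∑ k, v k * u (k, i) := by
  simp [rowI, mulVec, dotProduct, Fintype.sum_prod_type]

end Blocks

/-! ### Boundary values of a function with given core values and highest derivatives. -/

section Solution

variable {a b c d : ℝ} {n₀ n₁ n₂ : ℕ}

/-- The function with core boundary values `w` and highest derivatives `f`. -/
def Sol (a c : ℝ) (w : RL (Core0 n₁ n₂) (Core1 n₁ n₂)) (f : ℝ × ℝ → State n₀ n₁ n₂ → ℝ)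
    (z : ℝ × ℝ) : State n₀ n₁ n₂ → ℝ :=
  Sum.elim (fun i => f z (Sum.inl i)) (Sum.elim
    (fun i => S1 a c (w.1 (Sum.inl i)) (fun x => w.2.1 x (Sum.inl i)) (fun y => w.2.2 y (Sum.inl i))
      (fun z => f z (Sum.inr (Sum.inl i))) z)
    (fun i => S2 a c (fun k => w.1 (Sum.inr (k, i))) (fun k x => w.2.1 x (Sum.inr (k, i)))
      (fun k y => w.2.2 y (Sum.inr (k, i))) (fun z => f z (Sum.inr (Sum.inr i))) 0 0 z))

/-- The contribution of the highest derivatives `f` to the full boundary values. -/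
def H3 (a b c d : ℝ) (f : ℝ × ℝ → State n₀ n₁ n₂ → ℝ) : RL (Full0 n₁ n₂) (Full1 n₁ n₂) :=
  (∫ z, H03 b d n₀ n₁ n₂ z.1 z.2 *ᵥ f z ∂(mu2 a b c d),
   fun x => ∫ y, H13 d n₀ n₁ n₂ y *ᵥ f (x, y) ∂(mu1 c d),
   fun y => ∫ x, H23 b n₀ n₁ n₂ x *ᵥ f (x, y) ∂(mu1 a b))

lemma matMemLp_H03 : MatMemLp (fun z : ℝ × ℝ => H03 b d n₀ n₁ n₂ z.1 z.2) 2 (mu2 a b c d) :=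
  fun i j => memLp_mu2_of_continuous (continuous_H03_apply b d n₀ n₁ n₂ i j)

lemma matMemLp_H13 : MatMemLp (H13 d n₀ n₁ n₂) 2 (mu1 c d) :=
  fun i j => memLp_mu1_of_continuous (continuous_H13_apply d n₀ n₁ n₂ i j)

lemma matMemLp_H23 : MatMemLp (H23 b n₀ n₁ n₂) 2 (mu1 a b) :=
  fun i j => memLp_mu1_of_continuous (continuous_H23_apply b n₀ n₁ n₂ i j)

lemma integral_mulVec_apply {α p q : Type} [MeasurableSpace α] [Fintype p] [Fintype q]
    {μ : Measure α} {M : α → Matrix p q ℝ} {f : α → q → ℝ} (hM : MatMemLp M 2 μ)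
    (hf : MemLp f 2 μ) (i : p) : (∫ t, M t *ᵥ f t ∂μ) i = ∫ t, (M t *ᵥ f t) i ∂μ :=
  eval_integral (fun i => (integrable_mulVec hM hf).eval i) i

lemma ae_slice_x_pi {q : Type} [Fintype q] {f : ℝ × ℝ → q → ℝ} (hf : MemLp f 2 (mu2 a b c d)) :
    ∀ᵐ x ∂(mu1 a b), MemLp (fun y => f (x, y)) 2 (mu1 c d) := by
  filter_upwards [ae_all_iff.2 fun i => ae_slice_x (memLp_pi_iff.1 hf i)] with x hx
  exact memLp_pi_iff.2 hx

lemma ae_slice_y_pi {q : Type} [Fintype q] {f : ℝ × ℝ → q → ℝ} (hf : MemLp f 2 (mu2 a b c d)) :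
    ∀ᵐ y ∂(mu1 c d), MemLp (fun x => f (x, y)) 2 (mu1 a b) := by
  filter_upwards [ae_all_iff.2 fun i => ae_slice_y (memLp_pi_iff.1 hf i)] with x hx
  exact memLp_pi_iff.2 hx

variable {w : RL (Core0 n₁ n₂) (Core1 n₁ n₂)} {f : ℝ × ℝ → State n₀ n₁ n₂ → ℝ}
  {u₁ : ℝ × ℝ → Fin n₁ → ℝ} {u₂ : ℝ × ℝ → Fin n₂ → ℝ}

lemma hasWeakDeriv_S2 (hab : a ≤ b) (hcd : c ≤ d) (hw : RL.Mem a b c d w)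
    (hf : MemLp f 2 (mu2 a b c d))
    (h₂ : u₂ =ᵐ[mu2 a b c d] fun z i => Sol a c w f z (Sum.inr (Sum.inr i)))
    {k l : ℕ} (hk : k ≤ 2) (hl : l ≤ 2) :
    MemLp (fun z i => S2 a c (fun k => w.1 (Sum.inr (k, i))) (fun k x => w.2.1 x (Sum.inr (k, i)))
      (fun k y => w.2.2 y (Sum.inr (k, i))) (fun z => f z (Sum.inr (Sum.inr i))) k l z) 2
      (mu2 a b c d) ∧
    HasWeakDeriv a b c d k l u₂ fun z i => S2 a c (fun k => w.1 (Sum.inr (k, i)))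
      (fun k x => w.2.1 x (Sum.inr (k, i))) (fun k y => w.2.2 y (Sum.inr (k, i)))
      (fun z => f z (Sum.inr (Sum.inr i))) k l z := by
  have hβ := fun (i : Fin n₂) (k : Fin 2) => memLp_pi_iff.1 hw.1 (Sum.inr (k, i))
  have hγ := fun (i : Fin n₂) (k : Fin 2) => memLp_pi_iff.1 hw.2 (Sum.inr (k, i))
  have hr := fun i : Fin n₂ => memLp_pi_iff.1 hf (Sum.inr (Sum.inr i))
  refine ⟨memLp_pi_iff.2 fun i => memLp_S2 (hβ i) (hγ i) (hr i) k l,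
    hasWeakDeriv_iff.2 fun i => ?_⟩
  exact (weakD_S2 (α := fun k => w.1 (Sum.inr (k, i))) (hβ i) (hγ i) (hr i) hab hcd hk hl).congr
    (h₂.mono fun z hz => (congrFun hz i).symm) .rfl

lemma hasWeakDeriv_S1_x (hab : a ≤ b) (hw : RL.Mem a b c d w)
    (hf : MemLp f 2 (mu2 a b c d))
    (h₁ : u₁ =ᵐ[mu2 a b c d] fun z i => Sol a c w f z (Sum.inr (Sum.inl i))) :
    MemLp (fun z i => w.2.1 z.1 (Sum.inl i) + Iy c (fun z => f z (Sum.inr (Sum.inl i))) z) 2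
      (mu2 a b c d) ∧
    HasWeakDeriv a b c d 1 0 u₁ fun z i =>
      w.2.1 z.1 (Sum.inl i) + Iy c (fun z => f z (Sum.inr (Sum.inl i))) z := by
  have hβ := fun (i : Fin n₁) => memLp_pi_iff.1 hw.1 (Sum.inl i)
  have hγ := fun (i : Fin n₁) => memLp_pi_iff.1 hw.2 (Sum.inl i)
  have hr := fun i : Fin n₁ => memLp_pi_iff.1 hf (Sum.inr (Sum.inl i))
  refine ⟨memLp_pi_iff.2 fun i => (memLp_fst (hβ i)).add (memLp_Iy (hr i)),
    hasWeakDeriv_iff.2 fun i => ?_⟩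
  exact (weakD_S1_x hab _ (hβ i) (hγ i) (hr i)).congr
    (h₁.mono fun z hz => (congrFun hz i).symm) .rfl

lemma hasWeakDeriv_S1_y (hcd : c ≤ d) (hw : RL.Mem a b c d w)
    (hf : MemLp f 2 (mu2 a b c d))
    (h₁ : u₁ =ᵐ[mu2 a b c d] fun z i => Sol a c w f z (Sum.inr (Sum.inl i))) :
    MemLp (fun z i => w.2.2 z.2 (Sum.inl i) + Ix a (fun z => f z (Sum.inr (Sum.inl i))) z) 2
      (mu2 a b c d) ∧
    HasWeakDeriv a b c d 0 1 u₁ fun z i =>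
      w.2.2 z.2 (Sum.inl i) + Ix a (fun z => f z (Sum.inr (Sum.inl i))) z := by
  have hβ := fun (i : Fin n₁) => memLp_pi_iff.1 hw.1 (Sum.inl i)
  have hγ := fun (i : Fin n₁) => memLp_pi_iff.1 hw.2 (Sum.inl i)
  have hr := fun i : Fin n₁ => memLp_pi_iff.1 hf (Sum.inr (Sum.inl i))
  refine ⟨memLp_pi_iff.2 fun i => (memLp_snd (hγ i)).add (memLp_Ix (hr i)),
    hasWeakDeriv_iff.2 fun i => ?_⟩
  exact (weakD_S1_y hcd _ (hβ i) (hγ i) (hr i)).congr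
    (h₁.mono fun z hz => (congrFun hz i).symm) .rfl

lemma hasWeakDeriv_S1_xy (hab : a ≤ b) (hcd : c ≤ d) (hw : RL.Mem a b c d w)
    (hf : MemLp f 2 (mu2 a b c d))
    (h₁ : u₁ =ᵐ[mu2 a b c d] fun z i => Sol a c w f z (Sum.inr (Sum.inl i))) :
    HasWeakDeriv a b c d 1 1 u₁ fun z i => f z (Sum.inr (Sum.inl i)) := by
  have hβ := fun (i : Fin n₁) => memLp_pi_iff.1 hw.1 (Sum.inl i)
  have hγ := fun (i : Fin n₁) => memLp_pi_iff.1 hw.2 (Sum.inl i)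
  have hr := fun i : Fin n₁ => memLp_pi_iff.1 hf (Sum.inr (Sum.inl i))
  refine hasWeakDeriv_iff.2 fun i => ?_
  exact ((weakD_S1_x hab _ (hβ i) (hγ i) (hr i)).comp_x
    (weakD_primitive_y hcd (hβ i) (hr i))).congr
    (h₁.mono fun z hz => (congrFun hz i).symm) .rfl

/-- The full boundary values in terms of the core boundary values and the highest derivatives. -/
lemma Λbf_fst (hab : a < b) (hcd : c < d) (hw : RL.Mem a b c d w) (hf : MemLp f 2 (mu2 a b c d))
    (h₁ : u₁ =ᵐ[mu2 a b c d] fun z i => Sol a c w f z (Sum.inr (Sum.inl i)))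
    (h₂ : u₂ =ᵐ[mu2 a b c d] fun z i => Sol a c w f z (Sum.inr (Sum.inr i))) :
    (Λbf a b c d u₁ u₂).1
      = (PSep a b c d (H1Param a b c d n₁ n₂) w + H3 a b c d f).1 := by
  have hβ := fun i => memLp_pi_iff.1 hw.1 i
  have hγ := fun i => memLp_pi_iff.1 hw.2 i
  have hr := fun i => memLp_pi_iff.1 hf i
  rw [PSep_H1]
  ext p
  simp only [Prod.fst_add, H3, Pi.add_apply]
  have m1 : MatMemLp (H01 b c d n₁ n₂) 2 (mu1 a b) := (H1Param_mem (a := a)).mem01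
  have m2 : MatMemLp (H02 a b d n₁ n₂) 2 (mu1 c d) := (H1Param_mem (c := c)).mem02
  rw [integral_mulVec_apply m1 hw.1, integral_mulVec_apply m2 hw.2, integral_mulVec_apply matMemLp_H03 hf]
  have iβ := fun i => integrable_of_memLp_two (hβ i)
  have iγ := fun i => integrable_of_memLp_two (hγ i)
  have iβ' : ∀ i, Integrable (fun x => (b - x) * w.2.1 x i) (mu1 a b) := fun i =>
    integrable_of_memLp_two ((hβ i).mul (memLp_mu1_of_continuous (p := ∞) (by fun_prop)))
  have iγ' : ∀ i, Integrable (fun y => (d - y) * w.2.2 y i) (mu1 c d) := fun i =>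
    integrable_of_memLp_two ((hγ i).mul (memLp_mu1_of_continuous (p := ∞) (by fun_prop)))
  rcases p with ⟨k, i⟩ | ⟨k, i⟩
  · have := Λ1_eq hab hcd (fun i => hβ (Sum.inl i)) (fun i => hγ (Sum.inl i))
      (fun i => hr (Sum.inr (Sum.inl i))) h₁
    simp only [Λbf, Sum.elim_inl, this, H00, H01, H02, H03, fromBlocks_mulVec,
      fromCols_mulVec, colI_mulVec, Pi.add_apply, Matrix.zero_mulVec, Pi.zero_apply, add_zero,
      zero_add, Function.comp_apply]
    fin_cases k <;> simp
  -- The sixteen rows are the four corner values of each of `u₂`, `∂ₓu₂`, `∂_yu₂` and `∂ₓ∂_yu₂`.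
  -- Each of these is a mixed primitive with its own edge functions.
  · have e0 := Λ1_eq hab hcd
      (fun i => memLp_const_add_primitive (w.1 (Sum.inr (1, i))) (hβ (Sum.inr (0, i))))
      (fun i => memLp_const_add_primitive (w.1 (Sum.inr (2, i))) (hγ (Sum.inr (0, i))))
      (fun i => memLp_S1 (w.1 (Sum.inr (3, i))) (hβ (Sum.inr (1, i))) (hγ (Sum.inr (1, i)))
        (hr (Sum.inr (Sum.inr i)))) h₂
    have hD := fun k l (hk : k ≤ 2) (hl : l ≤ 2) => wderiv_eq
      (hasWeakDeriv_S2 hab.le hcd.le hw hf h₂ hk hl).1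
      (hasWeakDeriv_S2 hab.le hcd.le hw hf h₂ hk hl).2
    have e1 := Λ1_eq hab hcd (fun i => hβ (Sum.inr (0, i)))
      (fun i => memLp_const_add_primitive (w.1 (Sum.inr (3, i))) (hγ (Sum.inr (1, i))))
      (fun i => (memLp_fst (hβ (Sum.inr (1, i)))).add (memLp_Iy (hr (Sum.inr (Sum.inr i)))))
      (hD 1 0 one_le_two zero_le_two)
    have e2 := Λ1_eq hab hcd
      (fun i => memLp_const_add_primitive (w.1 (Sum.inr (3, i))) (hβ (Sum.inr (1, i))))
      (fun i => hγ (Sum.inr (0, i)))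
      (fun i => (memLp_snd (hγ (Sum.inr (1, i)))).add (memLp_Ix (hr (Sum.inr (Sum.inr i)))))
      (hD 0 1 zero_le_two one_le_two)
    have e3 := Λ1_eq hab hcd (fun i => hβ (Sum.inr (1, i))) (fun i => hγ (Sum.inr (1, i)))
      (fun i => hr (Sum.inr (Sum.inr i))) (hD 1 1 one_le_two one_le_two)
    -- Those edge functions and mixed derivatives are themselves primitives. Reducing their
    -- integrals to weighted integrals of `w` and `f` makes the entries of the `H` matrices visible.
    simp only [integral_const_add_primitive hab.le _ (hβ _),
      integral_const_add_primitive hcd.le _ (hγ _),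
      integral_S1 hab.le hcd.le _ (hβ _) (hγ _) (hr _)] at e0
    simp only [Pi.add_apply, integral_const_add_primitive hcd.le _ (hγ _),
      integral_fst_add_Iy hcd.le (hβ _) (hr _)] at e1
    simp only [Pi.add_apply, integral_const_add_primitive hab.le _ (hβ _),
      integral_snd_add_Ix hab.le (hγ _) (hr _)] at e2
    simp only [Λbf, Sum.elim_inr, e0, e1, e2, e3, H00, H01, H02, H03, fromBlocks_mulVec,
      fromCols_mulVec, colI_mulVec, blkI_mulVec, Pi.add_apply, Matrix.zero_mulVec, Pi.zero_apply,
      add_zero, zero_add, Function.comp_apply, Fin.sum_univ_four, Fin.sum_univ_two]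
    fin_cases k <;> simp [integral_add, Integrable.const_mul, iβ, iγ, iβ', iγ', mul_assoc,
      integral_const_mul] <;> ring

lemma Λbf_snd (hab : a < b) (hcd : c < d) (hw : RL.Mem a b c d w) (hf : MemLp f 2 (mu2 a b c d))
    (h₁ : u₁ =ᵐ[mu2 a b c d] fun z i => Sol a c w f z (Sum.inr (Sum.inl i)))
    (h₂ : u₂ =ᵐ[mu2 a b c d] fun z i => Sol a c w f z (Sum.inr (Sum.inr i))) :
    (Λbf a b c d u₁ u₂).2.1 =ᵐ[mu1 a b]
      (PSep a b c d (H1Param a b c d n₁ n₂) w + H3 a b c d f).2.1 := by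
  have hβ := fun i => memLp_pi_iff.1 hw.1 i
  have hr := fun i => memLp_pi_iff.1 hf i
  have hD := fun k l (hk : k ≤ 2) (hl : l ≤ 2) => wderiv_eq
    (hasWeakDeriv_S2 hab.le hcd.le hw hf h₂ hk hl).1
    (hasWeakDeriv_S2 hab.le hcd.le hw hf h₂ hk hl).2
  have g1 := hasWeakDeriv_S1_x hab.le hw hf h₁
  have e0 := Λ2_eq (β := fun i x => w.2.1 x (Sum.inl i)) hcd (fun i => hr (Sum.inr (Sum.inl i)))
    (wderiv_eq g1.1 g1.2)
  have e1 := Λ2_eq (β := fun i x => w.2.1 x (Sum.inr (0, i))) hcd (fun i => (memLp_fst (hβ (Sum.inr (1, i)))).add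
    (memLp_Iy (hr (Sum.inr (Sum.inr i))))) (hD 2 0 le_rfl zero_le_two)
  have e2 := Λ2_eq (β := fun i x => w.2.1 x (Sum.inr (1, i))) hcd
    (fun i => hr (Sum.inr (Sum.inr i))) (hD 2 1 le_rfl one_le_two)
  rw [PSep_H1]
  filter_upwards [e0, e1, e2, ae_slice_x_pi hf] with x e0 e1 e2 hx
  -- The value of `∂ₓ²u₂` at `y = d` involves the integral of `∂ₓ²∂_yu₂` in `y`, itself a primitive.
  -- This gives the entry `d - c` of `H11` and the weight `d - y` of `H13`.
  have e3 : ∀ i, ∫ y, (w.2.1 x (Sum.inr (1, i)) + Iy c (fun z => f z (Sum.inr (Sum.inr i))) (x, y))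
      ∂(mu1 c d) = (d - c) * w.2.1 x (Sum.inr (1, i))
        + ∫ y, (d - y) * f (x, y) (Sum.inr (Sum.inr i)) ∂(mu1 c d) := fun i =>
    integral_const_add_primitive hcd.le _ (memLp_pi_iff.1 hx (Sum.inr (Sum.inr i)))
  simp only [Pi.add_apply, e3] at e1
  ext p
  simp only [Prod.snd_add, Prod.fst_add, H3, Pi.add_apply]
  rw [integral_mulVec_apply matMemLp_H13 hx]
  rcases p with ⟨k, i⟩ | ⟨k, i⟩
  · simp only [Λbf, Sum.elim_inl, e0, H11, H13, fromBlocks_mulVec,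
      fromCols_mulVec, colI_mulVec, Pi.add_apply, Matrix.zero_mulVec, Pi.zero_apply, add_zero,
      zero_add, Function.comp_apply]
    fin_cases k <;> simp
  · simp only [Λbf, Sum.elim_inr, e1, e2, H11, H13, fromBlocks_mulVec,
      fromCols_mulVec, colI_mulVec, blkI_mulVec, Pi.add_apply, Matrix.zero_mulVec, Pi.zero_apply,
      add_zero, zero_add, Function.comp_apply, Fin.sum_univ_two]
    fin_cases k <;> simp [add_assoc]

lemma Λbf_trd (hab : a < b) (hcd : c < d) (hw : RL.Mem a b c d w) (hf : MemLp f 2 (mu2 a b c d))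
    (h₁ : u₁ =ᵐ[mu2 a b c d] fun z i => Sol a c w f z (Sum.inr (Sum.inl i)))
    (h₂ : u₂ =ᵐ[mu2 a b c d] fun z i => Sol a c w f z (Sum.inr (Sum.inr i))) :
    (Λbf a b c d u₁ u₂).2.2 =ᵐ[mu1 c d]
      (PSep a b c d (H1Param a b c d n₁ n₂) w + H3 a b c d f).2.2 := by
  have hγ := fun i => memLp_pi_iff.1 hw.2 i
  have hr := fun i => memLp_pi_iff.1 hf i
  have hD := fun k l (hk : k ≤ 2) (hl : l ≤ 2) => wderiv_eq
    (hasWeakDeriv_S2 hab.le hcd.le hw hf h₂ hk hl).1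
    (hasWeakDeriv_S2 hab.le hcd.le hw hf h₂ hk hl).2
  have g1 := hasWeakDeriv_S1_y hcd.le hw hf h₁
  have e0 := Λ3_eq (γ := fun i y => w.2.2 y (Sum.inl i)) hab (fun i => hr (Sum.inr (Sum.inl i)))
    (wderiv_eq g1.1 g1.2)
  have e1 := Λ3_eq (γ := fun i y => w.2.2 y (Sum.inr (0, i))) hab (fun i => (memLp_snd (hγ (Sum.inr (1, i)))).add
    (memLp_Ix (hr (Sum.inr (Sum.inr i))))) (hD 0 2 zero_le_two le_rfl)
  have e2 := Λ3_eq (γ := fun i y => w.2.2 y (Sum.inr (1, i))) hab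
    (fun i => hr (Sum.inr (Sum.inr i))) (hD 1 2 one_le_two le_rfl)
  rw [PSep_H1]
  filter_upwards [e0, e1, e2, ae_slice_y_pi hf] with y e0 e1 e2 hx
  have e3 : ∀ i, ∫ x, (w.2.2 y (Sum.inr (1, i)) + Ix a (fun z => f z (Sum.inr (Sum.inr i))) (x, y))
      ∂(mu1 a b) = (b - a) * w.2.2 y (Sum.inr (1, i))
        + ∫ x, (b - x) * f (x, y) (Sum.inr (Sum.inr i)) ∂(mu1 a b) := fun i =>
    integral_const_add_primitive hab.le _ (memLp_pi_iff.1 hx (Sum.inr (Sum.inr i)))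
  simp only [Pi.add_apply, e3] at e1
  ext p
  simp only [Prod.snd_add, H3, Pi.add_apply]
  rw [integral_mulVec_apply matMemLp_H23 hx]
  rcases p with ⟨k, i⟩ | ⟨k, i⟩
  · simp only [Λbf, Sum.elim_inl, e0, H22, H23, fromBlocks_mulVec,
      fromCols_mulVec, colI_mulVec, Pi.add_apply, Matrix.zero_mulVec, Pi.zero_apply, add_zero,
      zero_add, Function.comp_apply]
    fin_cases k <;> simp
  · simp only [Λbf, Sum.elim_inr, e1, e2, H22, H23, fromBlocks_mulVec,
      fromCols_mulVec, colI_mulVec, blkI_mulVec, Pi.add_apply, Matrix.zero_mulVec, Pi.zero_apply,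
      add_zero, zero_add, Function.comp_apply, Fin.sum_univ_two]
    fin_cases k <;> simp [add_assoc]

end Solution

/-! ### Sobolev functions are exactly the functions `Sol`. -/

section SobolevStructure

variable {a b c d : ℝ} {n n₀ n₁ n₂ : ℕ}

lemma wderiv_spec {k : ℕ} {v : ℝ × ℝ → Fin n → ℝ} (h : InH a b c d k v) {i j : ℕ} (hi : i ≤ k)
    (hj : j ≤ k) : MemLp (wderiv a b c d i j v) 2 (mu2 a b c d) ∧
      HasWeakDeriv a b c d i j v (wderiv a b c d i j v) := by
  rw [wderiv, dif_pos (h.2 i hi j hj)]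
  exact (h.2 i hi j hj).choose_spec

lemma InH.exists_S1 (hab : a < b) (hcd : c < d) {v : ℝ × ℝ → Fin n → ℝ} (h : InH a b c d 1 v)
    (i : Fin n) : ∃ α β γ, MemLp β 2 (mu1 a b) ∧ MemLp γ 2 (mu1 c d) ∧
      (fun z => v z i) =ᵐ[mu2 a b c d] S1 a c α β γ fun z => wderiv a b c d 1 1 v z i := by
  have hm := fun (k l) (hk : k ≤ 1) (hl : l ≤ 1) => memLp_pi_iff.1 (wderiv_spec h hk hl).1 i
  have hw := fun (k l) (hk : k ≤ 1) (hl : l ≤ 1) =>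
    hasWeakDeriv_iff.1 (wderiv_spec h hk hl).2 i
  have h10 := hw 1 0 le_rfl zero_le_one
  have h01 := hw 0 1 zero_le_one le_rfl
  have h11 := hw 1 1 le_rfl le_rfl
  obtain ⟨α, β, γ, hβ, hγ, h, -⟩ := PIE2D.exists_S1 hab hcd (memLp_pi_iff.1 h.1 i)
    (hm 1 0 le_rfl zero_le_one) (hm 0 1 zero_le_one le_rfl) (hm 1 1 le_rfl le_rfl) h10 h01
    (h10.div_y h11) (h01.div_x h11)
  exact ⟨α, β, γ, hβ, hγ, h⟩

lemma InH.exists_S2 (hab : a < b) (hcd : c < d) {v : ℝ × ℝ → Fin n → ℝ} (h : InH a b c d 2 v)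
    (i : Fin n) : ∃ α β γ, (∀ k, MemLp (β k) 2 (mu1 a b)) ∧ (∀ k, MemLp (γ k) 2 (mu1 c d)) ∧
      (fun z => v z i) =ᵐ[mu2 a b c d]
        S2 a c α β γ (fun z => wderiv a b c d 2 2 v z i) 0 0 := by
  have hm := fun (k) (hk : k ≤ 2) (l) (hl : l ≤ 2) => memLp_pi_iff.1 (wderiv_spec h hk hl).1 i
  have hw := fun (k) (hk : k ≤ 2) (l) (hl : l ≤ 2) =>
    hasWeakDeriv_iff.1 (wderiv_spec h hk hl).2 i
  -- The weak derivative of order zero is a chosen function, equal to `v` only almost everywhere.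
  have h0 : (fun z => v z i) =ᵐ[mu2 a b c d] fun z => wderiv a b c d 0 0 v z i :=
    (weakD_zero_zero _).unique (hw 0 zero_le_two 0 zero_le_two)
      (integrable_of_memLp_two (memLp_pi_iff.1 h.1 i))
      (integrable_of_memLp_two (hm 0 zero_le_two 0 zero_le_two))
  obtain ⟨α, β, γ, hβ, hγ, h⟩ := PIE2D.exists_S2 hab hcd
    (w := fun k l z => wderiv a b c d k l v z i) hm
    (fun k hk l hl => (hw k hk l hl).congr h0 .rfl)
  exact ⟨α, β, γ, hβ, hγ, h0.trans h⟩

/-- Every element of `L₂ × H₁ × H₂` is determined by its core boundary values and its highest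
derivatives. -/
lemma exists_Sol (hab : a < b) (hcd : c < d) {u₀ : ℝ × ℝ → Fin n₀ → ℝ} {u₁ : ℝ × ℝ → Fin n₁ → ℝ}
    {u₂ : ℝ × ℝ → Fin n₂ → ℝ} (h₀ : MemLp u₀ 2 (mu2 a b c d)) (h₁ : InH a b c d 1 u₁)
    (h₂ : InH a b c d 2 u₂) :
    ∃ (w : RL (Core0 n₁ n₂) (Core1 n₁ n₂)) (f : ℝ × ℝ → State n₀ n₁ n₂ → ℝ),
      RL.Mem a b c d w ∧ MemLp f 2 (mu2 a b c d) ∧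
      (fun z => Sum.elim (u₀ z) (Sum.elim (u₁ z) (u₂ z))) =ᵐ[mu2 a b c d] Sol a c w f := by
  choose α β γ hβ hγ h1 using h₁.exists_S1 hab hcd
  choose α' β' γ' hβ' hγ' h2 using h₂.exists_S2 hab hcd
  refine ⟨(Sum.elim α fun p => α' p.2 p.1, fun x => Sum.elim (fun i => β i x) fun p => β' p.2 p.1 x,
    fun y => Sum.elim (fun i => γ i y) fun p => γ' p.2 p.1 y),
    fun z => Sum.elim (u₀ z) (Sum.elim (wderiv a b c d 1 1 u₁ z) (wderiv a b c d 2 2 u₂ z)),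
    ⟨memLp_pi_iff.2 ?_, memLp_pi_iff.2 ?_⟩, memLp_pi_iff.2 ?_, ?_⟩
  · rintro (i | ⟨k, i⟩)
    exacts [hβ i, hβ' i k]
  · rintro (i | ⟨k, i⟩)
    exacts [hγ i, hγ' i k]
  · rintro (i | i | i)
    exacts [memLp_pi_iff.1 h₀ i, memLp_pi_iff.1 (wderiv_spec h₁ le_rfl le_rfl).1 i,
      memLp_pi_iff.1 (wderiv_spec h₂ le_rfl le_rfl).1 i]
  · filter_upwards [ae_all_iff.2 h1, ae_all_iff.2 h2] with z h1 h2
    ext (i | i | i)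
    exacts [rfl, h1 i, h2 i]

variable {w : RL (Core0 n₁ n₂) (Core1 n₁ n₂)} {f : ℝ × ℝ → State n₀ n₁ n₂ → ℝ}
  {u₁ : ℝ × ℝ → Fin n₁ → ℝ} {u₂ : ℝ × ℝ → Fin n₂ → ℝ}

lemma memLp_Sol (hw : RL.Mem a b c d w) (hf : MemLp f 2 (mu2 a b c d)) :
    MemLp (Sol a c w f) 2 (mu2 a b c d) := by
  refine memLp_pi_iff.2 ?_
  rintro (i | i | i)
  · exact memLp_pi_iff.1 hf (Sum.inl i)
  · exact memLp_S1 _ (memLp_pi_iff.1 hw.1 _) (memLp_pi_iff.1 hw.2 _) (memLp_pi_iff.1 hf _)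
  · exact memLp_S2 (α := fun k => w.1 (Sum.inr (k, i)))
      (fun k => memLp_pi_iff.1 hw.1 (Sum.inr (k, i)))
      (fun k => memLp_pi_iff.1 hw.2 (Sum.inr (k, i))) (memLp_pi_iff.1 hf (Sum.inr (Sum.inr i))) 0 0

lemma inH_one_Sol (hab : a ≤ b) (hcd : c ≤ d) (hw : RL.Mem a b c d w)
    (hf : MemLp f 2 (mu2 a b c d))
    (h₁ : u₁ =ᵐ[mu2 a b c d] fun z i => Sol a c w f z (Sum.inr (Sum.inl i))) :
    InH a b c d 1 u₁ := by
  have hu : MemLp u₁ 2 (mu2 a b c d) :=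
    (memLp_pi_iff.2 fun i => memLp_pi_iff.1 (memLp_Sol hw hf) (Sum.inr (Sum.inl i))).ae_eq h₁.symm
  refine ⟨hu, fun i hi j hj => ?_⟩
  interval_cases i <;> interval_cases j
  · exact ⟨u₁, hu, hasWeakDeriv_iff.2 fun i => weakD_zero_zero _⟩
  · exact ⟨_, hasWeakDeriv_S1_y hcd hw hf h₁⟩
  · exact ⟨_, hasWeakDeriv_S1_x hab hw hf h₁⟩
  · exact ⟨_, memLp_pi_iff.2 fun i => memLp_pi_iff.1 hf (Sum.inr (Sum.inl i)),
      hasWeakDeriv_S1_xy hab hcd hw hf h₁⟩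

lemma inH_two_Sol (hab : a ≤ b) (hcd : c ≤ d) (hw : RL.Mem a b c d w)
    (hf : MemLp f 2 (mu2 a b c d))
    (h₂ : u₂ =ᵐ[mu2 a b c d] fun z i => Sol a c w f z (Sum.inr (Sum.inr i))) :
    InH a b c d 2 u₂ :=
  ⟨(memLp_pi_iff.2 fun i => memLp_pi_iff.1 (memLp_Sol hw hf) (Sum.inr (Sum.inr i))).ae_eq h₂.symm,
    fun _ hi _ hj => ⟨_, hasWeakDeriv_S2 hab hcd hw hf h₂ hi hj⟩⟩

/-- This identity turns the boundary condition on `u` into a linear equation for the core values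
`w`. -/
lemma Λbf_eq (hab : a < b) (hcd : c < d) (hw : RL.Mem a b c d w) (hf : MemLp f 2 (mu2 a b c d))
    (h₁ : u₁ =ᵐ[mu2 a b c d] fun z i => Sol a c w f z (Sum.inr (Sum.inl i)))
    (h₂ : u₂ =ᵐ[mu2 a b c d] fun z i => Sol a c w f z (Sum.inr (Sum.inr i))) :
    RL.Eq a b c d (Λbf a b c d u₁ u₂) (P011 a b c d (H1Param a b c d n₁ n₂) w + H3 a b c d f) :=
  RL.Eq.trans ⟨Λbf_fst hab hcd hw hf h₁ h₂, Λbf_snd hab hcd hw hf h₁ h₂,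
      Λbf_trd hab hcd hw hf h₁ h₂⟩
    ((P011_eq_PSep hab.le hcd.le H1Param_mem H1Param_separable hw).symm.add (.refl _))

end SobolevStructure

/-! ### Kernels of operators from the rectangle to boundary data, and their composition. -/

section Kernels

variable {p₀ p₁ q₀ q₁ s : Type} [Fintype p₀] [Fintype p₁] [Fintype q₀] [Fintype q₁] [Fintype s]
  {a b c d : ℝ}

/-- Kernels of an operator from `L₂^s[x, y]` to `ℝ^p₀ × L₂^p₁[x] × L₂^p₁[y]`. -/
@[ext]
structure Ker (p₀ p₁ s : Type) where
  A0 : ℝ × ℝ → Matrix p₀ s ℝ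
  A1d : ℝ × ℝ → Matrix p₁ s ℝ
  A1k : ℝ → ℝ × ℝ → Matrix p₁ s ℝ
  A2d : ℝ × ℝ → Matrix p₁ s ℝ
  A2k : ℝ → ℝ × ℝ → Matrix p₁ s ℝ

namespace Ker

/-- Square integrability of the kernels, and boundedness of the partial ones. -/
structure Mem (a b c d : ℝ) (A : Ker p₀ p₁ s) : Prop where
  mem0 : MatMemLp A.A0 2 (mu2 a b c d)
  mem1d : MatMemLp A.A1d ∞ (mu2 a b c d)
  mem1k : MatMemLp (fun p : ℝ × (ℝ × ℝ) => A.A1k p.1 p.2) 2 ((mu1 a b).prod (mu2 a b c d))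
  mem2d : MatMemLp A.A2d ∞ (mu2 a b c d)
  mem2k : MatMemLp (fun p : ℝ × (ℝ × ℝ) => A.A2k p.1 p.2) 2 ((mu1 c d).prod (mu2 a b c d))

/-- The operator with the given kernels. -/
def app (a b c d : ℝ) (A : Ker p₀ p₁ s) (f : ℝ × ℝ → s → ℝ) : RL p₀ p₁ :=
  (∫ z, A.A0 z *ᵥ f z ∂(mu2 a b c d),
   fun x => (∫ y, A.A1d (x, y) *ᵥ f (x, y) ∂(mu1 c d)) + ∫ z, A.A1k x z *ᵥ f z ∂(mu2 a b c d),
   fun y => (∫ x, A.A2d (x, y) *ᵥ f (x, y) ∂(mu1 a b)) + ∫ z, A.A2k y z *ᵥ f z ∂(mu2 a b c d))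

/-- The kernel of the composition with a functional on `ℝ^p₀ × L₂^p₁[x] × L₂^p₁[y]`. -/
def row (a b c d : ℝ) (A : Ker p₀ p₁ s) (M0 : Matrix q₀ p₀ ℝ) (M1 M2 : ℝ → Matrix q₀ p₁ ℝ)
    (z : ℝ × ℝ) : Matrix q₀ s ℝ :=
  M0 * A.A0 z + M1 z.1 * A.A1d z + matInt (mu1 a b) (fun t => M1 t * A.A1k t z)
    + M2 z.2 * A.A2d z + matInt (mu1 c d) (fun t => M2 t * A.A2k t z)

/-- The kernels of the composition with a 011-PI operator. -/
def comp (a b c d : ℝ) (N : Param011 q₀ q₁ p₀ p₁) (A : Ker p₀ p₁ s) : Ker q₀ q₁ s where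
  A0 := A.row a b c d N.N00 N.N01 N.N02
  A1d z := N.N11_0 z.1 * A.A1d z
  A1k x z := N.N11_0 x * A.A1k x z + A.row a b c d (N.N10 x) (N.N11_1 x) (N.N12 x) z
  A2d z := N.N22_0 z.2 * A.A2d z
  A2k y z := N.N22_0 y * A.A2k y z
    + A.row a b c d (N.N20 y) (fun x => N.N21 x y) (N.N22_1 y) z

variable {A : Ker p₀ p₁ s} {f : ℝ × ℝ → s → ℝ}

lemma memLp_slice_integral {l : Type} [Fintype l] {g : ℝ × ℝ → l → ℝ}
    (hg : MemLp g 2 (mu2 a b c d)) : MemLp (fun x => ∫ y, g (x, y) ∂(mu1 c d)) 2 (mu1 a b) := by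
  refine .of_eval fun i => ?_
  have h1 : MemLp (fun x => ∫ y, g (x, y) i * 1 ∂(mu1 c d)) 2 (mu1 a b) :=
    memLp_two_hs (k := fun z => g z i) (mu2_eq_prod a b c d ▸ memLp_pi_iff.1 hg i) (memLp_const 1)
  refine h1.ae_eq ?_
  filter_upwards [ae_slice_x_pi hg] with x hx
  simp only [mul_one]
  exact (eval_integral (fun i => integrable_of_memLp_two (memLp_pi_iff.1 hx i)) i).symm

lemma memLp_swap_pi {l : Type} [Fintype l] {g : ℝ × ℝ → l → ℝ} (hg : MemLp g 2 (mu2 a b c d)) :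
    MemLp (fun z => g z.swap) 2 (mu2 c d a b) :=
  memLp_pi_iff.2 fun i => memLp_swap (memLp_pi_iff.1 hg i)

lemma memLp_slice_integral' {l : Type} [Fintype l] {g : ℝ × ℝ → l → ℝ}
    (hg : MemLp g 2 (mu2 a b c d)) : MemLp (fun y => ∫ x, g (x, y) ∂(mu1 a b)) 2 (mu1 c d) :=
  memLp_slice_integral (memLp_swap_pi hg)

lemma matMemLp_fst {l m : Type} [Fintype l] [Fintype m] {M : ℝ → Matrix l m ℝ} {p : ℝ≥0∞}
    (hM : MatMemLp M p (mu1 a b)) : MatMemLp (fun z : ℝ × ℝ => M z.1) p (mu2 a b c d) :=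
  fun i j => memLp_fst (hM i j)

lemma matMemLp_snd {l m : Type} [Fintype l] [Fintype m] {M : ℝ → Matrix l m ℝ} {p : ℝ≥0∞}
    (hM : MatMemLp M p (mu1 c d)) : MatMemLp (fun z : ℝ × ℝ => M z.2) p (mu2 a b c d) :=
  fun i j => memLp_snd (hM i j)

/-- Boundedness of `D` keeps `M D` square integrable on the rectangle. This is why the partial
kernels of `Ker` are required to be essentially bounded. -/
lemma fubini_partial {l m : Type} [Fintype l] [Fintype m] {M : ℝ → Matrix l m ℝ}
    {D : ℝ × ℝ → Matrix m s ℝ} (hM : MatMemLp M 2 (mu1 a b)) (hD : MatMemLp D ∞ (mu2 a b c d))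
    (hf : MemLp f 2 (mu2 a b c d)) :
    ∫ x, M x *ᵥ (∫ y, D (x, y) *ᵥ f (x, y) ∂(mu1 c d)) ∂(mu1 a b)
      = ∫ z, (M z.1 * D z) *ᵥ f z ∂(mu2 a b c d) := by
  have hMD : MatMemLp (fun z : ℝ × ℝ => M z.1 * D z) 2 (mu2 a b c d) := (matMemLp_fst hM).mul hD
  have hI := integrable_mulVec hMD hf
  rw [mu2_eq_prod] at hI
  rw [mu2_eq_prod, integral_prod _ hI]
  refine integral_congr_ae ?_
  filter_upwards [ae_slice_x_pi (hD.mulVec hf : MemLp _ 2 _)] with x hx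
  rw [mulVec_integral _ (hx.integrable (by norm_num))]
  simp_rw [Matrix.mulVec_mulVec]

lemma fubini_partial' {l m : Type} [Fintype l] [Fintype m] {M : ℝ → Matrix l m ℝ}
    {D : ℝ × ℝ → Matrix m s ℝ} (hM : MatMemLp M 2 (mu1 c d)) (hD : MatMemLp D ∞ (mu2 a b c d))
    (hf : MemLp f 2 (mu2 a b c d)) :
    ∫ y, M y *ᵥ (∫ x, D (x, y) *ᵥ f (x, y) ∂(mu1 a b)) ∂(mu1 c d)
      = ∫ z, (M z.2 * D z) *ᵥ f z ∂(mu2 a b c d) := by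
  have hMD : MatMemLp (fun z : ℝ × ℝ => M z.2 * D z) 2 (mu2 a b c d) := (matMemLp_snd hM).mul hD
  have hI := integrable_mulVec hMD hf
  rw [mu2_eq_prod] at hI
  rw [mu2_eq_prod, integral_prod_symm _ hI]
  refine integral_congr_ae ?_
  filter_upwards [ae_slice_y_pi (hD.mulVec hf : MemLp _ 2 _)] with x hx
  rw [mulVec_integral _ (hx.integrable (by norm_num))]
  simp_rw [Matrix.mulVec_mulVec]

variable (hA : A.Mem a b c d)
include hA

lemma Mem.app_mem (hf : MemLp f 2 (mu2 a b c d)) : RL.Mem a b c d (A.app a b c d f) :=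
  ⟨(memLp_slice_integral (hA.mem1d.mulVec hf)).add (hA.mem1k.hs hf),
    (memLp_slice_integral' (hA.mem2d.mulVec hf)).add (hA.mem2k.hs hf)⟩

/-- Fubini's theorem for the composition of a functional with the operator of `A`. -/
lemma Mem.row_apply (hf : MemLp f 2 (mu2 a b c d)) (M0 : Matrix q₀ p₀ ℝ) {M1 M2 : ℝ → Matrix q₀ p₁ ℝ}
    (h1 : MatMemLp M1 2 (mu1 a b)) (h2 : MatMemLp M2 2 (mu1 c d)) :
    Integrable (fun z => A.row a b c d M0 M1 M2 z *ᵥ f z) (mu2 a b c d) ∧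
    M0 *ᵥ (A.app a b c d f).1 + (∫ x, M1 x *ᵥ (A.app a b c d f).2.1 x ∂(mu1 a b))
      + ∫ y, M2 y *ᵥ (A.app a b c d f).2.2 y ∂(mu1 c d)
      = ∫ z, A.row a b c d M0 M1 M2 z *ᵥ f z ∂(mu2 a b c d) := by
  have i1 := integrable_mulVec (hA.mem0.const_mul M0) hf
  have m2 : MatMemLp (fun z : ℝ × ℝ => M1 z.1 * A.A1d z) 2 (mu2 a b c d) :=
    (matMemLp_fst h1).mul hA.mem1d
  have i2 := integrable_mulVec m2 hf
  have i3 := matInt_mul_fubini h1 hA.mem1k hf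
  have m4 : MatMemLp (fun z : ℝ × ℝ => M2 z.2 * A.A2d z) 2 (mu2 a b c d) :=
    (matMemLp_snd h2).mul hA.mem2d
  have i4 := integrable_mulVec m4 hf
  have i5 := matInt_mul_fubini h2 hA.mem2k hf
  simp only [row, Matrix.add_mulVec]
  refine ⟨(((i1.add i2).add i3.1).add i4).add i5.1, ?_⟩
  have e1 : MemLp (fun x => ∫ y, A.A1d (x, y) *ᵥ f (x, y) ∂(mu1 c d)) 2 (mu1 a b) :=
    memLp_slice_integral (hA.mem1d.mulVec hf)
  have e2 : MemLp (fun y => ∫ x, A.A2d (x, y) *ᵥ f (x, y) ∂(mu1 a b)) 2 (mu1 c d) :=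
    memLp_slice_integral' (hA.mem2d.mulVec hf)
  have e3 := hA.mem1k.hs hf
  have e4 := hA.mem2k.hs hf
  simp only [app, Matrix.mulVec_add]
  rw [integral_add (integrable_mulVec h1 e1) (integrable_mulVec h1 e3),
    integral_add (integrable_mulVec h2 e2) (integrable_mulVec h2 e4),
    mulVec_integral _ (integrable_mulVec hA.mem0 hf), fubini_partial h1 hA.mem1d hf,
    fubini_partial' h2 hA.mem2d hf, ← i3.2, ← i5.2]
  have s1 := integral_add (((i1.add i2).add i3.1).add i4) i5.1
  have s2 := integral_add ((i1.add i2).add i3.1) i4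
  have s3 := integral_add (i1.add i2) i3.1
  have s4 := integral_add i1 i2
  simp only [Pi.add_apply] at s1 s2 s3 s4
  rw [s1, s2, s3, s4]
  simp only [Matrix.mulVec_mulVec]
  abel

/-- Square integrability of a family of composed kernels. -/
lemma Mem.row_mem {α : Type} [MeasurableSpace α] {μ : Measure α} [IsFiniteMeasure μ]
    {M0 : α → Matrix q₀ p₀ ℝ} {M1 M2 : α → ℝ → Matrix q₀ p₁ ℝ} (h0 : MatMemLp M0 2 μ)
    (h1 : MatMemLp (fun p : α × ℝ => M1 p.1 p.2) 2 (μ.prod (mu1 a b)))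
    (h2 : MatMemLp (fun p : α × ℝ => M2 p.1 p.2) 2 (μ.prod (mu1 c d))) :
    MatMemLp (fun p : α × (ℝ × ℝ) => A.row a b c d (M0 p.1) (M1 p.1) (M2 p.1) p.2) 2
      (μ.prod (mu2 a b c d)) := by
  have g1 : MatMemLp (fun p : α × (ℝ × ℝ) => M1 p.1 p.2.1) 2 (μ.prod (mu2 a b c d)) := by
    have h := (h1.fst (ν := mu1 c d))
    rw [mu2_eq_prod]
    exact fun i j => (h i j).comp_measurePreserving
      (measurePreserving_prodAssoc μ (mu1 a b) (mu1 c d)).symm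
  have g2 : MatMemLp (fun p : α × (ℝ × ℝ) => M2 p.1 p.2.2) 2 (μ.prod (mu2 a b c d)) := by
    have h := (h2.fst (ν := mu1 a b))
    have h' : MatMemLp (fun p : α × (ℝ × ℝ) => M2 p.1 p.2.1) 2
        (μ.prod ((mu1 c d).prod (mu1 a b))) := fun i j => (h i j).comp_measurePreserving
      (measurePreserving_prodAssoc μ (mu1 c d) (mu1 a b)).symm
    rw [mu2_eq_prod]
    exact fun i j => (h' i j).comp_measurePreserving
      ((MeasurePreserving.id μ).prod Measure.measurePreserving_swap)
  have d1 : MatMemLp (fun p : α × (ℝ × ℝ) => A.A1d p.2) ∞ (μ.prod (mu2 a b c d)) := hA.mem1d.snd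
  have d2 : MatMemLp (fun p : α × (ℝ × ℝ) => A.A2d p.2) ∞ (μ.prod (mu2 a b c d)) := hA.mem2d.snd
  exact ((((h0.tensor hA.mem0).add (g1.mul d1)).add (h1.hs_comp hA.mem1k)).add
    (g2.mul d2)).add (h2.hs_comp hA.mem2k)

/-- A fixed functional is a family over a one-point probability space, which reduces this to
`Mem.row_mem`. -/
lemma Mem.row_mem_const {M0 : Matrix q₀ p₀ ℝ} {M1 M2 : ℝ → Matrix q₀ p₁ ℝ}
    (h1 : MatMemLp M1 2 (mu1 a b)) (h2 : MatMemLp M2 2 (mu1 c d)) :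
    MatMemLp (A.row a b c d M0 M1 M2) 2 (mu2 a b c d) := by
  have g1 : MatMemLp (fun p : Unit × ℝ => M1 p.2) 2 ((Measure.dirac ()).prod (mu1 a b)) := h1.snd
  have g2 : MatMemLp (fun p : Unit × ℝ => M2 p.2) 2 ((Measure.dirac ()).prod (mu1 c d)) := h2.snd
  have h : MatMemLp (fun p : Unit × (ℝ × ℝ) => A.row a b c d M0 M1 M2 p.2) 2
      ((Measure.dirac ()).prod (mu2 a b c d)) :=
    hA.row_mem (M0 := fun _ => M0) (M1 := fun _ => M1) (M2 := fun _ => M2)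
      (matMemLp_const 2 M0) g1 g2
  have hmp : MeasurePreserving (Prod.mk ()) (mu2 a b c d)
      ((Measure.dirac ()).prod (mu2 a b c d)) :=
    ⟨measurable_prodMk_left, (Measure.dirac_prod ()).symm⟩
  intro i j
  have := (h i j).comp_measurePreserving hmp
  exact this

variable {N : Param011 q₀ q₁ p₀ p₁} (hN : N.Mem a b c d)
include hN

lemma Mem.comp_mem : (A.comp a b c d N).Mem a b c d where
  mem0 := hA.row_mem_const hN.mem01 hN.mem02
  mem1d := (matMemLp_fst hN.mem11_0).mul hA.mem1d
  mem1k := (hN.mem11_0.fst.mul hA.mem1k).add (hA.row_mem hN.mem10 hN.ker11 hN.ker12)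
  mem2d := (matMemLp_snd hN.mem22_0).mul hA.mem2d
  mem2k := (hN.mem22_0.fst.mul hA.mem2k).add
    (hA.row_mem (M1 := fun y x => N.N21 x y) hN.mem20 hN.ker21 hN.ker22)

/-- A multiplier preserves the two types of kernel: integration along one line stays partial, and
integration over the rectangle stays full. The integral terms of `N` turn both types into full
kernels, collected in `row` by Fubini. -/
lemma Mem.comp_app (hf : MemLp f 2 (mu2 a b c d)) :
    RL.Eq a b c d (PSep a b c d N (A.app a b c d f)) ((A.comp a b c d N).app a b c d f) := by
  refine ⟨(hA.row_apply hf _ hN.mem01 hN.mem02).2, ?_, ?_⟩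
  · filter_upwards [hN.ker11.ae_right, hN.ker12.ae_right, hA.mem1k.ae_right,
      ae_slice_x_pi (hA.mem1d.mulVec hf : MemLp _ 2 _)] with x h1 h2 h3 h4
    obtain ⟨i1, e1⟩ := hA.row_apply hf (N.N10 x) h1 h2
    have i2 := integrable_mulVec (h3.const_mul (N.N11_0 x)) hf
    have e2 : (∫ y, ((A.comp a b c d N).A1d (x, y)) *ᵥ f (x, y) ∂(mu1 c d))
        = N.N11_0 x *ᵥ ∫ y, A.A1d (x, y) *ᵥ f (x, y) ∂(mu1 c d) := by
      rw [mulVec_integral _ (h4.integrable (by norm_num))]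
      simp only [comp, Matrix.mulVec_mulVec]
    have e3 : (∫ z, ((A.comp a b c d N).A1k x z) *ᵥ f z ∂(mu2 a b c d))
        = N.N11_0 x *ᵥ (∫ z, A.A1k x z *ᵥ f z ∂(mu2 a b c d))
          + ∫ z, A.row a b c d (N.N10 x) (N.N11_1 x) (N.N12 x) z *ᵥ f z ∂(mu2 a b c d) := by
      rw [mulVec_integral _ (integrable_mulVec h3 hf)]
      simp only [comp, Matrix.add_mulVec, Matrix.mulVec_mulVec]
      exact integral_add i2 i1
    change _ = _ + _
    rw [e2, e3, ← e1]
    simp only [PSep, app, Matrix.mulVec_add]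
    abel
  · filter_upwards [hN.ker21.ae_right, hN.ker22.ae_right, hA.mem2k.ae_right,
      ae_slice_y_pi (hA.mem2d.mulVec hf : MemLp _ 2 _)] with y h1 h2 h3 h4
    obtain ⟨i1, e1⟩ := hA.row_apply hf (N.N20 y) (M1 := fun x => N.N21 x y) h1 h2
    have i2 := integrable_mulVec (h3.const_mul (N.N22_0 y)) hf
    have e2 : (∫ x, ((A.comp a b c d N).A2d (x, y)) *ᵥ f (x, y) ∂(mu1 a b))
        = N.N22_0 y *ᵥ ∫ x, A.A2d (x, y) *ᵥ f (x, y) ∂(mu1 a b) := by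
      rw [mulVec_integral _ (h4.integrable (by norm_num))]
      simp only [comp, Matrix.mulVec_mulVec]
    have e3 : (∫ z, ((A.comp a b c d N).A2k y z) *ᵥ f z ∂(mu2 a b c d))
        = N.N22_0 y *ᵥ (∫ z, A.A2k y z *ᵥ f z ∂(mu2 a b c d))
          + ∫ z, A.row a b c d (N.N20 y) (fun x => N.N21 x y) (N.N22_1 y) z *ᵥ f z
            ∂(mu2 a b c d) := by
      rw [mulVec_integral _ (integrable_mulVec h3 hf)]
      simp only [comp, Matrix.add_mulVec, Matrix.mulVec_mulVec]
      exact integral_add i2 i1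
    change _ = _ + _
    rw [e2, e3, ← e1]
    simp only [PSep, app, Matrix.mulVec_add]
    abel

end Ker

end Kernels

/-! ### Splitting the rectangle at a point. -/

section Quadrants

variable {a b c d x y : ℝ} {E : Type*} [NormedAddCommGroup E] [NormedSpace ℝ E]

lemma mu1_mono {s t : ℝ} (h1 : a ≤ s) (h2 : t ≤ b) : mu1 s t ≤ mu1 a b :=
  Measure.restrict_mono (Icc_subset_Icc h1 h2) le_rfl

lemma mu2_mono {s t s' t' : ℝ} (h1 : a ≤ s) (h2 : t ≤ b) (h3 : c ≤ s') (h4 : t' ≤ d) :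
    mu2 s t s' t' ≤ mu2 a b c d :=
  Measure.restrict_mono (prod_mono (Icc_subset_Icc h1 h2) (Icc_subset_Icc h3 h4)) le_rfl

lemma integral_indicator_Iic (g : ℝ → E) (hx : x ∈ Icc a b) :
    ∫ t, (Iic x).indicator g t ∂(mu1 a b) = ∫ t, g t ∂(mu1 a x) := by
  rw [integral_indicator measurableSet_Iic, mu1, mu1, Measure.restrict_restrict measurableSet_Iic]
  congr 2
  ext z
  simp only [mem_Icc, mem_inter_iff, mem_Iic]
  exact ⟨fun h => ⟨h.2.1, h.1⟩, fun h => ⟨h.2, h.1, h.2.trans hx.2⟩⟩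

lemma integral_quadrants {g : ℝ × ℝ → E} (hg : Integrable g (mu2 a b c d)) (hx : x ∈ Icc a b)
    (hy : y ∈ Icc c d) :
    ∫ z, g z ∂(mu2 a b c d) = (∫ θ in a..x, ∫ ν in c..y, g (θ, ν))
      + (∫ θ in x..b, ∫ ν in c..y, g (θ, ν)) + (∫ θ in a..x, ∫ ν in y..d, g (θ, ν))
      + ∫ θ in x..b, ∫ ν in y..d, g (θ, ν) := by
  have h1 : Integrable (fun θ => ∫ ν in c..y, g (θ, ν)) (mu1 a b) := by
    have := hg.mono_measure (mu2_mono (le_refl a) (le_refl b) (le_refl c) hy.2)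
    rw [mu2_eq_prod] at this
    simp only [intervalIntegral_eq_mu1 hy.1]
    exact this.integral_prod_left
  have h2 : Integrable (fun θ => ∫ ν in y..d, g (θ, ν)) (mu1 a b) := by
    have := hg.mono_measure (mu2_mono (le_refl a) (le_refl b) hy.1 (le_refl d))
    rw [mu2_eq_prod] at this
    simp only [intervalIntegral_eq_mu1 hy.2]
    exact this.integral_prod_left
  rw [intervalIntegral_add_mu1 h1 hx, add_assoc, intervalIntegral_add_mu1 h2 hx,
    ← integral_add h1 h2]
  rw [mu2_eq_prod] at hg ⊢
  rw [integral_prod _ hg]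
  refine integral_congr_ae ?_
  filter_upwards [hg.prod_right_ae] with θ hθ
  exact (intervalIntegral_add_mu1 hθ hy).symm

lemma integral_quadrant_congr {F G : ℝ → ℝ → E} {s t s' t' : ℝ} (hst : s ≤ t) (hst' : s' ≤ t')
    (h : ∀ θ ∈ Ioc s t, ∀ ν ∈ Ioc s' t', F θ ν = G θ ν) :
    ∫ θ in s..t, ∫ ν in s'..t', F θ ν = ∫ θ in s..t, ∫ ν in s'..t', G θ ν := by
  refine intervalIntegral.integral_congr_ae (.of_forall fun θ hθ => ?_)
  refine intervalIntegral.integral_congr_ae (.of_forall fun ν hν => ?_)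
  rw [uIoc_of_le hst] at hθ
  rw [uIoc_of_le hst'] at hν
  exact h θ hθ ν hν

end Quadrants

/-! ### The integral formula with the `K` kernels. -/

section SolutionFormula

variable {a b c d : ℝ} {n₀ n₁ n₂ : ℕ}

lemma matMemLp_K31 (x y : ℝ) (p : ℝ≥0∞) :
    MatMemLp (fun θ => K31 c n₀ n₁ n₂ x y θ) p (mu1 a b) := by
  intro i j
  refine memLp_mu1_of_continuous ?_
  rcases i with i | i | i <;> rcases j with j | ⟨k, j⟩ <;>
    simp only [K31, fromRows_apply_inl, fromRows_apply_inr, fromBlocks_apply₁₁, fromBlocks_apply₁₂,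
      fromBlocks_apply₂₁, fromBlocks_apply₂₂, Matrix.zero_apply, continuous_const, rowI, of_apply]
  fin_cases k <;> split_ifs <;> (try simp) <;> fun_prop

lemma matMemLp_K32 (x y : ℝ) (p : ℝ≥0∞) :
    MatMemLp (fun ν => K32 a n₀ n₁ n₂ x y ν) p (mu1 c d) := by
  intro i j
  refine memLp_mu1_of_continuous ?_
  rcases i with i | i | i <;> rcases j with j | ⟨k, j⟩ <;>
    simp only [K32, fromRows_apply_inl, fromRows_apply_inr, fromBlocks_apply₁₁, fromBlocks_apply₁₂,
      fromBlocks_apply₂₁, fromBlocks_apply₂₂, Matrix.zero_apply, continuous_const, rowI, of_apply]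
  fin_cases k <;> split_ifs <;> (try simp) <;> fun_prop

lemma matMemLp_K33 (x y : ℝ) (p : ℝ≥0∞) :
    MatMemLp (fun z : ℝ × ℝ => K33 n₀ n₁ n₂ x y z.1 z.2) p (mu2 a b c d) := by
  intro i j
  refine memLp_mu2_of_continuous ?_
  rcases i with i | i | i <;> rcases j with j | j | j <;>
    simp only [K33, fromBlocks_apply₁₁, fromBlocks_apply₁₂,
      fromBlocks_apply₂₁, fromBlocks_apply₂₂, Matrix.zero_apply, continuous_const, Matrix.smul_apply]
  fun_prop

variable {w : RL (Core0 n₁ n₂) (Core1 n₁ n₂)} {f : ℝ × ℝ → State n₀ n₁ n₂ → ℝ}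

/-- The upper right corner suffices: a point (x, y) is that corner of `[a, x] × [c, y]`, and `Sol`
depends only on the base corner (a, c). -/
lemma Sol_corner (hab : a ≤ b) (hcd : c ≤ d) (hw : RL.Mem a b c d w)
    (hf : MemLp f 2 (mu2 a b c d)) :
    Sol a c w f (b, d) = (fromBlocks 1 0 0 0 : Matrix (State n₀ n₁ n₂) (State n₀ n₁ n₂) ℝ) *ᵥ f (b, d)
      + K30 a c n₀ n₁ n₂ b d *ᵥ w.1 + (∫ θ, K31 c n₀ n₁ n₂ b d θ *ᵥ w.2.1 θ ∂(mu1 a b))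
      + (∫ ν, K32 a n₀ n₁ n₂ b d ν *ᵥ w.2.2 ν ∂(mu1 c d))
      + ∫ z, K33 n₀ n₁ n₂ b d z.1 z.2 *ᵥ f z ∂(mu2 a b c d) := by
  have hβ := fun i => memLp_pi_iff.1 hw.1 i
  have hγ := fun i => memLp_pi_iff.1 hw.2 i
  have hr := fun i => memLp_pi_iff.1 hf i
  have iβ' : ∀ i, Integrable (fun x => (b - x) * w.2.1 x i) (mu1 a b) := fun i =>
    integrable_of_memLp_two ((hβ i).mul (memLp_mu1_of_continuous (p := ∞) (by fun_prop)))
  have iγ' : ∀ i, Integrable (fun y => (d - y) * w.2.2 y i) (mu1 c d) := fun i =>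
    integrable_of_memLp_two ((hγ i).mul (memLp_mu1_of_continuous (p := ∞) (by fun_prop)))
  ext i
  simp only [Pi.add_apply]
  rw [integral_mulVec_apply (matMemLp_K31 b d 2) hw.1,
    integral_mulVec_apply (matMemLp_K32 b d 2) hw.2, integral_mulVec_apply (matMemLp_K33 b d 2) hf]
  rcases i with i | i | i
  · simp [Sol, K30, K31, K32, K33, fromBlocks_mulVec, fromRows_mulVec]
  · simp only [Sol, K30, K31, K32, K33, fromBlocks_mulVec, fromRows_mulVec, Sum.elim_inl,
      Sum.elim_inr, Matrix.zero_mulVec, Pi.zero_apply, Matrix.one_mulVec, add_zero, zero_add, Function.comp_apply]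
    rw [S1_corner hab hcd (hr _)]
  · simp only [Sol, K30, K31, K32, K33, fromBlocks_mulVec, fromRows_mulVec,
      Sum.elim_inr, Matrix.zero_mulVec, Pi.zero_apply, Matrix.one_mulVec, Matrix.smul_mulVec,
      rowI_mulVec, Pi.smul_apply, smul_eq_mul, Fin.sum_univ_four, Fin.sum_univ_two, add_zero, zero_add, Function.comp_apply]
    rw [S2, S1_corner hab hcd (memLp_S1 _ (hβ _) (hγ _) (hr _)),
      integral_const_add_primitive hab _ (hβ _), integral_const_add_primitive hcd _ (hγ _),
      integral_S1 hab hcd _ (hβ _) (hγ _) (hr _)]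
    simp [integral_add, Integrable.const_mul, iβ', iγ', mul_assoc, integral_const_mul]
    simp only [mul_left_comm (b - _ : ℝ) (d - _)]
    ring

lemma RL.Mem.mono {p₀ p₁ : Type} [Fintype p₁] {v : RL p₀ p₁} (hv : RL.Mem a b c d v) {x y : ℝ}
    (hx : x ≤ b) (hy : y ≤ d) : RL.Mem a x c y v :=
  ⟨hv.1.mono_measure (mu1_mono le_rfl hx), hv.2.mono_measure (mu1_mono le_rfl hy)⟩

end SolutionFormula

/-! ### Identification of the kernels `F`, `G` and `T`. -/

section TOperator

variable {a b c d : ℝ} {n₀ n₁ n₂ : ℕ} (B : BParam n₁ n₂) (Ehat : CoreParam n₁ n₂)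

/-- The kernels of `H3`. -/
def H3Ker (b d : ℝ) (n₀ n₁ n₂ : ℕ) : Ker (Full0 n₁ n₂) (Full1 n₁ n₂) (State n₀ n₁ n₂) where
  A0 z := H03 b d n₀ n₁ n₂ z.1 z.2
  A1d z := H13 d n₀ n₁ n₂ z.2
  A1k := 0
  A2d z := H23 b n₀ n₁ n₂ z.1
  A2k := 0

lemma H3Ker_mem : (H3Ker b d n₀ n₁ n₂).Mem a b c d where
  mem0 := matMemLp_H03
  mem1d i j := memLp_mu2_of_continuous ((continuous_H13_apply d n₀ n₁ n₂ i j).comp continuous_snd)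
  mem1k _ _ := MemLp.zero
  mem2d i j := memLp_mu2_of_continuous ((continuous_H23_apply b n₀ n₁ n₂ i j).comp continuous_fst)
  mem2k _ _ := MemLp.zero

lemma H3Ker_app (f : ℝ × ℝ → State n₀ n₁ n₂ → ℝ) :
    (H3Ker b d n₀ n₁ n₂).app a b c d f = H3 a b c d f := by
  simp [Ker.app, H3Ker, H3]

/-- The kernels `G` of the operator mapping highest derivatives to core boundary values. -/
def GKer (a b c d : ℝ) (n₀ : ℕ) {n₁ n₂ : ℕ} (B : BParam n₁ n₂) (Ehat : CoreParam n₁ n₂) :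
    Ker (Core0 n₁ n₂) (Core1 n₁ n₂) (State n₀ n₁ n₂) where
  A0 z := G0 a b c d n₀ B Ehat z.1 z.2
  A1d z := G1_0 d n₀ B Ehat z.1 z.2
  A1k x z := G1_1 a b c d n₀ B Ehat x z.2 z.1
  A2d z := G2_0 b n₀ B Ehat z.1 z.2
  A2k y z := G2_1 a b c d n₀ B Ehat z.1 y z.2

lemma matInt_zero {α l m : Type*} [MeasurableSpace α] (μ : Measure α) :
    matInt μ (fun _ => (0 : Matrix l m ℝ)) = 0 := by
  ext; simp [matInt]

/-- `ℋ₃` has no full kernels in its function components, so the matrix integrals in the composition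
rule drop out. What remains is the definition of `F`. -/
lemma H3Ker_comp : (H3Ker b d n₀ n₁ n₂).comp a b c d B =
    ⟨fun z => F0 b d n₀ B z.1 z.2, fun z => F1_0 d n₀ B z.1 z.2,
      fun x z => F1_1 b d n₀ B x z.2 z.1, fun z => F2_0 b n₀ B z.1 z.2,
      fun y z => F2_1 b d n₀ B z.1 y z.2⟩ := by
  have hrow : ∀ {q : Type} [Fintype q] (M0 : Matrix q (Full0 n₁ n₂) ℝ)
      (M1 M2 : ℝ → Matrix q (Full1 n₁ n₂) ℝ) (z : ℝ × ℝ),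
      (H3Ker b d n₀ n₁ n₂).row a b c d M0 M1 M2 z
        = M0 * H03 b d n₀ n₁ n₂ z.1 z.2 + M1 z.1 * H13 d n₀ n₁ n₂ z.2
          + M2 z.2 * H23 b n₀ n₁ n₂ z.1 := fun M0 M1 M2 z => by
    simp only [Ker.row, H3Ker, Pi.zero_apply, Matrix.mul_zero, matInt_zero, add_zero]
  refine Ker.ext (funext fun z => hrow _ _ _ z) rfl (funext₂ fun x z => ?_) rfl
    (funext₂ fun y z => ?_)
  · simp only [Ker.comp, hrow]
    simp only [H3Ker, Pi.zero_apply, Matrix.mul_zero, zero_add, F1_1]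
  · simp only [Ker.comp, hrow]
    simp only [H3Ker, Pi.zero_apply, Matrix.mul_zero, zero_add, F2_1]
    abel

/-- The lengthy formulas for `G` are the composition rule applied once more, now with all terms
present. -/
lemma H3Ker_comp_comp (hab : a ≤ b) (hcd : c ≤ d) :
    ((H3Ker b d n₀ n₁ n₂).comp a b c d B).comp a b c d Ehat = GKer a b c d n₀ B Ehat := by
  rw [H3Ker_comp]
  refine Ker.ext (funext fun z => ?_) rfl (funext₂ fun x z => ?_) rfl (funext₂ fun y z => ?_)
  · simp only [Ker.comp, Ker.row, GKer, G0, mInt_eq_matInt hab, mInt_eq_matInt hcd]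
  · simp only [Ker.comp, Ker.row, GKer, G1_1, mInt_eq_matInt hab, mInt_eq_matInt hcd]
    abel
  · simp only [Ker.comp, Ker.row, GKer, G2_1, mInt_eq_matInt hab, mInt_eq_matInt hcd]
    abel

variable {B Ehat}

lemma GKer_mem (hab : a ≤ b) (hcd : c ≤ d) (hB : B.Mem a b c d) (hE : Ehat.Mem a b c d) :
    (GKer a b c d n₀ B Ehat).Mem a b c d :=
  H3Ker_comp_comp (n₀ := n₀) B Ehat hab hcd ▸ (H3Ker_mem.comp_mem hB).comp_mem hE

lemma GKer_app (hab : a ≤ b) (hcd : c ≤ d) (hB : B.Mem a b c d) (hBs : B.Separable)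
    (hE : Ehat.Mem a b c d) (hEs : Ehat.Separable) {f : ℝ × ℝ → State n₀ n₁ n₂ → ℝ}
    (hf : MemLp f 2 (mu2 a b c d)) :
    RL.Eq a b c d (P011 a b c d Ehat (P011 a b c d B (H3 a b c d f)))
      ((GKer a b c d n₀ B Ehat).app a b c d f) := by
  have m0 : RL.Mem a b c d (H3 a b c d f) := H3Ker_app (a := a) (c := c) f ▸ H3Ker_mem.app_mem hf
  have m1 := (H3Ker_mem (n₀ := n₀)).comp_mem hB
  have e1 : RL.Eq a b c d (P011 a b c d B (H3 a b c d f))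
      (((H3Ker b d n₀ n₁ n₂).comp a b c d B).app a b c d f) :=
    (P011_eq_PSep hab hcd hB hBs m0).trans
      (H3Ker_app (a := a) (c := c) f ▸ H3Ker_mem.comp_app hB hf)
  rw [← H3Ker_comp_comp B Ehat hab hcd]
  exact (P011_congr hab hcd _ e1).trans
    ((P011_eq_PSep hab hcd hE hEs (m1.app_mem hf)).trans (m1.comp_app hE hf))

lemma matInt_indicator {l m k : Type} [Fintype m] {x : ℝ} (hx : x ∈ Icc a b)
    (K : ℝ → Matrix l m ℝ) (G : ℝ → Matrix m k ℝ) :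
    matInt (mu1 a b) (fun t => (Iic x).indicator K t * G t) = mInt a x fun t => K t * G t := by
  have h : ∀ t, (Iic x).indicator K t * G t = (Iic x).indicator (fun t => K t * G t) t := fun t => by
    by_cases ht : t ∈ Iic x <;> simp [ht]
  simp only [h]
  ext i j
  rw [mInt_eq_matInt hx.1]
  simp only [matInt, of_apply]
  rw [← integral_indicator_Iic _ hx]
  refine integral_congr_ae (.of_forall fun t => ?_)
  by_cases ht : t ∈ Iic x <;> simp [ht]

/-- The kernel of the solution operator on the whole rectangle. -/
def TKer (a b c d : ℝ) (n₀ : ℕ) {n₁ n₂ : ℕ} (B : BParam n₁ n₂) (Ehat : CoreParam n₁ n₂) (x y : ℝ)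
    (z : ℝ × ℝ) : Matrix (State n₀ n₁ n₂) (State n₀ n₁ n₂) ℝ :=
  (Iic x ×ˢ Iic y).indicator (fun z => K33 n₀ n₁ n₂ x y z.1 z.2) z
    - (GKer a b c d n₀ B Ehat).row a b c d (K30 a c n₀ n₁ n₂ x y)
      ((Iic x).indicator fun θ => K31 c n₀ n₁ n₂ x y θ)
      ((Iic y).indicator fun ν => K32 a n₀ n₁ n₂ x y ν) z

/-- The indicators encode that `K31`, `K32` and `K33` integrate only up to `x` and `y`. Inside each
quadrant they are constant, which is the source of the four kernels `T11`, `T21`, `T12`, `T22`. -/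
lemma TKer_eq {x y : ℝ} (hx : x ∈ Icc a b) (hy : y ∈ Icc c d) (θ ν : ℝ) :
    TKer a b c d n₀ B Ehat x y (θ, ν)
      = (if θ ≤ x ∧ ν ≤ y then K33 n₀ n₁ n₂ x y θ ν else 0) + T22 a b c d n₀ B Ehat x y θ ν
        - (if θ ≤ x then K31 c n₀ n₁ n₂ x y θ else 0) * G1_0 d n₀ B Ehat θ ν
        - (if ν ≤ y then K32 a n₀ n₁ n₂ x y ν else 0) * G2_0 b n₀ B Ehat θ ν := by
  simp only [TKer, Ker.row, matInt_indicator hx, matInt_indicator hy, T22, GKer]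
  simp only [indicator_apply, mem_prod, mem_Iic]
  abel

lemma indicator_mulVec {α l m : Type} [Fintype m] (s : Set α) (K : α → Matrix l m ℝ)
    (v : α → m → ℝ) (t : α) : s.indicator K t *ᵥ v t = s.indicator (fun t => K t *ᵥ v t) t := by
  by_cases ht : t ∈ s <;> simp [ht]

lemma MatMemLp.indicator {α l m : Type} [Fintype l] [Fintype m] [MeasurableSpace α] {μ : Measure α}
    {p : ℝ≥0∞} {K : α → Matrix l m ℝ} (hK : MatMemLp K p μ) {s : Set α} (hs : MeasurableSet s) :
    MatMemLp (s.indicator K) p μ := fun i j => by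
  have : (fun t => s.indicator K t i j) = s.indicator fun t => K t i j := by
    ext t
    by_cases ht : t ∈ s <;> simp [ht]
  rw [this]
  exact (hK i j).indicator hs

lemma Sol_eq_integral (hab : a ≤ b) (hcd : c ≤ d) (hB : B.Mem a b c d) (hE : Ehat.Mem a b c d)
    {f : ℝ × ℝ → State n₀ n₁ n₂ → ℝ} (hf : MemLp f 2 (mu2 a b c d)) {x y : ℝ}
    (hx : x ∈ Icc a b) (hy : y ∈ Icc c d) :
    Integrable (fun z => TKer a b c d n₀ B Ehat x y z *ᵥ f z) (mu2 a b c d) ∧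
    Sol a c (-(GKer a b c d n₀ B Ehat).app a b c d f) f (x, y)
      = (fromBlocks 1 0 0 0 : Matrix (State n₀ n₁ n₂) (State n₀ n₁ n₂) ℝ) *ᵥ f (x, y)
        + ∫ z, TKer a b c d n₀ B Ehat x y z *ᵥ f z ∂(mu2 a b c d) := by
  have hA : (GKer a b c d n₀ B Ehat).Mem a b c d := GKer_mem hab hcd hB hE
  have hv := hA.app_mem hf
  have h1 := (matMemLp_K31 (a := a) (b := b) (c := c) (n₀ := n₀) (n₁ := n₁) (n₂ := n₂)
    x y 2).indicator (measurableSet_Iic (a := x))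
  have h2 := (matMemLp_K32 (a := a) (c := c) (d := d) (n₀ := n₀) (n₁ := n₁) (n₂ := n₂)
    x y 2).indicator (measurableSet_Iic (a := y))
  obtain ⟨i1, e1⟩ := hA.row_apply hf (K30 a c n₀ n₁ n₂ x y) h1 h2
  have i2 := (integrable_mulVec (matMemLp_K33 x y 2) hf).indicator
    (measurableSet_Iic.prod measurableSet_Iic : MeasurableSet (Iic x ×ˢ Iic y))
  simp only [TKer, Matrix.sub_mulVec, indicator_mulVec]
  refine ⟨i2.sub i1, ?_⟩
  rw [integral_sub i2 i1, ← e1, integral_indicator_rect _ hx hy]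
  simp only [indicator_mulVec]
  rw [integral_indicator_Iic _ hx, integral_indicator_Iic _ hy]
  generalize (GKer a b c d n₀ B Ehat).app a b c d f = v at hv ⊢
  have hv' : RL.Mem a b c d (-v) := ⟨hv.1.neg, hv.2.neg⟩
  -- The formula is applied on `[a, x] × [c, y]`; the indicators have extended its integrals to the
  -- whole rectangle.
  rw [Sol_corner hx.1 hy.1 (hv'.mono hx.2 hy.2)
    (hf.mono_measure (mu2_mono le_rfl hx.2 le_rfl hy.2))]
  simp only [Prod.fst_neg, Prod.snd_neg, Pi.neg_apply, Matrix.mulVec_neg, integral_neg]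
  abel

/-- The 2D-PI operator `T` solves the boundary value problem. -/
lemma P2D_eq_Sol (hab : a ≤ b) (hcd : c ≤ d) (hB : B.Mem a b c d) (hE : Ehat.Mem a b c d)
    {f : ℝ × ℝ → State n₀ n₁ n₂ → ℝ} (hf : MemLp f 2 (mu2 a b c d)) {x y : ℝ}
    (hx : x ∈ Icc a b) (hy : y ∈ Icc c d) :
    P2D a b c d (TParam a b c d n₀ B Ehat) f (x, y)
      = Sol a c (-(GKer a b c d n₀ B Ehat).app a b c d f) f (x, y) := by
  obtain ⟨hg, e⟩ := Sol_eq_integral hab hcd hB hE hf hx hy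
  rw [e, integral_quadrants hg hx hy]
  -- In the lower left quadrant all indicators are one. `T21` and `T12` each contain `T22`, hence
  -- the subtraction of one copy in `T11`.
  have q11 := integral_quadrant_congr (F := fun θ ν => T11 a b c d n₀ B Ehat x y θ ν *ᵥ f (θ, ν))
    (G := fun θ ν => TKer a b c d n₀ B Ehat x y (θ, ν) *ᵥ f (θ, ν))
    hx.1 hy.1 fun θ hθ ν hν => by
      refine congrArg (· *ᵥ f (θ, ν)) (.trans ?_ (TKer_eq hx hy θ ν).symm)
      rw [if_pos ⟨hθ.2, hν.2⟩, if_pos hθ.2, if_pos hν.2]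
      simp only [T11, T12, T21]
      abel
  have q21 := integral_quadrant_congr (F := fun θ ν => T21 a b c d n₀ B Ehat x y θ ν *ᵥ f (θ, ν))
    (G := fun θ ν => TKer a b c d n₀ B Ehat x y (θ, ν) *ᵥ f (θ, ν))
    hx.2 hy.1 fun θ hθ ν hν => by
      refine congrArg (· *ᵥ f (θ, ν)) (.trans ?_ (TKer_eq hx hy θ ν).symm)
      rw [if_neg fun h => hθ.1.not_ge h.1, if_neg hθ.1.not_ge, if_pos hν.2]
      simp only [T21, Matrix.zero_mul]
      abel
  have q12 := integral_quadrant_congr (F := fun θ ν => T12 a b c d n₀ B Ehat x y θ ν *ᵥ f (θ, ν))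
    (G := fun θ ν => TKer a b c d n₀ B Ehat x y (θ, ν) *ᵥ f (θ, ν))
    hx.1 hy.2 fun θ hθ ν hν => by
      refine congrArg (· *ᵥ f (θ, ν)) (.trans ?_ (TKer_eq hx hy θ ν).symm)
      rw [if_neg fun h => hν.1.not_ge h.2, if_pos hθ.2, if_neg hν.1.not_ge]
      simp only [T12, Matrix.zero_mul]
      abel
  have q22 := integral_quadrant_congr (F := fun θ ν => T22 a b c d n₀ B Ehat x y θ ν *ᵥ f (θ, ν))
    (G := fun θ ν => TKer a b c d n₀ B Ehat x y (θ, ν) *ᵥ f (θ, ν))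
    hx.2 hy.2 fun θ hθ ν hν => by
      refine congrArg (· *ᵥ f (θ, ν)) (.trans ?_ (TKer_eq hx hy θ ν).symm)
      rw [if_neg fun h => hν.1.not_ge h.2, if_neg hθ.1.not_ge, if_neg hν.1.not_ge]
      simp only [Matrix.zero_mul]
      abel
  simp only [P2D, TParam, Pi.zero_apply, Matrix.zero_mulVec, intervalIntegral.integral_zero,
    add_zero]
  rw [q11, q21, q12, q22]
  simp only [add_assoc]

end TOperator

/-! ### The operator on `L₂` and its range. -/

section Unitary

variable {a b c d : ℝ} {n₀ n₁ n₂ : ℕ}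

/-- The core functions enter `Sol` only under integrals, so almost everywhere equal core data give
equal values at every point of the rectangle. -/
lemma Sol_congr {w w' : RL (Core0 n₁ n₂) (Core1 n₁ n₂)} {f : ℝ × ℝ → State n₀ n₁ n₂ → ℝ}
    (hw : RL.Mem a b c d w) (hf : MemLp f 2 (mu2 a b c d)) (h : RL.Eq a b c d w w')
    {x y : ℝ} (hx : x ∈ Icc a b) (hy : y ∈ Icc c d) :
    Sol a c w f (x, y) = Sol a c w' f (x, y) := by
  have hf' : MemLp f 2 (mu2 a x c y) := hf.mono_measure (mu2_mono le_rfl hx.2 le_rfl hy.2)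
  rw [Sol_corner hx.1 hy.1 (hw.mono hx.2 hy.2) hf',
    Sol_corner hx.1 hy.1 ((hw.congr h).mono hx.2 hy.2) hf', h.1]
  have e1 : ∫ θ, K31 c n₀ n₁ n₂ x y θ *ᵥ w.2.1 θ ∂(mu1 a x)
      = ∫ θ, K31 c n₀ n₁ n₂ x y θ *ᵥ w'.2.1 θ ∂(mu1 a x) :=
    integral_congr_ae ((h.2.1.filter_mono (ae_mono (mu1_mono le_rfl hx.2))).mono fun t ht => by
      simp only [ht])
  have e2 : ∫ ν, K32 a n₀ n₁ n₂ x y ν *ᵥ w.2.2 ν ∂(mu1 c y)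
      = ∫ ν, K32 a n₀ n₁ n₂ x y ν *ᵥ w'.2.2 ν ∂(mu1 c y) :=
    integral_congr_ae ((h.2.2.filter_mono (ae_mono (mu1_mono le_rfl hy.2))).mono fun t ht => by
      simp only [ht])
  rw [e1, e2]

/-- The values of an element of `L₂`. -/
def vals (u : L2 a b c d n₀ n₁ n₂) (z : ℝ × ℝ) : State n₀ n₁ n₂ → ℝ := (u z).ofLp

lemma memLp_vals (u : L2 a b c d n₀ n₁ n₂) : MemLp (vals u) 2 (mu2 a b c d) :=
  memLp_pi_iff.2 (memLp_piLp_iff.1 (Lp.memLp u))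

lemma memLp_toLp {f : ℝ × ℝ → State n₀ n₁ n₂ → ℝ} (hf : MemLp f 2 (mu2 a b c d)) :
    MemLp (fun z => (WithLp.toLp 2 (f z) : EuclideanSpace ℝ (State n₀ n₁ n₂))) 2 (mu2 a b c d) :=
  memLp_piLp_iff.2 (memLp_pi_iff.1 hf)

/-- The element of `L₂` with the given values. -/
def ofVals {f : ℝ × ℝ → State n₀ n₁ n₂ → ℝ} (hf : MemLp f 2 (mu2 a b c d)) :
    L2 a b c d n₀ n₁ n₂ := (memLp_toLp hf).toLp

lemma vals_ofVals {f : ℝ × ℝ → State n₀ n₁ n₂ → ℝ} (hf : MemLp f 2 (mu2 a b c d)) :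
    vals (ofVals hf) =ᵐ[mu2 a b c d] f := by
  filter_upwards [(memLp_toLp hf).coeFn_toLp] with z hz
  rw [vals, ofVals, hz]

lemma L2_ext {u v : L2 a b c d n₀ n₁ n₂} (h : vals u =ᵐ[mu2 a b c d] vals v) : u = v :=
  Lp.ext (h.mono fun _ hz => WithLp.ofLp_injective 2 hz)

lemma vals_add (u v : L2 a b c d n₀ n₁ n₂) :
    vals (u + v) =ᵐ[mu2 a b c d] fun z => vals u z + vals v z := by
  filter_upwards [Lp.coeFn_add u v] with z hz
  rw [vals, hz]; rfl

lemma vals_smul (s : ℝ) (u : L2 a b c d n₀ n₁ n₂) :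
    vals (s • u) =ᵐ[mu2 a b c d] fun z => s • vals u z := by
  filter_upwards [Lp.coeFn_smul s u] with z hz
  rw [vals, hz]; rfl

lemma IsD.unique {u p p' : L2 a b c d n₀ n₁ n₂} (h : IsD u p) (h' : IsD u p') : p = p' := by
  have hi := fun (q : L2 a b c d n₀ n₁ n₂) i =>
    integrable_of_memLp_two (memLp_pi_iff.1 (memLp_vals q) i)
  have h1 := fun i => (hasWeakDeriv_iff.1 h.2.1 i).unique (hasWeakDeriv_iff.1 h'.2.1 i)
    (hi p _) (hi p' _)
  have h2 := fun i => (hasWeakDeriv_iff.1 h.2.2 i).unique (hasWeakDeriv_iff.1 h'.2.2 i)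
    (hi p _) (hi p' _)
  refine L2_ext ?_
  filter_upwards [h.1, h'.1, ae_all_iff.2 h1, ae_all_iff.2 h2] with z h3 h4 h5 h6
  ext (i | i | i)
  exacts [(congrFun h3 i).trans (congrFun h4 i).symm, h5 i, h6 i]

lemma Dop_eq {u p : L2 a b c d n₀ n₁ n₂} (h : IsD u p) : Dop u = p := by
  have h' : ∃ p, IsD u p := ⟨p, h⟩
  rw [Dop, dif_pos h']
  exact h'.choose_spec.unique h

variable {B : BParam n₁ n₂} {Ehat : CoreParam n₁ n₂}

/-- The core boundary values of the solution with highest derivatives `f`. -/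
def core (a b c d : ℝ) (B : BParam n₁ n₂) (Ehat : CoreParam n₁ n₂)
    (f : ℝ × ℝ → State n₀ n₁ n₂ → ℝ) : RL (Core0 n₁ n₂) (Core1 n₁ n₂) :=
  -(GKer a b c d n₀ B Ehat).app a b c d f

section

variable (hab : a < b) (hcd : c < d) (hB : B.Mem a b c d) (hE : Ehat.Mem a b c d)
include hab hcd hB hE

lemma core_mem {f : ℝ × ℝ → State n₀ n₁ n₂ → ℝ} (hf : MemLp f 2 (mu2 a b c d)) :
    RL.Mem a b c d (core a b c d B Ehat f) :=
  have h := (GKer_mem hab.le hcd.le hB hE).app_mem hf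
  ⟨h.1.neg, h.2.neg⟩

lemma memLp_Sol_core {f : ℝ × ℝ → State n₀ n₁ n₂ → ℝ} (hf : MemLp f 2 (mu2 a b c d)) :
    MemLp (Sol a c (core a b c d B Ehat f) f) 2 (mu2 a b c d) :=
  memLp_Sol (core_mem hab hcd hB hE hf) hf

/-- This makes the operator well defined on classes: beyond the pointwise `u₀` component, `f` enters
only under integrals. -/
lemma Sol_core_congr {f g : ℝ × ℝ → State n₀ n₁ n₂ → ℝ} (hf : MemLp f 2 (mu2 a b c d))
    (hg : MemLp g 2 (mu2 a b c d)) (h : f =ᵐ[mu2 a b c d] g) :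
    Sol a c (core a b c d B Ehat f) f =ᵐ[mu2 a b c d] Sol a c (core a b c d B Ehat g) g := by
  filter_upwards [h, ae_mem_rect a b c d] with ⟨x, y⟩ hz hr
  rw [core, core, (Sol_eq_integral hab.le hcd.le hB hE hf hr.1 hr.2).2,
    (Sol_eq_integral hab.le hcd.le hB hE hg hr.1 hr.2).2, hz]
  congr 1
  exact integral_congr_ae (h.mono fun t ht => by simp only [ht])

/-- The operator `T`. -/
def TOp : L2 a b c d n₀ n₁ n₂ →ₗ[ℝ] L2 a b c d n₀ n₁ n₂ where
  toFun u := ofVals (memLp_Sol_core hab hcd hB hE (memLp_vals u))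
  map_add' u v := by
    refine L2_ext ?_
    have hu := memLp_vals u
    have hv := memLp_vals v
    filter_upwards [vals_ofVals (memLp_Sol_core hab hcd hB hE (memLp_vals (u + v))),
      vals_add (ofVals (memLp_Sol_core hab hcd hB hE hu))
        (ofVals (memLp_Sol_core hab hcd hB hE hv)),
      vals_ofVals (memLp_Sol_core hab hcd hB hE hu), vals_ofVals (memLp_Sol_core hab hcd hB hE hv),
      Sol_core_congr hab hcd hB hE (memLp_vals (u + v)) (hu.add hv) (vals_add u v),
      ae_mem_rect a b c d] with ⟨x, y⟩ h1 h2 h3 h4 h5 hr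
    obtain ⟨iu, eu⟩ := Sol_eq_integral hab.le hcd.le hB hE hu hr.1 hr.2
    obtain ⟨iv, ev⟩ := Sol_eq_integral hab.le hcd.le hB hE hv hr.1 hr.2
    rw [h1, h2, h3, h4, h5, core, core, core, eu, ev,
      (Sol_eq_integral hab.le hcd.le hB hE (hu.add hv) hr.1 hr.2).2]
    simp only [Pi.add_apply, Matrix.mulVec_add]
    rw [integral_add iu iv]
    abel
  map_smul' s u := by
    refine L2_ext ?_
    have hu := memLp_vals u
    filter_upwards [vals_ofVals (memLp_Sol_core hab hcd hB hE (memLp_vals (s • u))),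
      vals_smul s (ofVals (memLp_Sol_core hab hcd hB hE hu)),
      vals_ofVals (memLp_Sol_core hab hcd hB hE hu),
      Sol_core_congr hab hcd hB hE (memLp_vals (s • u)) (hu.const_smul s) (vals_smul s u),
      ae_mem_rect a b c d] with ⟨x, y⟩ h1 h2 h3 h5 hr
    obtain ⟨iu, eu⟩ := Sol_eq_integral hab.le hcd.le hB hE hu hr.1 hr.2
    rw [RingHom.id_apply, h1, h2, h3, h5, core, core, eu,
      (Sol_eq_integral hab.le hcd.le hB hE (hu.const_smul s) hr.1 hr.2).2]
    simp only [Pi.smul_apply, Matrix.mulVec_smul]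
    rw [integral_smul, smul_add]

lemma vals_TOp (u : L2 a b c d n₀ n₁ n₂) : vals (TOp hab hcd hB hE u) =ᵐ[mu2 a b c d]
    Sol a c (core a b c d B Ehat (vals u)) (vals u) :=
  vals_ofVals (memLp_Sol_core hab hcd hB hE (memLp_vals u))

lemma TOp_eq_P2D (u : L2 a b c d n₀ n₁ n₂) {f : ℝ × ℝ → State n₀ n₁ n₂ → ℝ}
    (hf : f =ᵐ[mu2 a b c d] vals u) : vals (TOp hab hcd hB hE u) =ᵐ[mu2 a b c d]
      P2D a b c d (TParam a b c d n₀ B Ehat) f := by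
  have hf' := (memLp_vals u).ae_eq hf.symm
  filter_upwards [vals_TOp hab hcd hB hE u, ae_mem_rect a b c d,
    Sol_core_congr hab hcd hB hE (memLp_vals u) hf' hf.symm] with ⟨x, y⟩ h1 hr h2
  rw [h1, h2, P2D_eq_Sol hab.le hcd.le hB hE hf' hr.1 hr.2, core]

lemma isD_TOp (u : L2 a b c d n₀ n₁ n₂) : IsD (TOp hab hcd hB hE u) u := by
  have h := vals_TOp hab hcd hB hE u
  have hw := core_mem hab hcd hB hE (memLp_vals u)
  refine ⟨?_, hasWeakDeriv_S1_xy hab.le hcd.le hw (memLp_vals u) ?_,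
    (hasWeakDeriv_S2 hab.le hcd.le hw (memLp_vals u) ?_ le_rfl le_rfl).2⟩
  · filter_upwards [h] with z hz
    exact funext fun i => (congrFun hz (Sum.inl i)).symm
  · filter_upwards [h] with z hz
    exact funext fun i => congrFun hz (Sum.inr (Sum.inl i))
  · filter_upwards [h] with z hz
    exact funext fun i => congrFun hz (Sum.inr (Sum.inr i))

end

section

variable (hab : a < b) (hcd : c < d) (hB : B.Mem a b c d) (hsep : B.Separable)
  (hE : InverseParam a b c d B Ehat)
include hab hcd hB hsep

lemma BH3_mem {f : ℝ × ℝ → State n₀ n₁ n₂ → ℝ} (hf : MemLp f 2 (mu2 a b c d)) :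
    RL.Mem a b c d (P011 a b c d B (H3 a b c d f)) :=
  P011_mem hab.le hcd.le hB hsep (H3Ker_app (a := a) (c := c) f ▸ H3Ker_mem.app_mem hf)

/-- Applying the linear operator `ℬ` to the affine boundary identity gives `ℬ Λ_bf u = ℬ ℋ₁ w + ℬ ℋ₃
f`. -/
lemma BΛ_eq {w : RL (Core0 n₁ n₂) (Core1 n₁ n₂)} {f : ℝ × ℝ → State n₀ n₁ n₂ → ℝ}
    (hw : RL.Mem a b c d w) (hf : MemLp f 2 (mu2 a b c d)) {u : L2 a b c d n₀ n₁ n₂}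
    (h : vals u =ᵐ[mu2 a b c d] Sol a c w f) :
    RL.Eq a b c d (P011 a b c d B (Λbf a b c d (comp1 u) (comp2 u)))
      (BH1 a b c d B w + P011 a b c d B (H3 a b c d f)) := by
  have h1 : comp1 u =ᵐ[mu2 a b c d] fun z i => Sol a c w f z (Sum.inr (Sum.inl i)) :=
    h.mono fun z hz => funext fun i => congrFun hz (Sum.inr (Sum.inl i))
  have h2 : comp2 u =ᵐ[mu2 a b c d] fun z i => Sol a c w f z (Sum.inr (Sum.inr i)) :=
    h.mono fun z hz => funext fun i => congrFun hz (Sum.inr (Sum.inr i))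
  exact (P011_congr hab.le hcd.le B (Λbf_eq hab hcd hw hf h1 h2)).trans
    (P011_add hab.le hcd.le hB hsep (P011_mem hab.le hcd.le H1Param_mem H1Param_separable hw)
      (H3Ker_app (a := a) (c := c) f ▸ H3Ker_mem.app_mem hf))

include hE

lemma core_eq {f : ℝ × ℝ → State n₀ n₁ n₂ → ℝ} (hf : MemLp f 2 (mu2 a b c d)) :
    RL.Eq a b c d (core a b c d B Ehat f)
      ((-1 : ℝ) • P011 a b c d Ehat (P011 a b c d B (H3 a b c d f))) := by
  have := ((GKer_app hab.le hcd.le hB hsep hE.mem hE.separable hf).symm).smul (-1)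
  rwa [neg_one_smul] at this

/-- The right inverse property of `Ê` is used: `ℬ ℋ₁ (-Ê ℬ ℋ₃ f) = -ℬ ℋ₃ f` cancels the contribution
of `f`. -/
lemma TOp_mem (u : L2 a b c d n₀ n₁ n₂) : TOp hab hcd hB hE.mem u ∈ X n₀ B := by
  have hf := memLp_vals u
  have h := vals_TOp hab hcd hB hE.mem u
  have hw := core_mem hab hcd hB hE.mem hf
  refine ⟨inH_one_Sol hab.le hcd.le hw hf
      (h.mono fun z hz => funext fun i => congrFun hz (Sum.inr (Sum.inl i))),
    inH_two_Sol hab.le hcd.le hw hf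
      (h.mono fun z hz => funext fun i => congrFun hz (Sum.inr (Sum.inr i))), ?_⟩
  have hy := BH3_mem hab hcd hB hsep hf
  have hEy := P011_mem hab.le hcd.le hE.mem hE.separable hy
  have e1 : RL.Eq a b c d (BH1 a b c d B (core a b c d B Ehat (vals u)))
      ((-1 : ℝ) • P011 a b c d B (H3 a b c d (vals u))) := by
    refine (BH1_congr hab.le hcd.le B (core_eq hab hcd hB hsep hE hf)).trans ?_
    refine (P011_congr hab.le hcd.le B
      (P011_smul hab.le hcd.le H1Param_mem H1Param_separable (-1) hEy)).trans ?_
    refine (P011_smul hab.le hcd.le hB hsep (-1)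
      (P011_mem hab.le hcd.le H1Param_mem H1Param_separable hEy)).trans ?_
    exact (hE.inverse _ hy).2.smul (-1)
  have := (BΛ_eq hab hcd hB hsep hw hf h).trans (e1.add (.refl _))
  rwa [neg_one_smul, neg_add_cancel] at this

/-- The left inverse property of `Ê` is used. Writing `u = Sol a c w f`, the boundary condition is
`ℬ ℋ₁ w = -ℬ ℋ₃ f`, so `w` must be the core data that the operator assigns to `f`, and `f` is the
preimage. -/
lemma TOp_surj {u : L2 a b c d n₀ n₁ n₂} (hu : u ∈ X n₀ B) :
    ∃ v, TOp hab hcd hB hE.mem v = u := by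
  obtain ⟨h1, h2, h3⟩ := hu
  obtain ⟨w, f, hw, hf, h⟩ := exists_Sol hab hcd
    (memLp_pi_iff.2 fun i => memLp_pi_iff.1 (memLp_vals u) (Sum.inl i)) h1 h2
  have hu : vals u =ᵐ[mu2 a b c d] Sol a c w f := by
    filter_upwards [h] with z hz
    rw [← hz]
    ext (i | i | i) <;> rfl
  refine ⟨ofVals hf, L2_ext ?_⟩
  have hy := BH3_mem hab hcd hB hsep hf
  have e1 := (BΛ_eq hab hcd hB hsep hw hf hu).symm.trans h3
  have e2 : RL.Eq a b c d (BH1 a b c d B w) ((-1 : ℝ) • P011 a b c d B (H3 a b c d f)) := by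
    have := e1.add (.refl ((-1 : ℝ) • P011 a b c d B (H3 a b c d f)))
    rwa [neg_one_smul, add_neg_cancel_right, zero_add, ← neg_one_smul ℝ] at this
  have e3 : RL.Eq a b c d (core a b c d B Ehat f) w :=
    (core_eq hab hcd hB hsep hE hf).trans <|
      (P011_smul hab.le hcd.le hE.mem hE.separable (-1) hy).symm.trans <|
      (P011_congr hab.le hcd.le Ehat e2).symm.trans (hE.inverse w hw).1
  filter_upwards [vals_TOp hab hcd hB hE.mem (ofVals hf), hu,
    Sol_core_congr hab hcd hB hE.mem (memLp_vals (ofVals hf)) hf (vals_ofVals hf),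
    ae_mem_rect a b c d] with ⟨x, y⟩ g1 g2 g3 hr
  rw [g1, g2, g3, Sol_congr (core_mem hab hcd hB hE.mem hf) hf e3 hr.1 hr.2]

end

end Unitary

end PIE2D

end

/-! ### The theorem. -/

theorem mainTheorem10 {a b c d : ℝ} (hab : a < b) (hcd : c < d) (n₀ n₁ n₂ : ℕ)
    (B : BParam n₁ n₂) (hB : B.Mem a b c d) (hsep : B.Separable) (hwp : WellPosed a b c d B) :
    -- there are separable parameters of the inverse operator
    (∃ Ehat : CoreParam n₁ n₂, InverseParam a b c d B Ehat) ∧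
    -- the explicit inversion formula, where it applies, yields such parameters
    (∀ (q : ℕ) (Q : Decomp (Core0 n₁ n₂) (Core1 n₁ n₂) (Fin q)),
      Q.Decomposes a b c d (EParam a b c d B) → Q.Invertible a b c d →
      InverseParam a b c d B (Q.Linv a b c d)) ∧
    -- for any such parameters, `T` maps `L₂` unitarily onto `X(ℬ)`
    ∀ Ehat : CoreParam n₁ n₂, InverseParam a b c d B Ehat →
      ∃ T : L2 a b c d n₀ n₁ n₂ →ₗ[ℝ] L2 a b c d n₀ n₁ n₂,
        (∀ (uhat : L2 a b c d n₀ n₁ n₂) (f : ℝ × ℝ → State n₀ n₁ n₂ → ℝ),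
          (∀ᵐ z ∂(mu2 a b c d), f z = (uhat z).ofLp) →
          ∀ᵐ z ∂(mu2 a b c d), (T uhat z).ofLp = P2D a b c d (TParam a b c d n₀ B Ehat) f z) ∧
        (∀ uhat, T uhat ∈ X n₀ B) ∧
        (∀ u ∈ X n₀ B, ∃ uhat, T uhat = u) ∧
        ∀ uhat vhat, innerX (T uhat) (T vhat) = inner ℝ uhat vhat := by
  obtain ⟨E₀, hE₀⟩ := exists_inverseParam hwp hab.le hcd.le
  refine ⟨⟨E₀, hE₀⟩, fun q Q hQ hinv => inverseParam_Linv hab.le hcd.le hB hsep hE₀ hQ hinv,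
    fun Ehat hE => ⟨TOp hab hcd hB hE.mem, fun uhat f hf => TOp_eq_P2D hab hcd hB hE.mem uhat hf,
      TOp_mem hab hcd hB hsep hE, fun u hu => TOp_surj hab hcd hB hsep hE hu,
      fun uhat vhat => ?_⟩⟩
  -- Since `𝒟` undoes `𝒯`, the inner product of `X` reduces to that of `L₂`.
  rw [innerX, Dop_eq (isD_TOp hab hcd hB hE.mem uhat), Dop_eq (isD_TOp hab hcd hB hE.mem vhat)]
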